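/- Let $k$ be a commutative ring and let $A$ be a reduced commutative shuffle algebra over $k$: a commutative non-unital monoid in the category of symmetric sequences of $k$-modules, with respect to the tensor product $(M\odot N)(\ell)=\bigoplus_{p+q=\ell}k\Sigma_\ell\otimes_{k\Sigma_p\otimes k\Sigma_q}M(p)\otimes N(q)$, such that $A(0)=0$. Assume that every $A(\ell)$ is projective as a $k$-module. For a reduced symmetric sequence $M$ let $\bar C(M)=\bigoplus_{i\ge 1}M^{\odot i}/\Sigma_i$ be the free commutative non-unital monoid on $M$, and for a reduced commutative shuffle algebra $B$ let $Q_a(B)=B/\mathrm{im}(B\odot B\to B)$ denote the indecomposables. The André–Quillen homology of $A$ is $$AQ_*(A)=H_*\bigl(Q_a(\bar C^{\bullet+1}(A))\bigr),$$ the homology of the chain complex associated with the standard free simplicial resolution $[n]\mapsto\bar C^{n+1}(A)$ of $A$. The Harrison homology of $A$ is $$Harr_*(A)=H_*(\mathrm{Indec}\,B(A)),$$ where $B(A)$ is the reduced bar complex, with $B(A)_s=A^{\odot s}$ for $s\ge 1$, $B(A)_0=0$ and $\partial[a_1|\cdots|a_s]=\sum_{1\le i<s}(-1)^{i-1}[a_1|\cdots|a_ia_{i+1}|\cdots|a_s]$,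 and $\mathrm{Indec}\,B(A)$ is its quotient by the image of the signed shuffle product $B(A)\odot B(A)\to B(A)$. Then $AQ_*(A)\cong\Sigma^{-1}Harr_*(A)$ as graded symmetric sequences; that is, $AQ_r(A)\cong Harr_{r+1}(A)$ as symmetric sequences of $k$-modules for all $r\ge 0$, and $Harr_0(A)=0$. -/

import Mathlib

open CategoryTheory

universe u

namespace ShuffleAlg

noncomputable section

/-- A symmetric sequence of `k`-modules: for every `ℓ` a `k`-module with a left action of
the symmetric group on `ℓ` letters. Morphisms are levelwise equivariant `k`-linear maps. -/
abbrev SymSeq (k : Type u) [CommRing k] : Type (u + 1) :=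
  ∀ ℓ : ℕ, Rep.{u} k (Equiv.Perm (Fin ℓ))

variable {k : Type u} [CommRing k]

/-- A reduced commutative shuffle algebra, i.e. a commutative (non-unital) monoid `A` for the
tensor product `⊙` of symmetric sequences, with `A(0) = 0`. An equivariant map
`A ⊙ A → A` out of `(A ⊙ A)(ℓ) = ⨁_{p+q=ℓ} kΣ_ℓ ⊗_{kΣ_p ⊗ kΣ_q} A(p) ⊗ A(q)` is the
same as a family of bilinear maps `a, b ↦ μ[σ ⊗ a ⊗ b]`, indexed by the bijections
`σ : {1,…,p} ⊔ {1,…,q} ≃ {1,…,ℓ}`, which is balanced over `Σ_p × Σ_q` and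
`Σ_ℓ`-equivariant. -/
structure ReducedCommShuffleAlg (k : Type u) [CommRing k] where
  /-- the underlying symmetric sequence -/
  X : SymSeq k
  /-- the value of the multiplication on the class of `σ ⊗ a ⊗ b` -/
  mul {p q ℓ : ℕ} (σ : Fin p ⊕ Fin q ≃ Fin ℓ) : X p →ₗ[k] X q →ₗ[k] X ℓ
  /-- the multiplication is `Σ_ℓ`-equivariant -/
  mul_act {p q ℓ : ℕ} (σ : Fin p ⊕ Fin q ≃ Fin ℓ) (π : Equiv.Perm (Fin ℓ)) (a : X p) (b : X q) :
    mul (σ.trans π) a b = (X ℓ).ρ π (mul σ a b)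
  /-- the multiplication is balanced over `Σ_p × Σ_q` -/
  mul_balanced {p q ℓ : ℕ} (σ : Fin p ⊕ Fin q ≃ Fin ℓ) (α : Equiv.Perm (Fin p))
    (β : Equiv.Perm (Fin q)) (a : X p) (b : X q) :
    mul ((Equiv.sumCongr α β).trans σ) a b = mul σ ((X p).ρ α a) ((X q).ρ β b)
  /-- commutativity: `μ ∘ tw = μ` -/
  mul_comm {p q ℓ : ℕ} (σ : Fin p ⊕ Fin q ≃ Fin ℓ) (a : X p) (b : X q) :
    mul ((Equiv.sumComm (Fin q) (Fin p)).trans σ) b a = mul σ a b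
  /-- associativity: the two ways to bracket a triple product agree whenever they use the same
  bijection `{1,…,p} ⊔ {1,…,q} ⊔ {1,…,r} ≃ {1,…,ℓ}` -/
  mul_assoc {p q r m n ℓ : ℕ} (σ : Fin p ⊕ Fin q ≃ Fin m) (τ : Fin m ⊕ Fin r ≃ Fin ℓ)
    (σ' : Fin q ⊕ Fin r ≃ Fin n) (τ' : Fin p ⊕ Fin n ≃ Fin ℓ)
    (h : (Equiv.sumCongr σ (Equiv.refl (Fin r))).trans τ =
      (Equiv.sumAssoc (Fin p) (Fin q) (Fin r)).trans
        ((Equiv.sumCongr (Equiv.refl (Fin p)) σ').trans τ'))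
    (a : X p) (b : X q) (c : X r) :
    mul τ (mul σ a b) c = mul τ' a (mul σ' b c)
  /-- `A(0) = 0` -/
  reduced : Subsingleton (X 0)

namespace ReducedCommShuffleAlg

/-- A morphism of commutative shuffle algebras: a multiplicative morphism of symmetric
sequences. -/
@[ext]
structure Hom (A B : ReducedCommShuffleAlg k) where
  /-- the underlying morphism of symmetric sequences -/
  f : ∀ ℓ : ℕ, A.X ℓ ⟶ B.X ℓ
  map_mul {p q ℓ : ℕ} (σ : Fin p ⊕ Fin q ≃ Fin ℓ) (a : A.X p) (b : A.X q) :
    (f ℓ).hom (A.mul σ a b) = B.mul σ ((f p).hom a) ((f q).hom b)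

instance : Category (ReducedCommShuffleAlg k) where
  Hom A B := Hom A B
  id A := { f := fun _ => 𝟙 _, map_mul := fun _ _ _ => rfl }
  comp g h :=
    { f := fun ℓ => g.f ℓ ≫ h.f ℓ
      map_mul := fun σ a b => by
        simp only [Rep.hom_comp, Representation.IntertwiningMap.comp_apply, g.map_mul, h.map_mul] }

@[ext]
theorem hom_ext {A B : ReducedCommShuffleAlg k} {g h : A ⟶ B} (H : ∀ ℓ, g.f ℓ = h.f ℓ) : g = h :=
  Hom.ext (funext H)

@[simp] theorem id_f (A : ReducedCommShuffleAlg k) (ℓ : ℕ) : Hom.f (𝟙 A) ℓ = 𝟙 (A.X ℓ) := rfl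

@[simp] theorem comp_f {A B C : ReducedCommShuffleAlg k} (g : A ⟶ B) (h : B ⟶ C) (ℓ : ℕ) :
    Hom.f (g ≫ h) ℓ = g.f ℓ ≫ h.f ℓ := rfl

end ReducedCommShuffleAlg

/-! ### Indecomposables -/

/-- The decomposable elements of level `ℓ`: the image of `A ⊙ A → A`. -/
def decomposables (A : ReducedCommShuffleAlg k) (ℓ : ℕ) : Submodule k (A.X ℓ) :=
  Submodule.span k {z | ∃ (p q : ℕ) (σ : Fin p ⊕ Fin q ≃ Fin ℓ) (a : A.X p) (b : A.X q),
    A.mul σ a b = z}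

theorem decomposables_act (A : ReducedCommShuffleAlg k) (ℓ : ℕ) (π : Equiv.Perm (Fin ℓ)) :
    decomposables A ℓ ≤ (decomposables A ℓ).comap ((A.X ℓ).ρ π) := by
  refine Submodule.span_le.2 ?_
  rintro _ ⟨p, q, σ, a, b, rfl⟩
  exact Submodule.subset_span ⟨p, q, σ.trans π, a, b, A.mul_act σ π a b⟩

theorem decomposables_map {A B : ReducedCommShuffleAlg k} (g : A ⟶ B) (ℓ : ℕ) :
    decomposables A ℓ ≤ (decomposables B ℓ).comap (g.f ℓ).hom.toLinearMap := by
  refine Submodule.span_le.2 ?_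
  rintro _ ⟨p, q, σ, a, b, rfl⟩
  exact Submodule.subset_span ⟨p, q, σ, _, _, (g.map_mul σ a b).symm⟩

/-- The functor `Q_a` of indecomposables in level `ℓ`: `A ↦ A(ℓ) / im (A ⊙ A → A)(ℓ)`. -/
def indecomposables (k : Type u) [CommRing k] (ℓ : ℕ) :
    ReducedCommShuffleAlg k ⥤ Rep.{u} k (Equiv.Perm (Fin ℓ)) where
  obj A := Rep.of ((A.X ℓ).ρ.quotient (decomposables A ℓ) (decomposables_act A ℓ))
  map {A B} g := Rep.ofHom
    { toLinearMap := Submodule.mapQ _ _ (g.f ℓ).hom.toLinearMap (decomposables_map g ℓ)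
      isIntertwining' := fun π => by
        refine Submodule.linearMap_qext _ ?_
        ext x
        simp [Rep.hom_comm_apply] }
  map_id A := by
    ext : 2
    refine Submodule.linearMap_qext _ ?_
    ext x
    simp
  map_comp g h := by
    ext : 2
    refine Submodule.linearMap_qext _ ?_
    ext x
    simp

/-! ### The chain complex of a standard resolution -/

section Standard

variable {C : Type*} [Category C] (G : C ⥤ C) (ε : G ⟶ 𝟭 C)

/-- `standardObj G A n` is `Gⁿ A`. -/
def standardObj (A : C) : ℕ → C
  | 0 => A
  | n + 1 => G.obj (standardObj A n)

/-- The face maps `dᵢ = Gⁱ ε G^(n-i) : Gⁿ⁺¹ A ⟶ Gⁿ A`, `0 ≤ i ≤ n`. For `n = 0` this is the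
augmentation `G A ⟶ A`; for `n = m + 1` these are the faces from simplicial degree `m + 1` to
simplicial degree `m` of the standard simplicial object `[m] ↦ Gᵐ⁺¹ A`. -/
def standardFace (A : C) : (n : ℕ) → Fin (n + 1) → (standardObj G A (n + 1) ⟶ standardObj G A n)
  | 0, _ => ε.app A
  | n + 1, i => Fin.cases (ε.app (G.obj (standardObj G A n)))
      (fun j => G.map (standardFace A n j)) i

theorem standardFace_comp (A : C) (n : ℕ) (i : Fin (n + 1)) (j : Fin (n + 2))
    (hij : i.castSucc < j) :
    standardFace G ε A (n + 1) j ≫ standardFace G ε A n i =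
      standardFace G ε A (n + 1) i.castSucc ≫
        standardFace G ε A n (j.pred (Fin.ne_zero_of_lt hij)) := by
  induction n with
  | zero =>
    obtain ⟨j, rfl⟩ := Fin.exists_succ_eq.2 (Fin.ne_zero_of_lt hij)
    obtain rfl : j = 0 := Fin.ext (by lia)
    obtain rfl : i = 0 := Fin.ext (by lia)
    exact ε.naturality (ε.app A)
  | succ n ih =>
    obtain ⟨j, rfl⟩ := Fin.exists_succ_eq.2 (Fin.ne_zero_of_lt hij)
    induction i using Fin.cases with
    | zero => exact ε.naturality _
    | succ i =>
      have hij' : i.castSucc < j := by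
        simpa [Fin.lt_def] using hij
      obtain ⟨j, rfl⟩ := Fin.exists_succ_eq.2 (Fin.ne_zero_of_lt hij')
      have := congrArg G.map (ih i j.succ hij')
      exact (G.map_comp _ _).symm.trans (this.trans (G.map_comp _ _))

variable {D : Type*} [Category D] [Preadditive D] (Q : C ⥤ D)

/-- The alternating sum `∑ᵢ (-1)ⁱ Q(dᵢ)`. -/
def standardD (A : C) (n : ℕ) :
    Q.obj (standardObj G A (n + 1)) ⟶ Q.obj (standardObj G A n) :=
  ∑ i : Fin (n + 1), (-1 : ℤ) ^ (i : ℕ) • Q.map (standardFace G ε A n i)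

theorem standardD_comp (A : C) (n : ℕ) :
    standardD G ε Q A (n + 1) ≫ standardD G ε Q A n = 0 := by
  simp only [standardD, Preadditive.comp_sum, Preadditive.sum_comp, ← Finset.sum_product']
  let P := Fin (n + 1) × Fin (n + 2)
  let S : Finset P := {ij : P | (ij.2 : ℕ) ≤ (ij.1 : ℕ)}
  rw [Finset.univ_product_univ, ← Finset.sum_add_sum_compl S, ← eq_neg_iff_add_eq_zero,
    ← Finset.sum_neg_distrib]
  let φ : ∀ ij : P, ij ∈ S → P := fun ij hij =>
    (Fin.castLT ij.2 (lt_of_le_of_lt (Finset.mem_filter.mp hij).right (Fin.is_lt ij.1)), ij.1.succ)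
  apply Finset.sum_bij φ
  · intro ij hij
    simp_rw [S, φ, Finset.compl_filter, Finset.mem_filter_univ, Fin.val_succ,
      Fin.val_castLT] at hij ⊢
    lia
  · rintro ⟨i, j⟩ hij ⟨i', j'⟩ hij' h
    rw [Prod.mk_inj]
    exact ⟨by simpa [φ] using! congr_arg Prod.snd h,
      by simpa [φ, Fin.castSucc_castLT] using! congr_arg Fin.castSucc (congr_arg Prod.fst h)⟩
  · rintro ⟨i', j'⟩ hij'
    simp_rw [S, Finset.compl_filter, Finset.mem_filter_univ, not_le] at hij'
    refine ⟨(j'.pred <| ?_, Fin.castSucc i'), ?_, ?_⟩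
    · rintro rfl
      simp only [Fin.val_zero, not_lt_zero] at hij'
    · simpa [S] using! Nat.le_sub_one_of_lt hij'
    · simp only [φ, Fin.castLT_castSucc, Fin.succ_pred]
  · rintro ⟨i, j⟩ hij
    dsimp
    simp only [Preadditive.zsmul_comp, Preadditive.comp_zsmul, smul_smul, ← neg_smul,
      ← Functor.map_comp]
    congr 1
    · simp only [φ, Fin.val_succ, pow_add, pow_one, mul_neg, neg_neg, mul_one]
      apply mul_comm
    · have hij2 : (j : ℕ) ≤ (i : ℕ) := by simpa [S] using! hij
      have := standardFace_comp G ε A n (φ (i, j) hij).1 i.succ (by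
        simp only [φ, Fin.lt_def, Fin.val_castSucc, Fin.val_castLT, Fin.val_succ]; lia)
      simp only [φ, Fin.castSucc_castLT, Fin.pred_succ] at this ⊢
      rw [this]

/-- The chain complex `⋯ ⟶ Q(G³ A) ⟶ Q(G² A) ⟶ Q(G A)` associated with the standard simplicial
object `G^(•+1) A`: in degree `n` it is `Q(Gⁿ⁺¹ A)`, and the differential is the alternating sum of
the faces. -/
def standardComplex (A : C) : ChainComplex D ℕ :=
  ChainComplex.of (fun n => Q.obj (standardObj G A (n + 1)))
    (fun n => standardD G ε Q A (n + 1)) (fun n => standardD_comp G ε Q A (n + 1))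

end Standard

/-! ### Words and tensor powers -/

/-- For a symmetric sequence `M`, a letter in `S` is a triple `(p, i, x)` with `x ∈ M(p)` and
`i : {1,…,p} → S` a map which assigns to the `p` inputs of `x` positions in `S`. -/
structure Letter (M : SymSeq k) (S : Type) where
  /-- the level `p` -/
  lvl : ℕ
  /-- the positions -/
  pos : Fin lvl → S
  /-- the element of `M(p)` -/
  elt : M lvl

/-- The list of all positions of the letters of a word. -/
def positions {M : SymSeq k} {S : Type} (w : List (Letter M S)) : List S :=
  w.flatMap fun t => List.ofFn t.pos

/-- The letters `(pⱼ, iⱼ, xⱼ)` of a word jointly define a bijection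
`{1,…,p₁} ⊔ ⋯ ⊔ {1,…,pₛ} ≃ S`: every element of `S` is a position exactly once. Such a word
stands for `σ ⊗ x₁ ⊗ ⋯ ⊗ xₛ`, where `σ` is this bijection. -/
def IsDecomposition {M : SymSeq k} {S : Type} (w : List (Letter M S)) : Prop :=
  (positions w).Nodup ∧ ∀ s : S, s ∈ positions w

/-- The relations of the tensor product over `k` and of its coequalizer for the actions of the
groups `Σ_{p₁} × ⋯ × Σ_{pₛ}`. -/
inductive TensorRel (M : SymSeq k) (S : Type) : (List (Letter M S) →₀ k) → Prop
  | add (l l' : List (Letter M S)) (p : ℕ) (i : Fin p → S) (x y : M p) :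
      TensorRel M S (Finsupp.single (l ++ ⟨p, i, x + y⟩ :: l') 1 -
        (Finsupp.single (l ++ ⟨p, i, x⟩ :: l') 1 + Finsupp.single (l ++ ⟨p, i, y⟩ :: l') 1))
  | smul (l l' : List (Letter M S)) (p : ℕ) (i : Fin p → S) (c : k) (x : M p) :
      TensorRel M S (Finsupp.single (l ++ ⟨p, i, c • x⟩ :: l') 1 -
        c • Finsupp.single (l ++ ⟨p, i, x⟩ :: l') 1)
  | balanced (l l' : List (Letter M S)) (p : ℕ) (i : Fin p → S) (π : Equiv.Perm (Fin p))
      (x : M p) :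
      TensorRel M S (Finsupp.single (l ++ ⟨p, i ∘ π, x⟩ :: l') 1 -
        Finsupp.single (l ++ ⟨p, i, (M p).ρ π x⟩ :: l') 1)

/-- The span of the relations `TensorRel`. -/
def tensorRel (M : SymSeq k) (S : Type) : Submodule k (List (Letter M S) →₀ k) :=
  Submodule.span k {z | TensorRel M S z}

/-- A function on words satisfies the relations of the tensor product. -/
structure Respects {M : SymSeq k} {S : Type} {N : Type*} [AddCommGroup N] [Module k N]
    (F : List (Letter M S) → N) : Prop where
  add (l l' : List (Letter M S)) (p : ℕ) (i : Fin p → S) (x y : M p) :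
      F (l ++ ⟨p, i, x + y⟩ :: l') = F (l ++ ⟨p, i, x⟩ :: l') + F (l ++ ⟨p, i, y⟩ :: l')
  smul (l l' : List (Letter M S)) (p : ℕ) (i : Fin p → S) (c : k) (x : M p) :
      F (l ++ ⟨p, i, c • x⟩ :: l') = c • F (l ++ ⟨p, i, x⟩ :: l')
  balanced (l l' : List (Letter M S)) (p : ℕ) (i : Fin p → S) (π : Equiv.Perm (Fin p)) (x : M p) :
      F (l ++ ⟨p, i ∘ π, x⟩ :: l') = F (l ++ ⟨p, i, (M p).ρ π x⟩ :: l')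

section

variable {M : SymSeq k} {S : Type} {N : Type*} [AddCommGroup N] [Module k N]

theorem respects_iff {f : (List (Letter M S) →₀ k) →ₗ[k] N} :
    tensorRel M S ≤ LinearMap.ker f ↔ Respects fun w => f (Finsupp.single w 1) := by
  constructor
  · intro h
    have H : ∀ z, TensorRel M S z → f z = 0 := fun z hz => h (Submodule.subset_span hz)
    refine ⟨fun l l' p i x y => ?_, fun l l' p i c x => ?_, fun l l' p i π x => ?_⟩
    · have := H _ (.add l l' p i x y)
      rwa [map_sub, sub_eq_zero, map_add] at this
    · have := H _ (.smul l l' p i c x)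
      rwa [map_sub, sub_eq_zero, map_smul] at this
    · have := H _ (.balanced l l' p i π x)
      rwa [map_sub, sub_eq_zero] at this
  · intro h
    refine Submodule.span_le.2 ?_
    rintro _ (⟨l, l', p, i, x, y⟩ | ⟨l, l', p, i, c, x⟩ | ⟨l, l', p, i, π, x⟩)
    · have := h.add l l' p i x y
      simp only [SetLike.mem_coe, LinearMap.mem_ker, map_sub, map_add, this, sub_self]
    · have := h.smul l l' p i c x
      simp only [SetLike.mem_coe, LinearMap.mem_ker, map_sub, map_smul, this, sub_self]
    · have := h.balanced l l' p i π x
      simp only [SetLike.mem_coe, LinearMap.mem_ker, map_sub, this, sub_self]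

theorem Respects.le_ker {F : List (Letter M S) → N} (h : Respects F) :
    tensorRel M S ≤ LinearMap.ker (Finsupp.linearCombination k F) :=
  respects_iff.2 (by simpa using h)

end

section

variable {M M' : SymSeq k} {S T : Type}

/-- Relabelling of the positions. -/
def Letter.relabel (g : S → T) (t : Letter M S) : Letter M T := ⟨t.lvl, g ∘ t.pos, t.elt⟩

/-- Application of a morphism of symmetric sequences to a letter. -/
def Letter.map (f : ∀ ℓ, M ℓ ⟶ M' ℓ) (t : Letter M S) : Letter M' S :=
  ⟨t.lvl, t.pos, (f t.lvl).hom t.elt⟩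

@[simp] theorem Letter.relabel_relabel {U : Type} (g : S → T) (h : T → U) (w : List (Letter M S)) :
    (w.map (Letter.relabel g)).map (Letter.relabel h) = w.map (Letter.relabel (h ∘ g)) := by
  rw [List.map_map]; rfl

theorem positions_relabel (g : S → T) (w : List (Letter M S)) :
    positions (w.map (Letter.relabel g)) = (positions w).map g := by
  simp [positions, List.flatMap_map, List.map_flatMap, Letter.relabel, List.map_ofFn]

theorem positions_map (f : ∀ ℓ, M ℓ ⟶ M' ℓ) (w : List (Letter M S)) :
    positions (w.map (Letter.map f)) = positions w := by
  simp [positions, List.flatMap_map, Letter.map]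

theorem positions_append (w w' : List (Letter M S)) :
    positions (w ++ w') = positions w ++ positions w' := by
  simp [positions]

theorem isDecomposition_relabel (g : S ≃ T) (w : List (Letter M S)) :
    IsDecomposition (w.map (Letter.relabel g)) ↔ IsDecomposition w := by
  simp only [IsDecomposition, positions_relabel, List.nodup_map_iff g.injective, List.mem_map]
  refine and_congr_right fun _ => ⟨fun h s => ?_, fun h t => ⟨g.symm t, h _, by simp⟩⟩
  obtain ⟨a, ha, h'⟩ := h (g s)
  rwa [← g.injective h']

theorem isDecomposition_map (f : ∀ ℓ, M ℓ ⟶ M' ℓ) (w : List (Letter M S)) :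
    IsDecomposition (w.map (Letter.map f)) ↔ IsDecomposition w := by
  simp only [IsDecomposition, positions_map]

theorem IsDecomposition.perm {w w' : List (Letter M S)} (h : w.Perm w') (hw : IsDecomposition w) :
    IsDecomposition w' :=
  have := List.Perm.flatMap_right (fun t : Letter M S => List.ofFn t.pos) h
  ⟨this.nodup_iff.1 hw.1, fun s => this.mem_iff.1 (hw.2 s)⟩

theorem Respects.relabel {N : Type*} [AddCommGroup N] [Module k N] {F : List (Letter M T) → N}
    (h : Respects F) (g : S → T) : Respects fun w => F (w.map (Letter.relabel g)) where
  add l l' p i x y := by simpa [Letter.relabel] using h.add _ _ p (g ∘ i) x y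
  smul l l' p i c x := by simpa [Letter.relabel] using h.smul _ _ p (g ∘ i) c x
  balanced l l' p i π x := by
    simpa [Letter.relabel, Function.comp_assoc] using h.balanced (l.map (Letter.relabel g))
      (l'.map (Letter.relabel g)) p (g ∘ i) π x

theorem Respects.map {N : Type*} [AddCommGroup N] [Module k N] {F : List (Letter M' S) → N}
    (h : Respects F) (f : ∀ ℓ, M ℓ ⟶ M' ℓ) : Respects fun w => F (w.map (Letter.map f)) where
  add l l' p i x y := by simpa [Letter.map] using h.add _ _ p i ((f p).hom x) ((f p).hom y)
  smul l l' p i c x := by simpa [Letter.map] using h.smul _ _ p i c ((f p).hom x)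
  balanced l l' p i π x := by
    simpa [Letter.map, Rep.hom_comm_apply] using h.balanced _ _ p i π ((f p).hom x)

theorem Respects.append_right {N : Type*} [AddCommGroup N] [Module k N]
    {F : List (Letter M S) → N} (h : Respects F) (v : List (Letter M S)) :
    Respects fun w => F (w ++ v) where
  add l l' p i x y := by simpa using h.add l (l' ++ v) p i x y
  smul l l' p i c x := by simpa using h.smul l (l' ++ v) p i c x
  balanced l l' p i π x := by simpa using h.balanced l (l' ++ v) p i π x

theorem Respects.append_left {N : Type*} [AddCommGroup N] [Module k N]
    {F : List (Letter M S) → N} (h : Respects F) (v : List (Letter M S)) :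
    Respects fun w => F (v ++ w) where
  add l l' p i x y := by simpa using h.add (v ++ l) l' p i x y
  smul l l' p i c x := by simpa using h.smul (v ++ l) l' p i c x
  balanced l l' p i π x := by simpa using h.balanced (v ++ l) l' p i π x

end

/-! ### The free commutative shuffle algebra -/

/-- The relations which cut out `⨁_{i ≥ 1} M^{⊙ i} / Σ_i` from the free module on all words:
the tensor relations, the invariance under permutations of the letters, and the vanishing of
those words which are empty or whose positions do not define a bijection onto `S`. -/
def freeRel (M : SymSeq k) (S : Type) : Submodule k (List (Letter M S) →₀ k) :=
  tensorRel M S ⊔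
    Submodule.span k {z | ∃ w w' : List (Letter M S), w.Perm w' ∧
      z = Finsupp.single w 1 - Finsupp.single w' 1} ⊔
    Submodule.span k {z | ∃ w : List (Letter M S), ¬ (w ≠ [] ∧ IsDecomposition w) ∧
      z = Finsupp.single w 1}

/-- The module `C̄(M)(S) = ⨁_{i ≥ 1} (M^{⊙ i} / Σ_i)(S)`. -/
abbrev FreeMod (M : SymSeq k) (S : Type) : Type u := (List (Letter M S) →₀ k) ⧸ freeRel M S

namespace FreeMod

variable {M M' : SymSeq k} {S T U : Type}

/-- The class of a word. -/
def mk (w : List (Letter M S)) : FreeMod M S := (freeRel M S).mkQ (Finsupp.single w 1)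

theorem mk_perm {w w' : List (Letter M S)} (h : w.Perm w') : mk w = mk w' := by
  rw [mk, mk, ← sub_eq_zero, ← map_sub, Submodule.mkQ_apply, Submodule.Quotient.mk_eq_zero]
  exact Submodule.mem_sup_left (Submodule.mem_sup_right (Submodule.subset_span ⟨w, w', h, rfl⟩))

theorem mk_eq_zero {w : List (Letter M S)} (h : ¬ (w ≠ [] ∧ IsDecomposition w)) : mk w = 0 := by
  rw [mk, Submodule.mkQ_apply, Submodule.Quotient.mk_eq_zero]
  exact Submodule.mem_sup_right (Submodule.subset_span ⟨w, h, rfl⟩)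

theorem respects_mk : Respects (mk : List (Letter M S) → FreeMod M S) :=
  respects_iff.1 (by rw [Submodule.ker_mkQ]; exact le_sup_left.trans le_sup_left)

/-- Linear maps out of `C̄(M)(S)`. -/
def lift {N : Type*} [AddCommGroup N] [Module k N] (F : List (Letter M S) → N) (h : Respects F)
    (hp : ∀ w w', w.Perm w' → F w = F w') (h0 : ∀ w, ¬ (w ≠ [] ∧ IsDecomposition w) → F w = 0) :
    FreeMod M S →ₗ[k] N :=
  (freeRel M S).liftQ (Finsupp.linearCombination k F) (by
    refine sup_le (sup_le h.le_ker (Submodule.span_le.2 ?_)) (Submodule.span_le.2 ?_)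
    · rintro _ ⟨w, w', hw, rfl⟩
      simp [hp w w' hw]
    · rintro _ ⟨w, hw, rfl⟩
      simp [h0 w hw])

@[simp] theorem lift_mk {N : Type*} [AddCommGroup N] [Module k N] (F : List (Letter M S) → N)
    (h hp h0) (w : List (Letter M S)) : lift F h hp h0 (mk w) = F w := by
  have : lift F h hp h0 (mk w) = Finsupp.linearCombination k F (Finsupp.single w 1) := rfl
  rw [this, Finsupp.linearCombination_single, one_smul]

theorem hom_ext {N : Type*} [AddCommGroup N] [Module k N] {f g : FreeMod M S →ₗ[k] N}
    (h : ∀ w, w ≠ [] → IsDecomposition w → f (mk w) = g (mk w)) : f = g := by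
  refine Submodule.linearMap_qext _ (Finsupp.lhom_ext' fun w => LinearMap.ext_ring ?_)
  change f (mk w) = g (mk w)
  by_cases hw : w ≠ [] ∧ IsDecomposition w
  · exact h w hw.1 hw.2
  · rw [mk_eq_zero hw, map_zero, map_zero]

theorem induction {p : FreeMod M S → Prop} (a : FreeMod M S) (zero : p 0)
    (add : ∀ x y, p x → p y → p (x + y)) (smul : ∀ (c : k) x, p x → p (c • x))
    (mk : ∀ w, w ≠ [] → IsDecomposition w → p (mk w)) : p a := by
  let V : Submodule k (FreeMod M S) :=
    { carrier := {x | p x}, zero_mem' := zero, add_mem' := add _ _, smul_mem' := smul }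
  have : V.mkQ = 0 := hom_ext fun w hw hw' => by
    simpa [V] using! mk w hw hw'
  have h : V.mkQ a = 0 := by rw [this, LinearMap.zero_apply]
  simpa [V] using! h

/-- Relabelling along a bijection. -/
def relabel (g : S ≃ T) : FreeMod M S →ₗ[k] FreeMod M T :=
  lift (fun w => mk (w.map (Letter.relabel g))) (respects_mk.relabel g)
    (fun _ _ h => mk_perm (h.map _))
    (fun w h => mk_eq_zero (by
      rwa [isDecomposition_relabel, Ne, List.map_eq_nil_iff]))

@[simp] theorem relabel_mk (g : S ≃ T) (w : List (Letter M S)) :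
    relabel g (mk w) = mk (w.map (Letter.relabel g)) := lift_mk ..

/-- Functoriality in the symmetric sequence. -/
def map (f : ∀ ℓ, M ℓ ⟶ M' ℓ) : FreeMod M S →ₗ[k] FreeMod M' S :=
  lift (fun w => mk (w.map (Letter.map f))) (respects_mk.map f)
    (fun _ _ h => mk_perm (h.map _))
    (fun w h => mk_eq_zero (by
      rwa [isDecomposition_map, Ne, List.map_eq_nil_iff]))

@[simp] theorem map_mk (f : ∀ ℓ, M ℓ ⟶ M' ℓ) (w : List (Letter M S)) :
    map f (mk w) = mk (w.map (Letter.map f)) := lift_mk ..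

theorem isDecomposition_append (σ : S ⊕ T ≃ U) (v : List (Letter M S)) (w : List (Letter M T)) :
    IsDecomposition (v.map (Letter.relabel (σ ∘ Sum.inl)) ++
      w.map (Letter.relabel (σ ∘ Sum.inr))) ↔ IsDecomposition v ∧ IsDecomposition w := by
  simp only [IsDecomposition, positions_append, positions_relabel, List.nodup_append,
    List.nodup_map_iff (σ.injective.comp Sum.inl_injective),
    List.nodup_map_iff (σ.injective.comp Sum.inr_injective), List.mem_append, List.mem_map,
    Function.comp_apply]
  constructor
  · rintro ⟨⟨h1, h2, -⟩, h4⟩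
    refine ⟨⟨h1, fun s => ?_⟩, ⟨h2, fun t => ?_⟩⟩
    · rcases h4 (σ (Sum.inl s)) with ⟨a, ha, h⟩ | ⟨a, ha, h⟩
      · simpa using (Sum.inl_injective (σ.injective h)) ▸ ha
      · simpa using σ.injective h
    · rcases h4 (σ (Sum.inr t)) with ⟨a, ha, h⟩ | ⟨a, ha, h⟩
      · simpa using σ.injective h
      · simpa using (Sum.inr_injective (σ.injective h)) ▸ ha
  · rintro ⟨⟨h1, h2⟩, ⟨h3, h4⟩⟩
    refine ⟨⟨h1, h3, ?_⟩, fun s => ?_⟩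
    · rintro _ ⟨a, -, rfl⟩ _ ⟨b, -, rfl⟩ h
      simpa using σ.injective h
    · rcases h : σ.symm s with a | a
      · exact Or.inl ⟨a, h2 a, by rw [← h, σ.apply_symm_apply]⟩
      · exact Or.inr ⟨a, h4 a, by rw [← h, σ.apply_symm_apply]⟩

theorem _root_.ShuffleAlg.Respects.ite {N : Type*} [AddCommGroup N] [Module k N]
    {F : List (Letter M S) → N} (h : Respects F) : Respects fun w => if w = [] then 0 else F w where
  add l l' p i x y := by simpa using h.add l l' p i x y
  smul l l' p i c x := by simpa using h.smul l l' p i c x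
  balanced l l' p i π x := by simpa using h.balanced l l' p i π x

open Classical in
/-- The product with a given word: concatenation of words. -/
def mulWord (σ : S ⊕ T ≃ U) (v : List (Letter M S)) : FreeMod M T →ₗ[k] FreeMod M U :=
  lift (fun w => if w = [] then 0 else mk (v.map (Letter.relabel (σ ∘ Sum.inl)) ++
        w.map (Letter.relabel (σ ∘ Sum.inr))))
      ((respects_mk.append_left _).relabel _).ite
      (fun w w' h => by
        have : w = [] ↔ w' = [] := by rw [← List.length_eq_zero_iff, h.length_eq,
          List.length_eq_zero_iff]
        simp only [this, mk_perm ((h.map (Letter.relabel (σ ∘ Sum.inr))).append_left _)])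
      (fun w h => by
        by_cases hw : w = []
        · simp [hw]
        · rw [if_neg hw]
          exact mk_eq_zero fun h' => h ⟨hw, ((isDecomposition_append σ v w).1 h'.2).2⟩)

theorem mulWord_mk (σ : S ⊕ T ≃ U) (v : List (Letter M S)) (w : List (Letter M T)) (hw : w ≠ []) :
    mulWord σ v (mk w) = mk (v.map (Letter.relabel (σ ∘ Sum.inl)) ++
        w.map (Letter.relabel (σ ∘ Sum.inr))) := by
  rw [mulWord, lift_mk, if_neg hw]

theorem respects_of_forall {N : Type*} [AddCommGroup N] [Module k N]
    {F : List (Letter M S) → FreeMod M T →ₗ[k] N}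
    (h : ∀ w : List (Letter M T), w ≠ [] → Respects fun v => F v (mk w)) : Respects F where
  add l l' p i x y := hom_ext fun w hw _ => (h w hw).add l l' p i x y
  smul l l' p i c x := hom_ext fun w hw _ => (h w hw).smul l l' p i c x
  balanced l l' p i π x := hom_ext fun w hw _ => (h w hw).balanced l l' p i π x

open Classical in
/-- The product `C̄(M)(S) ⊗ C̄(M)(T) → C̄(M)(U)` belonging to a bijection `S ⊔ T ≃ U`:
the concatenation of words. -/
def mul (σ : S ⊕ T ≃ U) : FreeMod M S →ₗ[k] FreeMod M T →ₗ[k] FreeMod M U :=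
  lift (fun v => if v = [] then 0 else mulWord σ v)
    (Respects.ite (respects_of_forall fun w hw => by
      simp only [mulWord_mk σ _ w hw]
      exact (respects_mk.append_right _).relabel _))
    (fun v v' h => by
      have : v = [] ↔ v' = [] := by rw [← List.length_eq_zero_iff, h.length_eq,
        List.length_eq_zero_iff]
      simp only [this]
      split_ifs
      · rfl
      · refine hom_ext fun w hw _ => ?_
        rw [mulWord_mk _ _ _ hw, mulWord_mk _ _ _ hw]
        exact mk_perm ((h.map _).append_right _))
    (fun v h => by
      by_cases hv : v = []
      · simp [hv]
      · rw [if_neg hv]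
        refine hom_ext fun w hw _ => ?_
        rw [mulWord_mk _ _ _ hw, LinearMap.zero_apply]
        exact mk_eq_zero fun h' => h ⟨hv, ((isDecomposition_append σ v w).1 h'.2).1⟩)

theorem mul_mk (σ : S ⊕ T ≃ U) {v : List (Letter M S)} {w : List (Letter M T)} (hv : v ≠ [])
    (hw : w ≠ []) : mul σ (mk v) (mk w) = mk (v.map (Letter.relabel (σ ∘ Sum.inl)) ++
        w.map (Letter.relabel (σ ∘ Sum.inr))) := by
  rw [mul, lift_mk, if_neg hv, mulWord_mk _ _ _ hw]

theorem hom_ext₂ {N : Type*} [AddCommGroup N] [Module k N]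
    {f g : FreeMod M S →ₗ[k] FreeMod M T →ₗ[k] N}
    (h : ∀ v w, v ≠ [] → w ≠ [] → f (mk v) (mk w) = g (mk v) (mk w)) : f = g :=
  hom_ext fun v hv _ => hom_ext fun w hw _ => h v w hv hw

theorem mul_assoc {V W X : Type} (σ : S ⊕ T ≃ V) (τ : V ⊕ U ≃ X) (σ' : T ⊕ U ≃ W) (τ' : S ⊕ W ≃ X)
    (h : (Equiv.sumCongr σ (Equiv.refl U)).trans τ =
      (Equiv.sumAssoc S T U).trans ((Equiv.sumCongr (Equiv.refl S) σ').trans τ'))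
    (a : FreeMod M S) (b : FreeMod M T) (c : FreeMod M U) :
    mul τ (mul σ a b) c = mul τ' a (mul σ' b c) := by
  induction a using FreeMod.induction with
  | zero => simp only [map_zero, LinearMap.zero_apply]
  | add x y hx hy => simp only [map_add, LinearMap.add_apply, hx, hy]
  | smul x y hx => simp only [map_smul, LinearMap.smul_apply, hx]
  | mk u hu _ =>
  induction b using FreeMod.induction with
  | zero => simp only [map_zero, LinearMap.zero_apply]
  | add x y hx hy => simp only [map_add, LinearMap.add_apply, hx, hy]
  | smul x y hx => simp only [map_smul, LinearMap.smul_apply, hx]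
  | mk v hv _ =>
  induction c using FreeMod.induction with
  | zero => simp only [map_zero]
  | add x y hx hy => simp only [map_add, hx, hy]
  | smul x y hx => simp only [map_smul, hx]
  | mk w hw _ =>
  rw [mul_mk _ hu hv, mul_mk _ hv hw, mul_mk _ (by simp [hu]) hw,
    mul_mk _ hu (by simp [hv])]
  simp only [List.map_append, Letter.relabel_relabel, List.append_assoc]
  have h1 : (τ ∘ Sum.inl) ∘ (σ ∘ Sum.inl) = τ' ∘ Sum.inl :=
    funext fun x => by simpa using Equiv.congr_fun h (Sum.inl (Sum.inl x))
  have h2 : (τ ∘ Sum.inl) ∘ (σ ∘ Sum.inr) = (τ' ∘ Sum.inr) ∘ (σ' ∘ Sum.inl) :=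
    funext fun x => by simpa using Equiv.congr_fun h (Sum.inl (Sum.inr x))
  have h3 : τ ∘ Sum.inr = (τ' ∘ Sum.inr) ∘ (σ' ∘ Sum.inr) :=
    funext fun x => by simpa using Equiv.congr_fun h (Sum.inr x)
  rw [h1, h2, h3]

end FreeMod

/-- The symmetric sequence `C̄(M) = ⨁_{i ≥ 1} M^{⊙ i} / Σ_i`. -/
def freeSeq (M : SymSeq k) : SymSeq k := fun ℓ => Rep.of
  { toFun := fun π : Equiv.Perm (Fin ℓ) => (FreeMod.relabel π : FreeMod M (Fin ℓ) →ₗ[k] _)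
    map_one' := FreeMod.hom_ext fun w _ _ => by
      have : (Letter.relabel id : Letter M (Fin ℓ) → _) = id := rfl
      simp [this]
    map_mul' := fun π π' => FreeMod.hom_ext fun w _ _ => by
      simp only [Module.End.mul_apply, FreeMod.relabel_mk, Letter.relabel_relabel]
      rfl }

theorem freeSeq_ρ (M : SymSeq k) (ℓ : ℕ) (π : Equiv.Perm (Fin ℓ)) :
    (freeSeq M ℓ).ρ π = (FreeMod.relabel π : FreeMod M (Fin ℓ) →ₗ[k] _) := rfl

/-- The free commutative non-unital monoid `C̄(M)` generated by a reduced symmetric sequence. -/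
def freeAlg (M : SymSeq k) (hM : Subsingleton (M 0)) : ReducedCommShuffleAlg k where
  X := freeSeq M
  mul σ := FreeMod.mul σ
  mul_act {p q ℓ} σ π a b := by
    have : FreeMod.mul (M := M) (σ.trans π) =
        (FreeMod.mul σ).compr₂ (FreeMod.relabel π) := by
      refine FreeMod.hom_ext₂ fun v w hv hw => ?_
      simp only [LinearMap.compr₂_apply, FreeMod.mul_mk _ hv hw, FreeMod.relabel_mk]
      simp only [List.map_append, Letter.relabel_relabel]
      rfl
    exact LinearMap.congr_fun (LinearMap.congr_fun this a) b
  mul_balanced {p q ℓ} σ α β a b := by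
    have : FreeMod.mul (M := M) ((Equiv.sumCongr α β).trans σ) =
        (FreeMod.mul σ).compl₁₂ (FreeMod.relabel α) (FreeMod.relabel β) := by
      refine FreeMod.hom_ext₂ fun v w hv hw => ?_
      simp only [LinearMap.compl₁₂_apply, FreeMod.relabel_mk]
      rw [FreeMod.mul_mk _ hv hw, FreeMod.mul_mk _ (by simpa using hv) (by simpa using hw)]
      simp only [Letter.relabel_relabel]
      rfl
    exact LinearMap.congr_fun (LinearMap.congr_fun this a) b
  mul_comm {p q ℓ} σ a b := by
    have : FreeMod.mul (M := M) ((Equiv.sumComm (Fin q) (Fin p)).trans σ) =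
        (FreeMod.mul σ).flip := by
      refine FreeMod.hom_ext₂ fun v w hv hw => ?_
      rw [LinearMap.flip_apply, FreeMod.mul_mk _ hv hw, FreeMod.mul_mk _ hw hv]
      exact FreeMod.mk_perm List.perm_append_comm
    exact LinearMap.congr_fun (LinearMap.congr_fun this b) a
  mul_assoc {p q r m n ℓ} σ τ σ' τ' h a b c := by
    exact FreeMod.mul_assoc σ τ σ' τ' h a b c
  reduced := by
    refine ⟨fun a b => ?_⟩
    have : ∀ a : FreeMod M (Fin 0), a = 0 := by
      intro a
      induction a using FreeMod.induction with
      | zero => rfl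
      | add x y hx hy => rw [hx, hy, add_zero]
      | smul x y hx => rw [hx, smul_zero]
      | mk u hu _ =>
      obtain - | ⟨⟨p, i, x⟩, l⟩ := u
      · exact absurd rfl hu
      · obtain - | p := p
        · have h := FreeMod.respects_mk.smul [] l 0 i (0 : k) x
          rw [zero_smul, zero_smul, Subsingleton.elim (0 : M 0) x] at h
          exact h
        · exact (i 0).elim0
    exact (this a).trans (this b).symm

/-! ### The structure map `C̄(A) → A` and the standard free resolution -/

/-- The map `M(m) → M(n)` induced by a bijection `{1,…,m} ≃ {1,…,n}` (so `m = n`). -/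
def transport (M : SymSeq k) {m n : ℕ} (e : Fin m ≃ Fin n) : M m →ₗ[k] M n :=
  have h : m = n := by simpa using Fintype.card_congr e
  match n, h, e with
  | _, rfl, e => (M m).ρ e

theorem transport_perm (M : SymSeq k) {n : ℕ} (e : Equiv.Perm (Fin n)) :
    transport M e = (M n).ρ e := rfl

theorem transport_trans (M : SymSeq k) {l m n : ℕ} (e : Fin l ≃ Fin m) (e' : Fin m ≃ Fin n)
    (x : M l) : transport M (e.trans e') x = transport M e' (transport M e x) := by
  obtain rfl : l = m := by simpa using Fintype.card_congr e
  obtain rfl : l = n := by simpa using Fintype.card_congr e'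
  simp only [transport_perm]
  rw [← Module.End.mul_apply, ← map_mul]
  rfl

theorem transport_refl (M : SymSeq k) {n : ℕ} (x : M n) :
    transport M (Equiv.refl (Fin n)) x = x := by
  rw [transport_perm]
  exact congrFun (congrArg DFunLike.coe (map_one (M n).ρ)) x

theorem map_transport {M M' : SymSeq k} (f : ∀ ℓ, M ℓ ⟶ M' ℓ) {m n : ℕ} (e : Fin m ≃ Fin n)
    (x : M m) : (f n).hom (transport M e x) = transport M' e ((f m).hom x) := by
  obtain rfl : m = n := by simpa using Fintype.card_congr e
  exact Rep.hom_comm_apply (f m) e x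

theorem mul_transport (A : ReducedCommShuffleAlg k) {p q m p' q' m' : ℕ} (σ : Fin p ⊕ Fin q ≃ Fin m)
    (σ' : Fin p' ⊕ Fin q' ≃ Fin m') (e : Fin p ≃ Fin p') (e' : Fin q ≃ Fin q')
    (g : Fin m ≃ Fin m') (h : (Equiv.sumCongr e e').trans σ' = σ.trans g) (a : A.X p)
    (b : A.X q) :
    A.mul σ' (transport A.X e a) (transport A.X e' b) = transport A.X g (A.mul σ a b) := by
  obtain rfl : p = p' := by simpa using Fintype.card_congr e
  obtain rfl : q = q' := by simpa using Fintype.card_congr e'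
  obtain rfl : m = m' := by simpa using Fintype.card_congr g
  simp only [transport_perm]
  rw [← A.mul_balanced, h, A.mul_act]

section

variable {M : SymSeq k} {S T : Type}

/-- Two letters are identified if they differ by a bijection of their inputs. -/
def LetterEquiv (s t : Letter M S) : Prop :=
  ∃ e : Fin s.lvl ≃ Fin t.lvl, t.pos ∘ e = s.pos ∧ transport M e s.elt = t.elt

theorem LetterEquiv.refl (s : Letter M S) : LetterEquiv s s :=
  ⟨Equiv.refl _, rfl, transport_refl _ _⟩

theorem LetterEquiv.trans {s t u : Letter M S} (h : LetterEquiv s t) (h' : LetterEquiv t u) :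
    LetterEquiv s u := by
  obtain ⟨e, h1, h2⟩ := h
  obtain ⟨e', h1', h2'⟩ := h'
  refine ⟨e.trans e', ?_, ?_⟩
  · rw [← h1, ← h1']; rfl
  · rw [transport_trans, h2, h2']

theorem LetterEquiv.symm {s t : Letter M S} (h : LetterEquiv s t) : LetterEquiv t s := by
  obtain ⟨e, h1, h2⟩ := h
  refine ⟨e.symm, ?_, ?_⟩
  · rw [← h1]; ext; simp
  · rw [← h2, ← transport_trans, Equiv.self_trans_symm, transport_refl]

theorem letterEquiv_balanced {p : ℕ} (i : Fin p → S) (π : Equiv.Perm (Fin p)) (x : M p) :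
    LetterEquiv (M := M) ⟨p, i ∘ π, x⟩ ⟨p, i, (M p).ρ π x⟩ := ⟨π, rfl, rfl⟩

theorem Respects.congr_aux {N : Type*} [AddCommGroup N] [Module k N] {F : List (Letter M S) → N}
    (h : Respects F) (l l' : List (Letter M S)) {p q : ℕ} (i : Fin p → S) (j : Fin q → S)
    (x : M p) (y : M q) (e : Fin p ≃ Fin q) (h1 : j ∘ e = i) (h2 : transport M e x = y) :
    F (l ++ ⟨p, i, x⟩ :: l') = F (l ++ ⟨q, j, y⟩ :: l') := by
  obtain rfl : p = q := by simpa using Fintype.card_congr e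
  subst h1 h2
  exact h.balanced l l' p j e x

theorem Respects.congr {N : Type*} [AddCommGroup N] [Module k N] {F : List (Letter M S) → N}
    (h : Respects F) {s t : Letter M S} (hst : LetterEquiv s t) (l l' : List (Letter M S)) :
    F (l ++ s :: l') = F (l ++ t :: l') := by
  obtain ⟨e, h1, h2⟩ := hst
  exact h.congr_aux l l' s.pos t.pos s.elt t.elt e h1 h2

open Classical in
/-- The element of `M(ℓ)` represented by a letter whose positions form a bijection onto
`{1,…,ℓ}`. -/
def Letter.toElt {ℓ : ℕ} (t : Letter M (Fin ℓ)) : M ℓ :=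
  if h : Function.Bijective t.pos then transport M (Equiv.ofBijective _ h) t.elt else 0

theorem Letter.toElt_of_equiv {ℓ : ℕ} (t : Letter M (Fin ℓ)) (e : Fin t.lvl ≃ Fin ℓ)
    (h : ⇑e = t.pos) : t.toElt = transport M e t.elt := by
  have hb : Function.Bijective t.pos := h ▸ e.bijective
  rw [Letter.toElt, dif_pos hb]
  congr 2
  ext x
  simp [h]

theorem Letter.toElt_congr {ℓ : ℕ} {s t : Letter M (Fin ℓ)} (h : LetterEquiv s t) :
    s.toElt = t.toElt := by
  obtain ⟨e, h1, h2⟩ := h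
  by_cases hb : Function.Bijective t.pos
  · rw [Letter.toElt_of_equiv t (Equiv.ofBijective _ hb) rfl,
      Letter.toElt_of_equiv s (e.trans (Equiv.ofBijective _ hb)) (by rw [← h1]; rfl),
      transport_trans, h2]
  · rw [Letter.toElt, Letter.toElt, dif_neg hb, dif_neg]
    rwa [← h1, Function.Bijective.of_comp_iff _ e.bijective]

theorem Letter.toElt_add {ℓ p : ℕ} (i : Fin p → Fin ℓ) (x y : M p) :
    Letter.toElt (M := M) ⟨p, i, x + y⟩ = Letter.toElt (M := M) ⟨p, i, x⟩ +
      Letter.toElt (M := M) ⟨p, i, y⟩ := by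
  unfold Letter.toElt
  dsimp only
  split_ifs <;> simp

theorem Letter.toElt_smul {ℓ p : ℕ} (i : Fin p → Fin ℓ) (c : k) (x : M p) :
    Letter.toElt (M := M) ⟨p, i, c • x⟩ = c • Letter.toElt (M := M) ⟨p, i, x⟩ := by
  unfold Letter.toElt
  dsimp only
  split_ifs <;> simp

end

section

variable {A B : ReducedCommShuffleAlg k} {S T : Type}

/-- The product of two letters of a commutative shuffle algebra: the product of the elements,
in the order given by the concatenation of the positions. -/
def mulLetter (s t : Letter A.X S) : Letter A.X S :=
  ⟨s.lvl + t.lvl, Fin.append s.pos t.pos, A.mul finSumFinEquiv s.elt t.elt⟩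

theorem append_finSumFinEquiv {p q : ℕ} (i : Fin p → S) (j : Fin q → S) :
    Fin.append i j ∘ finSumFinEquiv = Sum.elim i j := by
  ext (x | x) <;> simp

theorem mulLetter_equiv {s t u : Letter A.X S} (e : Fin s.lvl ⊕ Fin t.lvl ≃ Fin u.lvl)
    (hpos : u.pos ∘ e = Sum.elim s.pos t.pos) (helt : A.mul e s.elt t.elt = u.elt) :
    LetterEquiv (mulLetter s t) u := by
  refine ⟨(finSumFinEquiv.symm.trans e : Fin (s.lvl + t.lvl) ≃ Fin u.lvl), ?_, ?_⟩
  · change u.pos ∘ (e ∘ finSumFinEquiv.symm) = Fin.append s.pos t.pos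
    rw [← Function.comp_assoc, hpos, ← append_finSumFinEquiv, Function.comp_assoc,
      Equiv.self_comp_symm, Function.comp_id]
  · change transport A.X (finSumFinEquiv.symm.trans e) (A.mul finSumFinEquiv s.elt t.elt) = u.elt
    rw [← mul_transport A finSumFinEquiv e (Equiv.refl _) (Equiv.refl _), transport_refl,
      transport_refl, helt]
    ext x; simp

theorem mulLetter_congr {s s' t t' : Letter A.X S} (h : LetterEquiv s s') (h' : LetterEquiv t t') :
    LetterEquiv (mulLetter s t) (mulLetter s' t') := by
  obtain ⟨e, h1, h2⟩ := h
  obtain ⟨e', h1', h2'⟩ := h'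
  refine mulLetter_equiv ((Equiv.sumCongr e e').trans finSumFinEquiv) ?_ ?_
  · change Fin.append s'.pos t'.pos ∘ (finSumFinEquiv ∘ Sum.map e e') = _
    rw [← Function.comp_assoc, append_finSumFinEquiv, Sum.elim_comp_map, h1, h1']
  · change _ = A.mul finSumFinEquiv s'.elt t'.elt
    rw [← h2, ← h2', mul_transport A ((Equiv.sumCongr e e').trans finSumFinEquiv) finSumFinEquiv e e'
      (Equiv.refl _) rfl, transport_refl]
    rfl

theorem mulLetter_comm (s t : Letter A.X S) : LetterEquiv (mulLetter s t) (mulLetter t s) := by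
  refine mulLetter_equiv ((Equiv.sumComm _ _).trans finSumFinEquiv) ?_ (A.mul_comm _ _ _)
  change Fin.append t.pos s.pos ∘ (finSumFinEquiv ∘ Sum.swap) = _
  rw [← Function.comp_assoc, append_finSumFinEquiv, Sum.elim_swap]

theorem mulLetter_assoc (s t u : Letter A.X S) :
    LetterEquiv (mulLetter (mulLetter s t) u) (mulLetter s (mulLetter t u)) := by
  let e : Fin (s.lvl + t.lvl) ⊕ Fin u.lvl ≃ Fin (s.lvl + (t.lvl + u.lvl)) :=
    (Equiv.sumCongr finSumFinEquiv.symm (Equiv.refl _)).trans ((Equiv.sumAssoc _ _ _).trans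
      ((Equiv.sumCongr (Equiv.refl _) finSumFinEquiv).trans finSumFinEquiv))
  have he : (Equiv.sumCongr finSumFinEquiv (Equiv.refl _)).trans e = (Equiv.sumAssoc _ _ _).trans
      ((Equiv.sumCongr (Equiv.refl _) finSumFinEquiv).trans finSumFinEquiv) := by
    ext x
    rcases x with (x | x) | x <;> simp [e]
  refine mulLetter_equiv e ?_ (A.mul_assoc finSumFinEquiv e finSumFinEquiv finSumFinEquiv he _ _ _)
  change Fin.append s.pos (Fin.append t.pos u.pos) ∘ e =
    Sum.elim (Fin.append s.pos t.pos) u.pos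
  ext x
  obtain ⟨x, rfl⟩ := (Equiv.sumCongr finSumFinEquiv (Equiv.refl (Fin u.lvl))).surjective x
  have := Equiv.congr_fun he x
  simp only [Equiv.trans_apply] at this
  rw [Function.comp_apply, this]
  rcases x with (x | x) | x <;> simp

theorem relabel_mulLetter (g : S → T) (s t : Letter A.X S) :
    (mulLetter s t).relabel g = mulLetter (s.relabel g) (t.relabel g) := by
  have : g ∘ Fin.append s.pos t.pos = Fin.append (g ∘ s.pos) (g ∘ t.pos) := by
    ext x
    refine Fin.addCases (fun x => ?_) (fun x => ?_) x <;> simp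
  simp only [mulLetter, Letter.relabel, this]
  rfl

theorem map_mulLetter (f : A ⟶ B) (s t : Letter A.X S) :
    (mulLetter s t).map f.f = mulLetter (s.map f.f) (t.map f.f) := by
  exact congrArg (fun x => (⟨s.lvl + t.lvl, Fin.append s.pos t.pos, x⟩ : Letter B.X S))
    (f.map_mul finSumFinEquiv s.elt t.elt)

theorem toElt_mulLetter {p q ℓ : ℕ} (σ : Fin p ⊕ Fin q ≃ Fin ℓ) (s : Letter A.X (Fin p))
    (t : Letter A.X (Fin q)) (hs : Function.Bijective s.pos) (ht : Function.Bijective t.pos) :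
    (mulLetter (s.relabel (σ ∘ Sum.inl)) (t.relabel (σ ∘ Sum.inr))).toElt =
      A.mul σ s.toElt t.toElt := by
  let τ := (Equiv.sumCongr (Equiv.ofBijective _ hs) (Equiv.ofBijective _ ht)).trans σ
  have h : LetterEquiv (mulLetter (s.relabel (σ ∘ Sum.inl)) (t.relabel (σ ∘ Sum.inr)))
      (⟨ℓ, id, A.mul τ s.elt t.elt⟩ : Letter A.X (Fin ℓ)) := by
    refine mulLetter_equiv (s := s.relabel (σ ∘ Sum.inl)) (t := t.relabel (σ ∘ Sum.inr))
      (u := ⟨ℓ, id, A.mul τ s.elt t.elt⟩) τ ?_ rfl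
    ext (x | x) <;> rfl
  rw [Letter.toElt_congr h, Letter.toElt_of_equiv _ (Equiv.refl (Fin ℓ)) rfl, transport_refl,
    Letter.toElt_of_equiv s (Equiv.ofBijective _ hs) rfl,
    Letter.toElt_of_equiv t (Equiv.ofBijective _ ht) rfl,
    mul_transport A τ σ _ _ (Equiv.refl _) rfl, transport_refl]

/-- The product of all letters of a word (`none` for the empty word). -/
def prodWord : List (Letter A.X S) → Option (Letter A.X S)
  | [] => none
  | t :: w => match prodWord w with
    | none => some t
    | some s => some (mulLetter t s)

theorem prodWord_cons_some {t s : Letter A.X S} {w : List (Letter A.X S)}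
    (h : prodWord w = some s) : prodWord (t :: w) = some (mulLetter t s) := by
  simp [prodWord, h]

theorem exists_prodWord {w : List (Letter A.X S)} (hw : w ≠ []) : ∃ s, prodWord w = some s := by
  obtain - | ⟨t, w⟩ := w
  · exact absurd rfl hw
  · rw [prodWord]; split <;> exact ⟨_, rfl⟩

theorem prodWord_eq_none {w : List (Letter A.X S)} (h : prodWord w = none) : w = [] := by
  by_contra hw
  obtain ⟨s, hs⟩ := exists_prodWord hw
  simp [hs] at h

theorem prodWord_add (l l' : List (Letter A.X S)) (p : ℕ) (i : Fin p → S) (x y : A.X p) :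
    ∃ (q : ℕ) (j : Fin q → S) (X Y : A.X q), prodWord (l ++ ⟨p, i, x + y⟩ :: l') =
      some ⟨q, j, X + Y⟩ ∧ prodWord (l ++ ⟨p, i, x⟩ :: l') = some ⟨q, j, X⟩ ∧
      prodWord (l ++ ⟨p, i, y⟩ :: l') = some ⟨q, j, Y⟩ := by
  induction l with
  | nil =>
    rcases h : prodWord l' with - | s
    · exact ⟨p, i, x, y, by simp [prodWord, h], by simp [prodWord, h], by simp [prodWord, h]⟩
    · exact ⟨_, _, _, _, by simp only [List.nil_append, prodWord, h, mulLetter, map_add,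
        LinearMap.add_apply]; rfl, by simp only [List.nil_append, prodWord, h, mulLetter],
        by simp only [List.nil_append, prodWord, h, mulLetter]⟩
  | cons t l ih =>
    obtain ⟨q, j, X, Y, h1, h2, h3⟩ := ih
    exact ⟨_, _, _, _, by simp only [List.cons_append, prodWord, h1, mulLetter, map_add]; rfl,
      by simp only [List.cons_append, prodWord, h2, mulLetter],
      by simp only [List.cons_append, prodWord, h3, mulLetter]⟩

theorem prodWord_smul (l l' : List (Letter A.X S)) (p : ℕ) (i : Fin p → S) (c : k) (x : A.X p) :
    ∃ (q : ℕ) (j : Fin q → S) (X : A.X q), prodWord (l ++ ⟨p, i, c • x⟩ :: l') =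
      some ⟨q, j, c • X⟩ ∧ prodWord (l ++ ⟨p, i, x⟩ :: l') = some ⟨q, j, X⟩ := by
  induction l with
  | nil =>
    rcases h : prodWord l' with - | s
    · exact ⟨p, i, x, by simp [prodWord, h], by simp [prodWord, h]⟩
    · exact ⟨_, _, _, by simp only [List.nil_append, prodWord, h, mulLetter, map_smul,
        LinearMap.smul_apply]; rfl, by simp only [List.nil_append, prodWord, h, mulLetter]⟩
  | cons t l ih =>
    obtain ⟨q, j, X, h1, h2⟩ := ih
    exact ⟨_, _, _, by simp only [List.cons_append, prodWord, h1, mulLetter, map_smul]; rfl,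
      by simp only [List.cons_append, prodWord, h2, mulLetter]⟩

theorem prodWord_congr (l l' : List (Letter A.X S)) {s t : Letter A.X S} (hst : LetterEquiv s t) :
    ∃ u v, prodWord (l ++ s :: l') = some u ∧ prodWord (l ++ t :: l') = some v ∧
      LetterEquiv u v := by
  induction l with
  | nil =>
    rcases h : prodWord l' with - | r
    · exact ⟨s, t, by simp [prodWord, h], by simp [prodWord, h], hst⟩
    · exact ⟨_, _, prodWord_cons_some h, prodWord_cons_some h, mulLetter_congr hst (.refl _)⟩
  | cons r l ih =>
    obtain ⟨u, v, h1, h2, h3⟩ := ih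
    exact ⟨_, _, prodWord_cons_some h1, prodWord_cons_some h2, mulLetter_congr (.refl _) h3⟩

theorem prodWord_perm {w w' : List (Letter A.X S)} (h : w.Perm w') (hw : w ≠ []) :
    ∃ u v, prodWord w = some u ∧ prodWord w' = some v ∧ LetterEquiv u v := by
  induction h with
  | nil => exact absurd rfl hw
  | @cons t l l' h ih =>
    by_cases hl : l = []
    · subst hl
      obtain rfl := h.nil_eq
      exact ⟨t, t, rfl, rfl, .refl _⟩
    · obtain ⟨u, v, h1, h2, h3⟩ := ih hl
      exact ⟨_, _, prodWord_cons_some h1, prodWord_cons_some h2, mulLetter_congr (.refl _) h3⟩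
  | swap s t l =>
    rcases h : prodWord l with - | r
    · refine ⟨mulLetter t s, mulLetter s t, ?_, ?_, mulLetter_comm _ _⟩ <;> simp [prodWord, h]
    · exact ⟨_, _, prodWord_cons_some (prodWord_cons_some h),
        prodWord_cons_some (prodWord_cons_some h),
        (mulLetter_assoc _ _ _).symm.trans
          ((mulLetter_congr (mulLetter_comm _ _) (.refl _)).trans (mulLetter_assoc _ _ _))⟩
  | trans h h' ih ih' =>
    obtain ⟨u, v, h1, h2, h3⟩ := ih hw
    obtain ⟨u', v', h1', h2', h3'⟩ := ih' fun h0 => hw (by subst h0; exact h.eq_nil)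
    obtain rfl : v = u' := Option.some.inj (h2.symm.trans h1')
    exact ⟨u, v', h1, h2', h3.trans h3'⟩

theorem prodWord_append {v w : List (Letter A.X S)} {s t : Letter A.X S}
    (hv : prodWord v = some s) (hw : prodWord w = some t) :
    ∃ u, prodWord (v ++ w) = some u ∧ LetterEquiv u (mulLetter s t) := by
  induction v generalizing s with
  | nil => simp [prodWord] at hv
  | cons r v ih =>
    rcases h : prodWord v with - | s'
    · obtain rfl := prodWord_eq_none h
      obtain rfl : r = s := by simpa [prodWord] using hv
      exact ⟨_, prodWord_cons_some hw, .refl _⟩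
    · obtain rfl : mulLetter r s' = s := by simpa [prodWord, h] using hv
      obtain ⟨u, h1, h2⟩ := ih h
      exact ⟨_, prodWord_cons_some h1,
        (mulLetter_congr (.refl _) h2).trans (mulLetter_assoc _ _ _).symm⟩

theorem prodWord_relabel (g : S → T) (w : List (Letter A.X S)) :
    prodWord (w.map (Letter.relabel g)) = (prodWord w).map (Letter.relabel g) := by
  induction w with
  | nil => rfl
  | cons t w ih =>
    rw [List.map_cons, prodWord, ih, prodWord]
    rcases prodWord w with - | s
    · rfl
    · exact congrArg some (relabel_mulLetter g t s).symm

theorem prodWord_map (f : A ⟶ B) (w : List (Letter A.X S)) :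
    prodWord (w.map (Letter.map f.f)) = (prodWord w).map (Letter.map f.f) := by
  induction w with
  | nil => rfl
  | cons t w ih =>
    rw [List.map_cons, prodWord, ih, prodWord]
    rcases prodWord w with - | s
    · rfl
    · exact congrArg some (map_mulLetter f t s).symm

theorem positions_mulLetter (s t : Letter A.X S) (w : List (Letter A.X S)) :
    positions (mulLetter s t :: w) = positions (s :: t :: w) := by
  simp [positions, mulLetter, List.ofFn_fin_append]

theorem prodWord_positions {w : List (Letter A.X S)} {s : Letter A.X S} (h : prodWord w = some s) :
    positions w = List.ofFn s.pos := by
  induction w generalizing s with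
  | nil => simp [prodWord] at h
  | cons t w ih =>
    rcases h' : prodWord w with - | s'
    · obtain rfl := prodWord_eq_none h'
      obtain rfl : t = s := by simpa [prodWord] using h
      simp [positions]
    · obtain rfl : mulLetter t s' = s := by simpa [prodWord, h'] using h
      have := ih h'
      simp only [positions, List.flatMap_cons, mulLetter, List.ofFn_fin_append] at this ⊢
      rw [this]

theorem prodWord_bijective {w : List (Letter A.X S)} {s : Letter A.X S} (h : prodWord w = some s) :
    Function.Bijective s.pos ↔ IsDecomposition w := by
  rw [IsDecomposition, prodWord_positions h, List.nodup_ofFn]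
  simp [Function.Bijective, Function.Surjective, List.mem_ofFn]

/-- The product in `A` of the letters of a word over `{1,…,ℓ}`. -/
def evalWord {ℓ : ℕ} (w : List (Letter A.X (Fin ℓ))) : A.X ℓ :=
  match prodWord w with
  | none => 0
  | some s => s.toElt

theorem evalWord_some {ℓ : ℕ} {w : List (Letter A.X (Fin ℓ))} {s : Letter A.X (Fin ℓ)}
    (h : prodWord w = some s) : evalWord w = s.toElt := by
  rw [evalWord, h]

theorem respects_evalWord (A : ReducedCommShuffleAlg k) (ℓ : ℕ) :
    Respects (evalWord : List (Letter A.X (Fin ℓ)) → A.X ℓ) where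
  add l l' p i x y := by
    obtain ⟨q, j, X, Y, h1, h2, h3⟩ := prodWord_add l l' p i x y
    rw [evalWord_some h1, evalWord_some h2, evalWord_some h3, Letter.toElt_add]
  smul l l' p i c x := by
    obtain ⟨q, j, X, h1, h2⟩ := prodWord_smul l l' p i c x
    rw [evalWord_some h1, evalWord_some h2, Letter.toElt_smul]
  balanced l l' p i π x := by
    obtain ⟨u, v, h1, h2, h3⟩ := prodWord_congr (A := A) l l' (letterEquiv_balanced i π x)
    rw [evalWord_some h1, evalWord_some h2, Letter.toElt_congr h3]

/-- The structure map `C̄(A)(ℓ) → A(ℓ)`, which multiplies the letters of a word. -/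
def eval (A : ReducedCommShuffleAlg k) (ℓ : ℕ) : FreeMod A.X (Fin ℓ) →ₗ[k] A.X ℓ :=
  FreeMod.lift evalWord (respects_evalWord A ℓ)
    (fun w w' h => by
      by_cases hw : w = []
      · subst hw
        obtain rfl := h.nil_eq
        rfl
      · obtain ⟨u, v, h1, h2, h3⟩ := prodWord_perm h hw
        rw [evalWord_some h1, evalWord_some h2, Letter.toElt_congr h3])
    (fun w h => by
      by_cases hw : w = []
      · subst hw
        rfl
      · obtain ⟨s, hs⟩ := exists_prodWord hw
        rw [evalWord_some hs, Letter.toElt, dif_neg]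
        rw [prodWord_bijective hs]
        exact fun h' => h ⟨hw, h'⟩)

@[simp] theorem eval_mk {ℓ : ℕ} (w : List (Letter A.X (Fin ℓ))) :
    eval A ℓ (FreeMod.mk w) = evalWord w := FreeMod.lift_mk ..

theorem eval_mul {p q ℓ : ℕ} (σ : Fin p ⊕ Fin q ≃ Fin ℓ) (a : FreeMod A.X (Fin p))
    (b : FreeMod A.X (Fin q)) :
    eval A ℓ (FreeMod.mul σ a b) = A.mul σ (eval A p a) (eval A q b) := by
  induction a using FreeMod.induction with
  | zero => simp only [map_zero, LinearMap.zero_apply]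
  | add x y hx hy => simp only [map_add, LinearMap.add_apply, hx, hy]
  | smul x y hx => simp only [map_smul, LinearMap.smul_apply, hx]
  | mk v hv hv' =>
  induction b using FreeMod.induction with
  | zero => simp only [map_zero]
  | add x y hx hy => simp only [map_add, hx, hy]
  | smul x y hx => simp only [map_smul, hx]
  | mk w hw hw' =>
  obtain ⟨s, hs⟩ := exists_prodWord hv
  obtain ⟨t, ht⟩ := exists_prodWord hw
  obtain ⟨u, h1, h2⟩ := prodWord_append (v := v.map (Letter.relabel (σ ∘ Sum.inl)))
    (w := w.map (Letter.relabel (σ ∘ Sum.inr)))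
    (s := s.relabel (σ ∘ Sum.inl)) (t := t.relabel (σ ∘ Sum.inr))
    (by rw [prodWord_relabel, hs]; rfl) (by rw [prodWord_relabel, ht]; rfl)
  rw [FreeMod.mul_mk _ hv hw, eval_mk, eval_mk, eval_mk, evalWord_some hs, evalWord_some ht,
    evalWord_some h1, Letter.toElt_congr h2, toElt_mulLetter _ _ _ ((prodWord_bijective hs).2 hv')
    ((prodWord_bijective ht).2 hw')]

end

/-- The endofunctor `A ↦ C̄(A)` of the category of reduced commutative shuffle algebras: the free
algebra on the underlying symmetric sequence of `A`. -/
def freeFunctor (k : Type u) [CommRing k] : ReducedCommShuffleAlg k ⥤ ReducedCommShuffleAlg k where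
  obj A := freeAlg A.X A.reduced
  map {A B} g :=
    { f := fun ℓ => Rep.ofHom
        { toLinearMap := FreeMod.map g.f
          isIntertwining' := fun π => by
            refine FreeMod.hom_ext fun w _ _ => ?_
            change FreeMod.map g.f (FreeMod.relabel π (FreeMod.mk w)) =
              FreeMod.relabel π (FreeMod.map g.f (FreeMod.mk w))
            rw [FreeMod.relabel_mk, FreeMod.map_mk, FreeMod.map_mk, FreeMod.relabel_mk, List.map_map,
              List.map_map]
            rfl }
      map_mul := fun {p q ℓ} σ a b => by
        change FreeMod.map g.f (FreeMod.mul σ a b) =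
          FreeMod.mul σ (FreeMod.map g.f a) (FreeMod.map g.f b)
        have : (FreeMod.mul (M := A.X) σ).compr₂ (FreeMod.map g.f) =
            (FreeMod.mul σ).compl₁₂ (FreeMod.map g.f) (FreeMod.map g.f) := by
          refine FreeMod.hom_ext₂ fun v w hv hw => ?_
          rw [LinearMap.compr₂_apply, LinearMap.compl₁₂_apply, FreeMod.mul_mk _ hv hw,
            FreeMod.map_mk, FreeMod.map_mk, FreeMod.map_mk,
            FreeMod.mul_mk _ (by simpa using hv) (by simpa using hw)]
          simp only [List.map_append, List.map_map]
          rfl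
        exact LinearMap.congr_fun (LinearMap.congr_fun this a) b }
  map_id A := by
    ext ℓ : 3
    refine FreeMod.hom_ext fun w _ _ => ?_
    change FreeMod.map _ (FreeMod.mk w) = FreeMod.mk w
    rw [FreeMod.map_mk]
    exact congrArg FreeMod.mk (List.map_id _)
  map_comp g h := by
    ext ℓ : 3
    refine FreeMod.hom_ext fun w _ _ => ?_
    change FreeMod.map _ (FreeMod.mk w) = FreeMod.map _ (FreeMod.map _ (FreeMod.mk w))
    rw [FreeMod.map_mk, FreeMod.map_mk, FreeMod.map_mk, List.map_map]
    rfl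

/-- The natural map `C̄(A) → A` of commutative shuffle algebras which codifies the multiplication
of `A`. -/
def freeCounit (k : Type u) [CommRing k] : freeFunctor k ⟶ 𝟭 (ReducedCommShuffleAlg k) where
  app A :=
    { f := fun ℓ => Rep.ofHom
        { toLinearMap := eval A ℓ
          isIntertwining' := fun π => by
            refine FreeMod.hom_ext fun w hw hw' => ?_
            change eval A ℓ (FreeMod.relabel π (FreeMod.mk w)) =
              (A.X ℓ).ρ π (eval A ℓ (FreeMod.mk w))
            obtain ⟨s, hs⟩ := exists_prodWord hw
            rw [FreeMod.relabel_mk, eval_mk, eval_mk, evalWord_some hs,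
              evalWord_some (s := s.relabel π) (by rw [prodWord_relabel, hs]; rfl)]
            have hb := (prodWord_bijective hs).2 hw'
            rw [Letter.toElt_of_equiv s (Equiv.ofBijective _ hb) rfl,
              Letter.toElt_of_equiv (s.relabel π) ((Equiv.ofBijective _ hb).trans π) rfl,
              ← transport_perm]
            exact transport_trans _ _ _ _ }
      map_mul := fun σ a b => eval_mul σ a b }
  naturality A B g := by
    ext ℓ : 3
    refine FreeMod.hom_ext fun w hw hw' => ?_
    change eval B ℓ (FreeMod.map g.f (FreeMod.mk w)) = (g.f ℓ).hom (eval A ℓ (FreeMod.mk w))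
    obtain ⟨s, hs⟩ := exists_prodWord hw
    rw [FreeMod.map_mk, eval_mk, eval_mk, evalWord_some hs,
      evalWord_some (s := s.map g.f) (by rw [prodWord_map, hs]; rfl)]
    have hb := (prodWord_bijective hs).2 hw'
    rw [Letter.toElt_of_equiv s (Equiv.ofBijective _ hb) rfl,
      Letter.toElt_of_equiv (s.map g.f) (Equiv.ofBijective _ hb) rfl, map_transport]
    rfl

/-- The chain complex `Q_a(C̄^{•+1}(A))` in level `ℓ`. -/
def aqComplex (A : ReducedCommShuffleAlg k) (ℓ : ℕ) : ChainComplex (Rep.{u} k (Equiv.Perm (Fin ℓ))) ℕ :=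
  standardComplex (freeFunctor k) (freeCounit k) (indecomposables k ℓ) A

/-- André–Quillen homology `AQ_r(A) = H_r(Q_a(C̄^{•+1}(A)))`, a symmetric sequence. -/
def andreQuillen (A : ReducedCommShuffleAlg k) (r : ℕ) : SymSeq k := fun ℓ => (aqComplex A ℓ).homology r

/-! ### The bar complex -/

section

variable {M : SymSeq k} {S T : Type}

/-- The word with first letter `t` followed by a given word, extended linearly. -/
def consL (t : Letter M S) : (List (Letter M S) →₀ k) →ₗ[k] (List (Letter M S) →₀ k) :=
  Finsupp.linearCombination k fun w => Finsupp.single (t :: w) 1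

@[simp] theorem consL_single (t : Letter M S) (w : List (Letter M S)) :
    consL t (Finsupp.single w (1 : k)) = Finsupp.single (t :: w) 1 := by
  simp [consL]

theorem word_hom_ext {N : Type*} [AddCommGroup N] [Module k N]
    {f g : (List (Letter M S) →₀ k) →ₗ[k] N}
    (h : ∀ w, f (Finsupp.single w 1) = g (Finsupp.single w 1)) : f = g :=
  Finsupp.lhom_ext' fun w => LinearMap.ext_ring (h w)

/-- The signed shuffle product of two words, whose letters all have degree `1`:
`(a u) ⧢ (b v) = a (u ⧢ b v) + (-1)^{|a u|} b (a u ⧢ v)`. It is the sum over all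
`(p,q)`-shuffles of the letters, with the signs of the shuffles. -/
def shuffle : List (Letter M S) → List (Letter M S) → (List (Letter M S) →₀ k)
  | [], v => Finsupp.single v 1
  | a :: u, [] => Finsupp.single (a :: u) 1
  | a :: u, b :: v => consL a (shuffle u (b :: v)) +
      (-1 : k) ^ (u.length + 1) • consL b (shuffle (a :: u) v)
termination_by u v => u.length + v.length

end

section

variable {A : ReducedCommShuffleAlg k} {S T : Type}

/-- `mulFirst a (b v) = (ab) v`, and `mulFirst a` vanishes on the empty word. -/
def mulFirst (a : Letter A.X S) : List (Letter A.X S) → (List (Letter A.X S) →₀ k)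
  | [] => 0
  | b :: v => Finsupp.single (mulLetter a b :: v) 1

/-- The differential of the bar construction on words,
`∂[a₁|⋯|aₛ] = ∑ (-1)^(i-1) [a₁|⋯|aᵢ aᵢ₊₁|⋯|aₛ]` (sum over `1 ≤ i < s`), in recursive form. -/
def bdry : List (Letter A.X S) → (List (Letter A.X S) →₀ k)
  | [] => 0
  | a :: v => mulFirst a v - consL a (bdry v)

/-- Linear extension of `bdry`. -/
def bdryL : (List (Letter A.X S) →₀ k) →ₗ[k] (List (Letter A.X S) →₀ k) :=
  Finsupp.linearCombination k bdry

/-- Linear extension of `mulFirst`. -/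
def mulFirstL (a : Letter A.X S) : (List (Letter A.X S) →₀ k) →ₗ[k] (List (Letter A.X S) →₀ k) :=
  Finsupp.linearCombination k (mulFirst a)

@[simp] theorem bdryL_single (w : List (Letter A.X S)) :
    bdryL (Finsupp.single w (1 : k)) = bdry w := by simp [bdryL]

@[simp] theorem mulFirstL_single (a : Letter A.X S) (w : List (Letter A.X S)) :
    mulFirstL a (Finsupp.single w (1 : k)) = mulFirst a w := by simp [mulFirstL]

theorem bdryL_consL (a : Letter A.X S) (z : List (Letter A.X S) →₀ k) :
    bdryL (consL a z) = mulFirstL a z - consL a (bdryL z) := by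
  have : bdryL ∘ₗ consL a = mulFirstL a - consL a ∘ₗ bdryL :=
    word_hom_ext fun w => by simp [bdry]
  exact LinearMap.congr_fun this z

theorem mulFirstL_consL (a b : Letter A.X S) (z : List (Letter A.X S) →₀ k) :
    mulFirstL a (consL b z) = consL (mulLetter a b) z := by
  have : mulFirstL a ∘ₗ consL b = consL (mulLetter a b) :=
    word_hom_ext fun w => by simp [mulFirst]
  exact LinearMap.congr_fun this z

end

section

variable {M : SymSeq k} {S : Type}

/-- The relations between letters. -/
inductive LetterRel (M : SymSeq k) (S : Type) : (Letter M S →₀ k) → Prop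
  | add (p : ℕ) (i : Fin p → S) (x y : M p) : LetterRel M S (Finsupp.single ⟨p, i, x + y⟩ 1 -
      (Finsupp.single ⟨p, i, x⟩ 1 + Finsupp.single ⟨p, i, y⟩ 1))
  | smul (p : ℕ) (i : Fin p → S) (c : k) (x : M p) :
      LetterRel M S (Finsupp.single ⟨p, i, c • x⟩ 1 - c • Finsupp.single ⟨p, i, x⟩ 1)
  | equiv (s t : Letter M S) (h : LetterEquiv s t) :
      LetterRel M S (Finsupp.single s 1 - Finsupp.single t 1)

/-- A function on letters, extended linearly, kills the relations between letters. -/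
def LetterRespects {N : Type*} [AddCommGroup N] [Module k N] (F : Letter M S → N) : Prop :=
  ∀ z, LetterRel M S z → Finsupp.linearCombination k F z = 0

theorem Respects.letter {N : Type*} [AddCommGroup N] [Module k N] {F : List (Letter M S) → N}
    (h : Respects F) (l l' : List (Letter M S)) : LetterRespects fun t => F (l ++ t :: l') := by
  rintro _ (⟨p, i, x, y⟩ | ⟨p, i, c, x⟩ | ⟨s, t, hst⟩)
  · simp [h.add]
  · simp [h.smul]
  · simp [h.congr hst]

theorem respects_of_letter {N : Type*} [AddCommGroup N] [Module k N] {F : List (Letter M S) → N}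
    (h : ∀ l l', LetterRespects fun t => F (l ++ t :: l')) : Respects F where
  add l l' p i x y := by
    have := h l l' _ (.add p i x y)
    rw [map_sub, map_add, sub_eq_zero] at this
    simpa using this
  smul l l' p i c x := by
    have := h l l' _ (.smul p i c x)
    rw [map_sub, map_smul, sub_eq_zero] at this
    simpa using this
  balanced l l' p i π x := by
    have := h l l' _ (.equiv _ _ (letterEquiv_balanced i π x))
    rw [map_sub, sub_eq_zero] at this
    simpa using this

theorem LetterRespects.sub {N : Type*} [AddCommGroup N] [Module k N] {F G : Letter M S → N}
    (hF : LetterRespects F) (hG : LetterRespects G) : LetterRespects fun t => F t - G t := by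
  intro z hz
  have : Finsupp.linearCombination k (fun t => F t - G t) =
      Finsupp.linearCombination k F - Finsupp.linearCombination k G :=
    Finsupp.lhom_ext' fun w => LinearMap.ext_ring (by simp)
  rw [this, LinearMap.sub_apply, hF z hz, hG z hz, sub_zero]

theorem LetterRespects.comp {N N' : Type*} [AddCommGroup N] [Module k N] [AddCommGroup N']
    [Module k N'] {F : Letter M S → N} (hF : LetterRespects F) (f : N →ₗ[k] N') :
    LetterRespects fun t => f (F t) := by
  intro z hz
  have : Finsupp.linearCombination k (fun t => f (F t)) = f ∘ₗ Finsupp.linearCombination k F :=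
    Finsupp.lhom_ext' fun w => LinearMap.ext_ring (by simp)
  rw [this, LinearMap.comp_apply, hF z hz, map_zero]

theorem letterRespects_zero {N : Type*} [AddCommGroup N] [Module k N] :
    LetterRespects fun _ : Letter M S => (0 : N) := by
  intro z _
  have : Finsupp.linearCombination k (fun _ : Letter M S => (0 : N)) = 0 :=
    Finsupp.lhom_ext' fun w => LinearMap.ext_ring (by simp)
  rw [this, LinearMap.zero_apply]

theorem LetterRespects.mul_left {A : ReducedCommShuffleAlg k} {N : Type*} [AddCommGroup N] [Module k N]
    {F : Letter A.X S → N} (hF : LetterRespects F) (s : Letter A.X S) :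
    LetterRespects fun t => F (mulLetter s t) := by
  rintro _ (⟨p, i, x, y⟩ | ⟨p, i, c, x⟩ | ⟨t, t', h⟩)
  · simpa [mulLetter] using hF _ (.add _ (Fin.append s.pos i) (A.mul finSumFinEquiv s.elt x)
      (A.mul finSumFinEquiv s.elt y))
  · simpa [mulLetter] using hF _ (.smul _ (Fin.append s.pos i) c (A.mul finSumFinEquiv s.elt x))
  · simpa using hF _ (.equiv _ _ (mulLetter_congr (LetterEquiv.refl s) h))

theorem LetterRespects.mul_right {A : ReducedCommShuffleAlg k} {N : Type*} [AddCommGroup N] [Module k N]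
    {F : Letter A.X S → N} (hF : LetterRespects F) (s : Letter A.X S) :
    LetterRespects fun t => F (mulLetter t s) := by
  rintro _ (⟨p, i, x, y⟩ | ⟨p, i, c, x⟩ | ⟨t, t', h⟩)
  · simpa [mulLetter] using hF _ (.add _ (Fin.append i s.pos) (A.mul finSumFinEquiv x s.elt)
      (A.mul finSumFinEquiv y s.elt))
  · simpa [mulLetter] using hF _ (.smul _ (Fin.append i s.pos) c (A.mul finSumFinEquiv x s.elt))
  · simpa using hF _ (.equiv _ _ (mulLetter_congr h (LetterEquiv.refl s)))

/-- The quotient map of the tensor relations. -/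
abbrev tq (M : SymSeq k) (S : Type) :
    (List (Letter M S) →₀ k) →ₗ[k] (List (Letter M S) →₀ k) ⧸ tensorRel M S :=
  (tensorRel M S).mkQ

theorem respects_tq : Respects fun w : List (Letter M S) => tq M S (Finsupp.single w 1) :=
  respects_iff.1 (by rw [Submodule.ker_mkQ])

theorem tensorRel_consL (t : Letter M S) :
    tensorRel M S ≤ (tensorRel M S).comap (consL t) := by
  have h : Respects fun w : List (Letter M S) => (tq M S ∘ₗ consL t) (Finsupp.single w 1) := by
    simpa using respects_tq.append_left [t]
  have := respects_iff.2 h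
  rwa [LinearMap.ker_comp, Submodule.ker_mkQ] at this

theorem tq_consL (t : Letter M S) (z : List (Letter M S) →₀ k) :
    tq M S (consL t z) = (tensorRel M S).mapQ _ (consL t) (tensorRel_consL t) (tq M S z) := rfl

theorem letterRespects_consL (z : List (Letter M S) →₀ k) :
    LetterRespects fun t : Letter M S => tq M S (consL t z) := by
  intro r hr
  have key : ∀ z : List (Letter M S) →₀ k,
      Finsupp.linearCombination k (fun t : Letter M S => tq M S (consL t z)) r = 0 := by
    intro z
    induction z using Finsupp.induction_linear with
    | zero =>
      simpa using letterRespects_zero r hr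
    | add x y hx hy =>
      have : Finsupp.linearCombination k (fun t : Letter M S => tq M S (consL t (x + y))) =
          Finsupp.linearCombination k (fun t : Letter M S => tq M S (consL t x)) +
          Finsupp.linearCombination k (fun t : Letter M S => tq M S (consL t y)) :=
        Finsupp.lhom_ext' fun w => LinearMap.ext_ring (by simp)
      rw [this, LinearMap.add_apply, hx, hy, add_zero]
    | single w c =>
      have : Finsupp.linearCombination k
          (fun t : Letter M S => tq M S (consL t (Finsupp.single w c))) =
          c • Finsupp.linearCombination k
            (fun t : Letter M S => tq M S (Finsupp.single ([] ++ t :: w) 1)) := by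
        refine Finsupp.lhom_ext' fun t => LinearMap.ext_ring ?_
        have : Finsupp.single w c = c • Finsupp.single w (1 : k) := by simp
        rw [this]
        simp only [map_smul, consL_single, LinearMap.comp_apply, Finsupp.lsingle_apply,
          Finsupp.linearCombination_single, one_smul, LinearMap.smul_apply, List.nil_append]
      rw [this, LinearMap.smul_apply, respects_tq.letter [] w r hr, smul_zero]
  exact key z

end

section

variable {A : ReducedCommShuffleAlg k} {S T : Type}

theorem letterRespects_mulFirst (a : Letter A.X S) (l l' : List (Letter A.X S)) :
    LetterRespects fun t => tq A.X S (mulFirst a (l ++ t :: l')) := by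
  obtain - | ⟨r, l⟩ := l
  · exact (respects_tq.letter [] l').mul_left a
  · exact respects_tq.letter (mulLetter a r :: l) l'

theorem letterRespects_bdry (l l' : List (Letter A.X S)) :
    LetterRespects fun t => tq A.X S (bdry (l ++ t :: l')) := by
  induction l with
  | nil =>
    simp only [List.nil_append, bdry, map_sub]
    refine LetterRespects.sub ?_ (letterRespects_consL _)
    obtain - | ⟨r, l'⟩ := l'
    · simpa only [mulFirst, map_zero] using letterRespects_zero
    · exact (respects_tq.letter [] l').mul_right r
  | cons r l ih =>
    simp only [List.cons_append, bdry, map_sub]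
    exact LetterRespects.sub (letterRespects_mulFirst r l l')
      (ih.comp ((tensorRel A.X S).mapQ _ (consL r) (tensorRel_consL r)))

theorem tensorRel_bdryL : tensorRel A.X S ≤ (tensorRel A.X S).comap bdryL := by
  have h : Respects fun w : List (Letter A.X S) =>
      (tq A.X S ∘ₗ bdryL) (Finsupp.single w 1) := by
    simp only [LinearMap.comp_apply, bdryL_single]
    exact respects_of_letter (F := fun w => tq A.X S (bdry w)) letterRespects_bdry
  have := respects_iff.2 h
  rwa [LinearMap.ker_comp, Submodule.ker_mkQ] at this

theorem mulFirst_assoc (a b : Letter A.X S) (v : List (Letter A.X S)) :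
    tq A.X S (mulFirstL a (mulFirst b v)) = tq A.X S (mulFirst (mulLetter a b) v) := by
  obtain - | ⟨c, v⟩ := v
  · simp [mulFirst]
  · simp only [mulFirst, mulFirstL_single]
    exact (respects_tq.congr (mulLetter_assoc a b c) [] v).symm

theorem bdryL_bdry (w : List (Letter A.X S)) : tq A.X S (bdryL (bdry w)) = 0 := by
  induction w with
  | nil => simp [bdry]
  | cons a v ih =>
    rw [bdry, map_sub, bdryL_consL, map_sub, map_sub, tq_consL, ih, map_zero, sub_zero]
    obtain - | ⟨b, v⟩ := v
    · simp [mulFirst, bdry]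
    · rw [mulFirst, bdryL_single, bdry, bdry, map_sub, map_sub, map_sub, mulFirst_assoc,
        mulFirstL_consL, sub_self]

theorem bdry_mem (w : List (Letter A.X S)) : bdry w ∈ Finsupp.supported k k
    {w' : List (Letter A.X S) | w' ≠ [] ∧ w'.length + 1 = w.length ∧
      positions w' = positions w} := by
  induction w with
  | nil => simp [bdry]
  | cons a v ih =>
    rw [bdry]
    refine Submodule.sub_mem _ ?_ ?_
    · obtain - | ⟨b, v⟩ := v
      · simp [mulFirst]
      · exact Finsupp.single_mem_supported k _ ⟨by simp, by simp, positions_mulLetter a b v⟩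
    · have h : Finsupp.supported k k {w' : List (Letter A.X S) | w' ≠ [] ∧
          w'.length + 1 = v.length ∧ positions w' = positions v} ≤ (Finsupp.supported k k
          {w' : List (Letter A.X S) | w' ≠ [] ∧ w'.length + 1 = (a :: v).length ∧
            positions w' = positions (a :: v)}).comap (consL a) := by
        rw [Finsupp.supported_eq_span_single]
        refine Submodule.span_le.2 ?_
        rintro _ ⟨w', ⟨-, h1, h2⟩, rfl⟩
        simp only [SetLike.mem_coe, Submodule.mem_comap, consL_single]
        refine Finsupp.single_mem_supported k _ ⟨by simp, by simp [h1], ?_⟩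
        simp only [positions] at h2
        simp [positions, h2]
      exact h ih

end

/-- The relations which cut out `M^{⊙ s}` from the free module on all words: the tensor relations,
and the vanishing of those words which do not have `s` letters or whose positions do not define a
bijection onto `S`. The empty word is also excluded, so that nothing is left for `s = 0`. -/
def barRel (M : SymSeq k) (s : ℕ) (S : Type) : Submodule k (List (Letter M S) →₀ k) :=
  tensorRel M S ⊔ Submodule.span k {z | ∃ w : List (Letter M S),
    ¬ (w ≠ [] ∧ w.length = s ∧ IsDecomposition w) ∧ z = Finsupp.single w 1}

/-- The degree `s` part of the (reduced) bar construction: `M^{⊙ s}` for `s ≥ 1`, and `0`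
for `s = 0`. -/
abbrev BarMod (M : SymSeq k) (s : ℕ) (S : Type) : Type u :=
  (List (Letter M S) →₀ k) ⧸ barRel M s S

namespace BarMod

variable {M : SymSeq k} {A : ReducedCommShuffleAlg k} {S T : Type} {s : ℕ}

/-- The class of a linear combination of words in `M^{⊙ s}`. -/
abbrev q (M : SymSeq k) (s : ℕ) (S : Type) : (List (Letter M S) →₀ k) →ₗ[k] BarMod M s S :=
  (barRel M s S).mkQ

theorem q_single_eq_zero {w : List (Letter M S)}
    (h : ¬ (w ≠ [] ∧ w.length = s ∧ IsDecomposition w)) : q M s S (Finsupp.single w 1) = 0 := by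
  rw [Submodule.mkQ_apply, Submodule.Quotient.mk_eq_zero]
  exact Submodule.mem_sup_right (Submodule.subset_span ⟨w, h, rfl⟩)

theorem tensorRel_le : tensorRel M S ≤ barRel M s S := le_sup_left

theorem q_eq_of_tq {x y : List (Letter M S) →₀ k} (h : tq M S x = tq M S y) :
    q M s S x = q M s S y := by
  rw [← sub_eq_zero, ← map_sub, Submodule.mkQ_apply, Submodule.Quotient.mk_eq_zero] at h ⊢
  exact tensorRel_le h

theorem respects_q : Respects fun w : List (Letter M S) => q M s S (Finsupp.single w 1) :=
  respects_iff.1 (by rw [Submodule.ker_mkQ]; exact tensorRel_le)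

/-- Linear maps out of `M^{⊙ s}`. -/
def lift {N : Type*} [AddCommGroup N] [Module k N] (f : (List (Letter M S) →₀ k) →ₗ[k] N)
    (h : tensorRel M S ≤ LinearMap.ker f)
    (h0 : ∀ w, ¬ (w ≠ [] ∧ w.length = s ∧ IsDecomposition w) → f (Finsupp.single w 1) = 0) :
    BarMod M s S →ₗ[k] N :=
  (barRel M s S).liftQ f (sup_le h (Submodule.span_le.2 (by
    rintro _ ⟨w, hw, rfl⟩
    exact h0 w hw)))

@[simp] theorem lift_q {N : Type*} [AddCommGroup N] [Module k N]
    (f : (List (Letter M S) →₀ k) →ₗ[k] N) (h) (h0) (z : List (Letter M S) →₀ k) :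
    lift (s := s) f h h0 (q M s S z) = f z := rfl

theorem hom_ext {N : Type*} [AddCommGroup N] [Module k N] {f g : BarMod M s S →ₗ[k] N}
    (h : ∀ w, f (q M s S (Finsupp.single w 1)) = g (q M s S (Finsupp.single w 1))) : f = g :=
  Submodule.linearMap_qext _ (word_hom_ext h)

/-- Relabelling of the positions of words, extended linearly. -/
def relabelL (g : S → T) : (List (Letter M S) →₀ k) →ₗ[k] (List (Letter M T) →₀ k) :=
  Finsupp.linearCombination k fun w => Finsupp.single (w.map (Letter.relabel g)) 1

@[simp] theorem relabelL_single (g : S → T) (w : List (Letter M S)) :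
    relabelL g (Finsupp.single w (1 : k)) = Finsupp.single (w.map (Letter.relabel g)) 1 := by
  simp [relabelL]

/-- Relabelling along a bijection. -/
def relabel (g : S ≃ T) : BarMod M s S →ₗ[k] BarMod M s T :=
  lift (q M s T ∘ₗ relabelL g)
    (respects_iff.2 (by simpa using respects_q.relabel g))
    (fun w h => by
      rw [LinearMap.comp_apply, relabelL_single]
      exact q_single_eq_zero
        (by rwa [isDecomposition_relabel, Ne, List.map_eq_nil_iff, List.length_map]))

@[simp] theorem relabel_q (g : S ≃ T) (z : List (Letter M S) →₀ k) :
    relabel g (q M s S z) = q M s T (relabelL g z) := rfl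

/-- The differential of the bar construction. -/
def d (A : ReducedCommShuffleAlg k) (s : ℕ) (S : Type) : BarMod A.X (s + 1) S →ₗ[k] BarMod A.X s S :=
  lift (q A.X s S ∘ₗ bdryL)
    (tensorRel_bdryL.trans (by
      rw [LinearMap.ker_comp, Submodule.ker_mkQ]
      exact Submodule.comap_mono tensorRel_le))
    (fun w h => by
      rw [LinearMap.comp_apply, bdryL_single]
      have h' : Finsupp.supported k k {w' : List (Letter A.X S) | w' ≠ [] ∧
          w'.length + 1 = w.length ∧ positions w' = positions w} ≤
            LinearMap.ker (q A.X s S) := by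
        rw [Finsupp.supported_eq_span_single]
        refine Submodule.span_le.2 ?_
        rintro _ ⟨w', ⟨h1, h2, h3⟩, rfl⟩
        refine q_single_eq_zero fun h4 => h ⟨?_, ?_, ?_⟩
        · rintro rfl
          simp at h2
        · rw [← h2, h4.2.1]
        · simpa only [IsDecomposition, h3] using h4.2.2
      exact h' (bdry_mem w))

@[simp] theorem d_q (z : List (Letter A.X S) →₀ k) :
    d A s S (q A.X (s + 1) S z) = q A.X s S (bdryL z) := rfl

theorem d_d : d A s S ∘ₗ d A (s + 1) S = 0 := by
  refine hom_ext fun w => ?_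
  rw [LinearMap.comp_apply, d_q, d_q, bdryL_single, LinearMap.zero_apply]
  exact (q_eq_of_tq ((bdryL_bdry w).trans (map_zero _).symm)).trans (map_zero _)

theorem relabelL_consL (g : S → T) (t : Letter M S) (z : List (Letter M S) →₀ k) :
    relabelL g (consL t z) = consL (t.relabel g) (relabelL g z) := by
  have : relabelL g ∘ₗ consL t = consL (t.relabel g) ∘ₗ relabelL (k := k) g :=
    word_hom_ext fun w => by simp
  exact LinearMap.congr_fun this z

theorem relabelL_mulFirst (g : S → T) (a : Letter A.X S) (v : List (Letter A.X S)) :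
    relabelL g (mulFirst a v) = mulFirst (a.relabel g) (v.map (Letter.relabel g)) := by
  obtain - | ⟨b, v⟩ := v
  · simp [mulFirst]
  · simp [mulFirst, relabel_mulLetter]

theorem relabelL_bdry (g : S → T) (w : List (Letter A.X S)) :
    relabelL g (bdry w) = bdry (w.map (Letter.relabel g)) := by
  induction w with
  | nil => simp [bdry]
  | cons a v ih => rw [bdry, map_sub, relabelL_consL, relabelL_mulFirst, ih, List.map_cons, bdry]

theorem d_relabel (g : S ≃ T) (x : BarMod A.X (s + 1) S) :
    d A s T (relabel g x) = relabel g (d A s S x) := by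
  have : d A s T ∘ₗ relabel g = relabel g ∘ₗ d A s S := by
    refine hom_ext fun w => ?_
    simp only [LinearMap.comp_apply, relabel_q, d_q, bdryL_single, relabelL_single, relabelL_bdry]
  exact LinearMap.congr_fun this x

theorem relabelL_shuffle (g : S → T) (u v : List (Letter M S)) :
    relabelL g (shuffle u v) = shuffle (u.map (Letter.relabel g)) (v.map (Letter.relabel g)) := by
  induction u, v using shuffle.induct with
  | case1 v => simp [shuffle]
  | case2 a u => simp [shuffle]
  | case3 a u b v ih1 ih2 =>
    rw [shuffle, map_add, map_smul, relabelL_consL, relabelL_consL, ih1, ih2]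
    simp only [List.map_cons]
    rw [shuffle, List.length_map]

end BarMod

/-- The action of the symmetric group on `M^{⊙ s}(ℓ)`. -/
def barRep (M : SymSeq k) (s ℓ : ℕ) :
    Representation k (Equiv.Perm (Fin ℓ)) (BarMod M s (Fin ℓ)) :=
  { toFun := fun π : Equiv.Perm (Fin ℓ) => (BarMod.relabel π : BarMod M s (Fin ℓ) →ₗ[k] _)
    map_one' := BarMod.hom_ext fun w => by
      rw [BarMod.relabel_q, BarMod.relabelL_single]
      exact congrArg (fun v => BarMod.q M s (Fin ℓ) (Finsupp.single v 1)) (List.map_id w)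
    map_mul' := fun π π' => BarMod.hom_ext fun w => by
      simp only [Module.End.mul_apply, BarMod.relabel_q, BarMod.relabelL_single,
        Letter.relabel_relabel]
      rfl }

theorem barRep_apply (M : SymSeq k) (s ℓ : ℕ) (π : Equiv.Perm (Fin ℓ)) :
    barRep M s ℓ π = (BarMod.relabel π : BarMod M s (Fin ℓ) →ₗ[k] _) := rfl

/-- The bar complex `B(A)(ℓ)`. In degree `s ≥ 1` it is `A^{⊙ s}(ℓ)`, in degree `0` it is `0`. -/
def barComplex (A : ReducedCommShuffleAlg k) (ℓ : ℕ) : ChainComplex (Rep.{u} k (Equiv.Perm (Fin ℓ))) ℕ :=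
  ChainComplex.of (fun s => Rep.of (barRep A.X s ℓ))
    (fun s => Rep.ofHom
      { toLinearMap := BarMod.d A s (Fin ℓ)
        isIntertwining' := fun π => LinearMap.ext fun x => BarMod.d_relabel π x })
    (fun s => by
      ext : 2
      exact BarMod.d_d)

/-! ### The bar complex is a differential graded algebra -/

section

variable {A : ReducedCommShuffleAlg k} {S : Type}

/-- Bilinear extension of `shuffle`. -/
def shuffleL : (List (Letter A.X S) →₀ k) →ₗ[k] (List (Letter A.X S) →₀ k) →ₗ[k]
    (List (Letter A.X S) →₀ k) :=
  Finsupp.linearCombination k fun u => Finsupp.linearCombination k (shuffle u)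

@[simp] theorem shuffleL_single (u v : List (Letter A.X S)) :
    shuffleL (Finsupp.single u (1 : k)) (Finsupp.single v (1 : k)) = shuffle u v := by
  simp [shuffleL]

/-- The sign `(-1)^{|w|}` of a word. -/
def signL : (List (Letter A.X S) →₀ k) →ₗ[k] (List (Letter A.X S) →₀ k) :=
  Finsupp.linearCombination k fun w => (-1 : k) ^ w.length • Finsupp.single w 1

@[simp] theorem signL_single (w : List (Letter A.X S)) :
    signL (Finsupp.single w (1 : k)) = (-1 : k) ^ w.length • Finsupp.single w 1 := by
  simp only [signL, Finsupp.linearCombination_single, one_smul]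

theorem signL_bdry (w : List (Letter A.X S)) :
    signL (bdry w) = -((-1 : k) ^ w.length • bdry w) := by
  have h : Finsupp.supported k k {w' : List (Letter A.X S) | w' ≠ [] ∧
      w'.length + 1 = w.length ∧ positions w' = positions w} ≤
        LinearMap.ker (signL + (-1 : k) ^ w.length • LinearMap.id) := by
    rw [Finsupp.supported_eq_span_single]
    refine Submodule.span_le.2 ?_
    rintro _ ⟨w', ⟨-, h, -⟩, rfl⟩
    rw [SetLike.mem_coe, LinearMap.mem_ker, LinearMap.add_apply, signL_single,
      LinearMap.smul_apply, LinearMap.id_apply, ← h, pow_succ]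
    module
  have := h (bdry_mem w)
  rw [LinearMap.mem_ker, LinearMap.add_apply, LinearMap.smul_apply, LinearMap.id_apply] at this
  exact eq_neg_of_add_eq_zero_left this

theorem shuffle_nil_left (v : List (Letter A.X S)) :
    shuffle [] v = Finsupp.single v (1 : k) := by rw [shuffle]

theorem shuffle_nil_right (v : List (Letter A.X S)) :
    shuffle v [] = Finsupp.single v (1 : k) := by cases v <;> rw [shuffle]

theorem shuffleL_nil_left (z : List (Letter A.X S) →₀ k) :
    shuffleL (Finsupp.single [] 1) z = z := by
  have : shuffleL (Finsupp.single ([] : List (Letter A.X S)) 1) = LinearMap.id :=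
    word_hom_ext fun w => by simp [shuffle_nil_left]
  rw [this, LinearMap.id_apply]

theorem shuffleL_nil_right (z : List (Letter A.X S) →₀ k) :
    shuffleL z (Finsupp.single [] 1) = z := by
  have : shuffleL.flip (Finsupp.single ([] : List (Letter A.X S)) 1) = LinearMap.id :=
    word_hom_ext fun w => by simp [shuffle_nil_right]
  exact LinearMap.congr_fun this z

theorem shuffleL_consL_left (a b : Letter A.X S) (v : List (Letter A.X S))
    (z : List (Letter A.X S) →₀ k) :
    shuffleL (consL a z) (Finsupp.single (b :: v) 1) =
      consL a (shuffleL z (Finsupp.single (b :: v) 1)) -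
        consL b (shuffleL (consL a (signL z)) (Finsupp.single v 1)) := by
  have : shuffleL.flip (Finsupp.single (b :: v) 1) ∘ₗ consL a =
      consL a ∘ₗ shuffleL.flip (Finsupp.single (b :: v) 1) -
        consL b ∘ₗ shuffleL.flip (Finsupp.single v 1) ∘ₗ consL a ∘ₗ signL :=
    word_hom_ext fun w => by
      simp only [LinearMap.comp_apply, LinearMap.sub_apply, consL_single, LinearMap.flip_apply,
        shuffleL_single, signL_single, map_smul]
      rw [shuffle, pow_succ]
      module
  exact LinearMap.congr_fun this z

theorem shuffleL_consL_right (a b : Letter A.X S) (u : List (Letter A.X S))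
    (z : List (Letter A.X S) →₀ k) :
    shuffleL (Finsupp.single (a :: u) 1) (consL b z) =
      consL a (shuffleL (Finsupp.single u 1) (consL b z)) +
        (-1 : k) ^ (u.length + 1) • consL b (shuffleL (Finsupp.single (a :: u) 1) z) := by
  have : shuffleL (Finsupp.single (a :: u) 1) ∘ₗ consL b =
      consL a ∘ₗ shuffleL (Finsupp.single u 1) ∘ₗ consL b +
        (-1 : k) ^ (u.length + 1) • consL b ∘ₗ shuffleL (Finsupp.single (a :: u) 1) :=
    word_hom_ext fun w => by
      simp only [LinearMap.comp_apply, LinearMap.add_apply, consL_single,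
        shuffleL_single, LinearMap.smul_apply]
      rw [shuffle]
  exact LinearMap.congr_fun this z

theorem mulFirstL_shuffle_left (a b : Letter A.X S) (u v : List (Letter A.X S)) :
    mulFirstL a (shuffle u (b :: v)) = shuffleL (mulFirst a u) (Finsupp.single (b :: v) 1) +
      (-1 : k) ^ (u.length + 1) • consL b (shuffleL (mulFirst a u) (Finsupp.single v 1)) -
      (-1 : k) ^ (u.length + 1) • consL (mulLetter a b) (shuffle u v) := by
  obtain - | ⟨c, u⟩ := u
  · simp [shuffle_nil_left, mulFirst]
  · rw [shuffle, mulFirst, shuffleL_single, shuffleL_single, shuffle, map_add, map_smul,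
      mulFirstL_consL, mulFirstL_consL, List.length_cons]
    rw [pow_succ _ (u.length + 1)]
    module

theorem mulFirstL_shuffle_right (a b : Letter A.X S) (u v : List (Letter A.X S)) :
    mulFirstL b (shuffle (a :: u) v) = shuffleL (Finsupp.single (a :: u) 1) (mulFirst b v) -
      consL a (shuffleL (Finsupp.single u 1) (mulFirst b v)) +
      consL (mulLetter b a) (shuffle u v) := by
  obtain - | ⟨c, v⟩ := v
  · simp [shuffle_nil_right, mulFirst]
  · rw [shuffle, mulFirst, shuffleL_single, shuffleL_single, shuffle, map_add, map_smul,
      mulFirstL_consL, mulFirstL_consL]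
    module

theorem tq_consL_congr (a : Letter A.X S) {x y : List (Letter A.X S) →₀ k}
    (h : tq A.X S x = tq A.X S y) : tq A.X S (consL a x) = tq A.X S (consL a y) := by
  rw [tq_consL, h, tq_consL]

theorem tq_consL_comm (a b : Letter A.X S) (z : List (Letter A.X S) →₀ k) :
    tq A.X S (consL (mulLetter a b) z) = tq A.X S (consL (mulLetter b a) z) := by
  have : tq A.X S ∘ₗ consL (mulLetter a b) = tq A.X S ∘ₗ consL (mulLetter b a) :=
    word_hom_ext fun w => by
      simp only [LinearMap.comp_apply, consL_single]
      exact respects_tq.congr (mulLetter_comm a b) [] w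
  exact LinearMap.congr_fun this z

/-- The differential is a derivation for the shuffle product. -/
theorem bdryL_shuffle (u v : List (Letter A.X S)) :
    tq A.X S (bdryL (shuffle u v)) = tq A.X S (shuffleL (bdry u) (Finsupp.single v 1) +
      (-1 : k) ^ u.length • shuffleL (Finsupp.single u 1) (bdry v)) := by
  induction u, v using shuffle.induct with
  | case1 v => simp [shuffle_nil_left, bdry, shuffleL_nil_left]
  | case2 a u => simp [shuffle_nil_right, bdry.eq_1, shuffleL_nil_right]
  | case3 a u b v ih1 ih2 =>
    rw [shuffle, map_add, map_smul, bdryL_consL, bdryL_consL, mulFirstL_shuffle_left,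
      mulFirstL_shuffle_right]
    simp only [map_add, map_sub, map_smul] at ih1 ih2 ⊢
    rw [tq_consL a (bdryL _), ih1, tq_consL b (bdryL _), ih2]
    simp only [map_add, map_smul, ← tq_consL]
    rw [tq_consL_comm b a]
    rw [bdry.eq_2 a u, bdry.eq_2 b v]
    simp only [map_sub, LinearMap.sub_apply, shuffleL_consL_left, shuffleL_consL_right, signL_bdry,
      map_add, map_smul, map_neg, LinearMap.neg_apply, LinearMap.smul_apply]
    rw [List.length_cons]
    rw [pow_succ]
    generalize (-1 : k) ^ u.length = s
    module

end

/-! ### Harrison homology -/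

/-- The decomposable elements of the bar complex in degree `s` and level `ℓ`: the span of the
signed shuffle products of two words of positive length. (Words whose positions do not define a
bijection onto `{1,…,ℓ}`, or whose length is not `s`, represent zero.) This is the image of
the shuffle product `B(A) ⊙ B(A) → B(A)`. -/
def barDecomposables (A : ReducedCommShuffleAlg k) (s ℓ : ℕ) : Submodule k (BarMod A.X s (Fin ℓ)) :=
  Submodule.span k {z | ∃ u v : List (Letter A.X (Fin ℓ)), u ≠ [] ∧ v ≠ [] ∧
    z = BarMod.q A.X s (Fin ℓ) (shuffle u v)}

theorem barDecomposables_act (A : ReducedCommShuffleAlg k) (s ℓ : ℕ) (π : Equiv.Perm (Fin ℓ)) :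
    barDecomposables A s ℓ ≤ (barDecomposables A s ℓ).comap ((barRep A.X s ℓ) π) := by
  refine Submodule.span_le.2 ?_
  rintro _ ⟨u, v, hu, hv, rfl⟩
  refine Submodule.subset_span ⟨u.map (Letter.relabel π), v.map (Letter.relabel π),
    by simpa using hu, by simpa using hv, ?_⟩
  rw [← BarMod.relabelL_shuffle]
  rfl

theorem shuffleL_mem_left (A : ReducedCommShuffleAlg k) (s ℓ : ℕ) (w v : List (Letter A.X (Fin ℓ)))
    (hv : v ≠ []) :
    BarMod.q A.X s (Fin ℓ) (shuffleL (bdry w) (Finsupp.single v 1)) ∈ barDecomposables A s ℓ := by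
  have h : Finsupp.supported k k {w' : List (Letter A.X (Fin ℓ)) | w' ≠ [] ∧
      w'.length + 1 = w.length ∧ positions w' = positions w} ≤ (barDecomposables A s ℓ).comap
        (BarMod.q A.X s (Fin ℓ) ∘ₗ shuffleL.flip (Finsupp.single v 1)) := by
    rw [Finsupp.supported_eq_span_single]
    refine Submodule.span_le.2 ?_
    rintro _ ⟨w', ⟨h, -, -⟩, rfl⟩
    refine Submodule.subset_span ⟨w', v, h, hv, ?_⟩
    rw [LinearMap.comp_apply, LinearMap.flip_apply, shuffleL_single]
  exact h (bdry_mem w)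

theorem shuffleL_mem_right (A : ReducedCommShuffleAlg k) (s ℓ : ℕ) (u w : List (Letter A.X (Fin ℓ)))
    (hu : u ≠ []) :
    BarMod.q A.X s (Fin ℓ) (shuffleL (Finsupp.single u 1) (bdry w)) ∈ barDecomposables A s ℓ := by
  have h : Finsupp.supported k k {w' : List (Letter A.X (Fin ℓ)) | w' ≠ [] ∧
      w'.length + 1 = w.length ∧ positions w' = positions w} ≤ (barDecomposables A s ℓ).comap
        (BarMod.q A.X s (Fin ℓ) ∘ₗ shuffleL (Finsupp.single u 1)) := by
    rw [Finsupp.supported_eq_span_single]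
    refine Submodule.span_le.2 ?_
    rintro _ ⟨w', ⟨h, -, -⟩, rfl⟩
    refine Submodule.subset_span ⟨u, w', hu, h, ?_⟩
    rw [LinearMap.comp_apply, shuffleL_single]
  exact h (bdry_mem w)

theorem barDecomposables_d (A : ReducedCommShuffleAlg k) (s ℓ : ℕ) :
    barDecomposables A (s + 1) ℓ ≤ (barDecomposables A s ℓ).comap (BarMod.d A s (Fin ℓ)) := by
  refine Submodule.span_le.2 ?_
  rintro _ ⟨u, v, hu, hv, rfl⟩
  rw [SetLike.mem_coe, Submodule.mem_comap, BarMod.d_q, BarMod.q_eq_of_tq (bdryL_shuffle u v),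
    map_add, map_smul]
  exact Submodule.add_mem _ (shuffleL_mem_left A s ℓ u v hv)
    (Submodule.smul_mem _ _ (shuffleL_mem_right A s ℓ u v hu))

/-- The complex of indecomposables `Indec B(A)` of the bar complex, in level `ℓ`: the quotient of
`B(A)(ℓ)` by the shuffle products, with the induced differential. -/
def harrisonComplex (A : ReducedCommShuffleAlg k) (ℓ : ℕ) :
    ChainComplex (Rep.{u} k (Equiv.Perm (Fin ℓ))) ℕ :=
  ChainComplex.of
    (fun s => Rep.of ((barRep A.X s ℓ).quotient (barDecomposables A s ℓ)
      (barDecomposables_act A s ℓ)))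
    (fun s => Rep.ofHom
      { toLinearMap := Submodule.mapQ _ _ (BarMod.d A s (Fin ℓ)) (barDecomposables_d A s ℓ)
        isIntertwining' := fun π => by
          refine Submodule.linearMap_qext _ (LinearMap.ext fun x => ?_)
          exact congrArg (Submodule.mkQ _) (BarMod.d_relabel π x) })
    (fun s => by
      ext : 2
      refine Submodule.linearMap_qext _ (LinearMap.ext fun x => ?_)
      exact (congrArg (barDecomposables A s ℓ).mkQ
        (LinearMap.congr_fun BarMod.d_d x)).trans (map_zero (barDecomposables A s ℓ).mkQ))

/-- Harrison homology `Harr_s(A) = H_s(Indec B(A))`, a symmetric sequence. -/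
def harrison (A : ReducedCommShuffleAlg k) (s : ℕ) : SymSeq k := fun ℓ => (harrisonComplex A ℓ).homology s

end

end ShuffleAlg

/-! The theorem compares the two directions of the double complex `Indec B_s(C̄^(n+1)(A))`, where
`s` is the bar degree and `n` the simplicial degree.

For fixed `s`, the module `Indec B_s` depends only on the underlying symmetric sequence, because
shuffling reorders letters and never multiplies them (`mapL_shuffle`). The unit `M → C̄(M)` is not a
map of algebras, but it still acts on `Indec B_s` and gives an extra degeneracy (`extraDegeneracy`).
So the homology in the simplicial direction is concentrated in degree zero, where it is `Indec
B_s(A)`; with the remaining differential this is the Harrison complex.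

For fixed `n` the algebra is free. For every algebra the cokernel of `Indec B_2 → Indec B_1` is
`Q_a` (`barIndecAug_exact`). For a free algebra, `Indec B` is moreover exact in degrees above one
(`exists_d_sub_mem_barDecomposables`), which is the heart of the proof. Fix a position `s₀` in
`{1,…,ℓ}` and call a word marked if its first letter contains `s₀`. The marked words span a
subcomplex of `B` which is a complement of the shuffle products. Together they span, since a word `u
a v` is a shuffle product up to words in which `a` stands earlier. They meet in zero, since the
transpose of left normed bracketing (`dynkin`) fixes marked words and kills shuffle products:
iterated brackets are orthogonal to shuffles. No denominators occur, because `s₀` belongs to exactly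
one letter of a word. On marked elements of degree at least two, `[m r | w] ↦ [m | r | w]` is a
contraction (`d_split_add_split_d`), where `m` is the generator that contains `s₀`.

The choice of `s₀` breaks the symmetry of `Σ_ℓ`, but it only serves to prove exactness; all maps
between the complexes are equivariant. The two directions are compared by dimension shifting
(`homology_iso_of_resolution`). The shift by one arises because the bar complex starts in degree
one, so that the resolution of `Q_a` starts there as well. -/

namespace ShuffleAlg

noncomputable section

/-! ### Sequences of chain complexes which are acyclic in positive degrees -/

section Resolution

open Limits HomologicalComplex

variable {C : Type*} [Category C] [Abelian C]

/-- `Q` is a cokernel of `S.f` and `H` is a kernel of the map `Q ⟶ S.X₃` induced by `S.g`; this is a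
right homology datum of `S`. -/
theorem homology_iso_of_exact {S : ShortComplex C} {Q H : C} (p : S.X₂ ⟶ Q) [Epi p]
    (wp : S.f ≫ p = 0) (hp : (ShortComplex.mk S.f p wp).Exact) (q : Q ⟶ S.X₃) (hq : p ≫ q = S.g)
    (ι : H ⟶ Q) [Mono ι] (wι : ι ≫ q = 0) (hι : (ShortComplex.mk ι q wι).Exact) :
    Nonempty (S.homology ≅ H) := by
  have hc : IsColimit (CokernelCofork.ofπ p wp) :=
    have : Epi (ShortComplex.mk S.f p wp).g := ‹Epi p›
    hp.gIsCokernel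
  have hd : hc.desc (CokernelCofork.ofπ _ S.zero) = q := by
    rw [← cancel_epi p, hq]
    exact hc.fac (CokernelCofork.ofπ _ S.zero) WalkingParallelPair.one
  have hk : IsLimit (KernelFork.ofι ι wι) :=
    have : Mono (ShortComplex.mk ι q wι).f := ‹Mono ι›
    hι.fIsKernel
  subst hd
  exact ⟨ShortComplex.RightHomologyData.homologyIso
    { Q := Q, H := H, p := p, ι := ι, wp := wp, hp := hc, wι := wι, hι := hk }⟩

variable (E : ℕ → ChainComplex C ℕ) (δ : ∀ s, E (s + 1) ⟶ E s)
  (hδ : ∀ s, δ (s + 1) ≫ δ s = 0)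

/-- The short complex `H₀(E (s + 2)) ⟶ H₀(E (s + 1)) ⟶ H₀(E s)`. -/
abbrev homologyZeroComplex (s : ℕ) : ShortComplex C :=
  ShortComplex.mk (homologyMap (δ (s + 1)) 0) (homologyMap (δ s) 0)
    (by rw [← homologyMap_comp, hδ, homologyMap_zero])

/-- The short complex `coker (E (s + 3) ⟶ E (s + 2)) ⟶ E (s + 1) ⟶ coker (E (s + 2) ⟶ E (s + 1))`. -/
abbrev cokernelComplex (s : ℕ) : ShortComplex (ChainComplex C ℕ) :=
  ShortComplex.mk (X₁ := cokernel (δ (s + 2))) (X₂ := E (s + 1)) (X₃ := cokernel (δ (s + 1)))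
    (cokernel.desc _ (δ (s + 1)) (hδ (s + 1))) (cokernel.π (δ (s + 1)))
    (by rw [← cancel_epi (cokernel.π _), cokernel.π_desc_assoc, cokernel.condition, comp_zero])

variable {δ}

/-- By exactness at `E (s + 2)`, the map `δ (s + 1)` embeds the cokernel of `δ (s + 2)` into `E (s +
1)`, with image the kernel of the projection to the cokernel of `δ (s + 1)`. -/
theorem cokernelComplex_shortExact (s : ℕ)
    (h : (ShortComplex.mk (δ (s + 2)) (δ (s + 1)) (hδ (s + 1))).Exact) :
    (cokernelComplex E δ hδ s).ShortExact where
  mono_f := h.mono_cokernelDesc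
  epi_g := by dsimp [cokernelComplex]; infer_instance
  exact := by
    have h1 := ShortComplex.exact_cokernel (δ (s + 1))
    let φ : ShortComplex.mk _ _ (cokernel.condition (δ (s + 1))) ⟶ cokernelComplex E δ hδ s :=
      { τ₁ := cokernel.π (δ (s + 2))
        τ₂ := 𝟙 _
        τ₃ := 𝟙 _
        comm₁₂ := by simp [cokernelComplex]
        comm₂₃ := by simp [cokernelComplex] }
    have : Epi φ.τ₁ := inferInstanceAs (Epi (cokernel.π (δ (s + 2))))
    have : IsIso φ.τ₂ := inferInstanceAs (IsIso (𝟙 (E (s + 1))))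
    have : Mono φ.τ₃ := inferInstanceAs (Mono (𝟙 (cokernel (δ (s + 1)))))
    exact (ShortComplex.exact_iff_of_epi_of_isIso_of_mono φ).1 h1

/-- No differential leaves degree zero, so every chain there is a cycle and lifts along `φ`. -/
theorem epi_homologyMap_zero {K L : ChainComplex C ℕ} (φ : K ⟶ L) [Epi φ] :
    Epi (homologyMap φ 0) :=
  epi_homologyMap_of_epi_of_not_rel φ 0 (by simp)

/-- `H₀` is right exact on non-negative chain complexes. The long exact sequence of
`cokernelComplex` has `H₀` of the cokernel of `δ (s + 2)` on the left, and `H₀(E (s + 2))` surjects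
onto it. -/
theorem homology_zero_cokernel_exact
    (hE : ∀ s, (ShortComplex.mk (δ (s + 2)) (δ (s + 1)) (hδ (s + 1))).Exact) (s : ℕ) :
    (ShortComplex.mk (homologyMap (δ (s + 1)) 0) (homologyMap (cokernel.π (δ (s + 1))) 0)
      (by rw [← homologyMap_comp, cokernel.condition, homologyMap_zero])).Exact := by
  have h1 := (cokernelComplex_shortExact E hδ s (hE s)).homology_exact₂ 0
  let φ : ShortComplex.mk (homologyMap (δ (s + 1)) 0) (homologyMap (cokernel.π (δ (s + 1))) 0)
      (by rw [← homologyMap_comp, cokernel.condition, homologyMap_zero]) ⟶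
      ShortComplex.mk (homologyMap (cokernelComplex E δ hδ s).f 0)
        (homologyMap (cokernelComplex E δ hδ s).g 0)
        (by rw [← homologyMap_comp, ShortComplex.zero, homologyMap_zero]) :=
    { τ₁ := homologyMap (cokernel.π (δ (s + 2))) 0
      τ₂ := 𝟙 _
      τ₃ := 𝟙 _
      comm₁₂ := ((homologyMap_comp _ _ 0).symm.trans
        (congrArg (homologyMap · 0) (cokernel.π_desc _ _ _))).trans (Category.comp_id _).symm
      comm₂₃ := by
        rw [Category.id_comp, Category.comp_id] }
  have : Epi φ.τ₁ := epi_homologyMap_zero _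
  have : IsIso φ.τ₂ := inferInstanceAs (IsIso (𝟙 ((E (s + 1)).homology 0)))
  have : Mono φ.τ₃ := inferInstanceAs (Mono (𝟙 ((cokernel (δ (s + 1))).homology 0)))
  exact (ShortComplex.exact_iff_of_epi_of_isIso_of_mono φ).2 h1

/-- Since `E 0` vanishes, the homology on the right is the cokernel of `H₀(E 2) ⟶ H₀(E 1)`, which
right exactness of `H₀` identifies. -/
theorem homology_zero_cokernel_iso
    (hE : ∀ s, (ShortComplex.mk (δ (s + 2)) (δ (s + 1)) (hδ (s + 1))).Exact)
    (h0 : IsZero (E 0)) :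
    Nonempty ((cokernel (δ 1)).homology 0 ≅ (homologyZeroComplex E δ hδ 0).homology) := by
  have : Epi (homologyMap (cokernel.π (δ 1)) 0) := epi_homologyMap_zero _
  have hz : IsZero ((E 0).homology 0) := (homologyFunctor C _ 0).map_isZero h0
  obtain ⟨e⟩ := homology_iso_of_exact (S := homologyZeroComplex E δ hδ 0)
    (homologyMap (cokernel.π (δ 1)) 0) _ (homology_zero_cokernel_exact E hδ hE 0) 0
    (hz.eq_of_tgt _ _) (𝟙 _) comp_zero (ShortComplex.exact_of_f_is_kernel _
      (KernelFork.IsLimit.ofId _ rfl))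
  exact ⟨e.symm⟩

/-- As `H₁(E (s + 1)) = 0`, the connecting map identifies `H₁` of the cokernel of `δ (s + 1)` with
the kernel of the map from `H₀` of the cokernel of `δ (s + 2)` to `H₀(E (s + 1))`. By right
exactness the source of that map is the cokernel of `H₀(δ (s + 2))`, so the kernel is the homology
at `H₀(E (s + 2))`. -/
theorem homology_one_cokernel_iso
    (hE : ∀ s, (ShortComplex.mk (δ (s + 2)) (δ (s + 1)) (hδ (s + 1))).Exact)
    (hac : ∀ s j, IsZero ((E (s + 1)).homology (j + 1))) (s : ℕ) :
    Nonempty ((cokernel (δ (s + 1))).homology 1 ≅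
      (homologyZeroComplex E δ hδ (s + 1)).homology) := by
  have hs := cokernelComplex_shortExact E hδ s (hE s)
  have : Epi (homologyMap (cokernel.π (δ (s + 1 + 1))) 0) := epi_homologyMap_zero _
  have hr : (ComplexShape.down ℕ).Rel 1 0 := by simp
  have : Mono (hs.δ 1 0 hr) := hs.mono_δ 1 0 hr (hac s 0)
  obtain ⟨e⟩ := homology_iso_of_exact (S := homologyZeroComplex E δ hδ (s + 1))
    (homologyMap (cokernel.π (δ (s + 1 + 1))) 0) _ (homology_zero_cokernel_exact E hδ hE (s + 1))
    (homologyMap (cokernelComplex E δ hδ s).f 0)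
    (by rw [← homologyMap_comp, cokernel.π_desc])
    (hs.δ 1 0 hr) _ (hs.homology_exact₁ 1 0 hr)
  exact ⟨e.symm⟩

/-- Dimension shifting: the connecting isomorphism lowers the homological degree by one and raises
the index of the cokernel by one, so only `s + j` matters. The induction ends in homological degree
one. -/
theorem homology_succ_cokernel_iso
    (hE : ∀ s, (ShortComplex.mk (δ (s + 2)) (δ (s + 1)) (hδ (s + 1))).Exact)
    (hac : ∀ s j, IsZero ((E (s + 1)).homology (j + 1))) (j s : ℕ) :
    Nonempty ((cokernel (δ (s + 1))).homology (j + 1) ≅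
      (homologyZeroComplex E δ hδ (s + j + 1)).homology) := by
  induction j generalizing s with
  | zero => exact homology_one_cokernel_iso E hδ hE hac s
  | succ j ih =>
    have hs := cokernelComplex_shortExact E hδ s (hE s)
    obtain ⟨e⟩ := ih (s + 1)
    rw [show s + 1 + j + 1 = s + (j + 1) + 1 by lia] at e
    exact ⟨(hs.δIso (j + 1 + 1) (j + 1) (by simp) (hac _ _) (hac _ _)).trans e⟩

/-- If `⋯ ⟶ E 3 ⟶ E 2 ⟶ E 1 ⟶ L ⟶ 0` is an exact sequence of chain complexes, `E 0 = 0`, and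
the homology of every `E s` is concentrated in degree zero, then the homology of `L` is the homology
of the complex `s ↦ H₀(E s)`, shifted by one. -/
theorem homology_iso_of_resolution
    (hE : ∀ s, (ShortComplex.mk (δ (s + 2)) (δ (s + 1)) (hδ (s + 1))).Exact)
    (h0 : IsZero (E 0)) (hac : ∀ s j, IsZero ((E (s + 1)).homology (j + 1)))
    {L : ChainComplex C ℕ} (π : E 1 ⟶ L) [Epi π] (wπ : δ 1 ≫ π = 0)
    (hπ : (ShortComplex.mk (δ 1) π wπ).Exact) (r : ℕ) :
    Nonempty (L.homology r ≅ (homologyZeroComplex E δ hδ r).homology) := by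
  have : Epi (ShortComplex.mk (δ 1) π wπ).g := ‹Epi π›
  -- `L` is the cokernel of `δ 1`, so the preceding lemmas apply with `s = 0`.
  have e : L ≅ cokernel (δ 1) := hπ.gIsCokernel.coconePointUniqueUpToIso (colimit.isColimit _)
  have e' := (homologyFunctor C _ r).mapIso e
  obtain - | r := r
  · obtain ⟨e''⟩ := homology_zero_cokernel_iso E hδ hE h0
    exact ⟨e'.trans e''⟩
  · obtain ⟨e''⟩ := homology_succ_cokernel_iso E hδ hE hac r 0
    rw [show 0 + r + 1 = r + 1 by lia] at e''
    exact ⟨e'.trans e''⟩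

end Resolution

end

end ShuffleAlg

namespace ShuffleAlg

noncomputable section

variable {k : Type u} [CommRing k]

/-! ### Shuffles and reorderings of words -/

section

variable {A : ReducedCommShuffleAlg k} {S : Type}

/-- The word with last letter `t` preceded by a given word, extended linearly. -/
def snocL (t : Letter A.X S) : (List (Letter A.X S) →₀ k) →ₗ[k] (List (Letter A.X S) →₀ k) :=
  Finsupp.linearCombination k fun w => Finsupp.single (w ++ [t]) 1

@[simp] theorem snocL_single (t : Letter A.X S) (w : List (Letter A.X S)) :
    snocL t (Finsupp.single w (1 : k)) = Finsupp.single (w ++ [t]) 1 := by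
  simp [snocL]

theorem consL_snocL (a b : Letter A.X S) (z : List (Letter A.X S) →₀ k) :
    consL a (snocL b z) = snocL b (consL a z) := by
  have : consL a ∘ₗ snocL b = snocL b ∘ₗ consL a := word_hom_ext fun w => by simp
  exact LinearMap.congr_fun this z

theorem shuffle_cons_cons (a b : Letter A.X S) (u v : List (Letter A.X S)) :
    shuffle (a :: u) (b :: v) = consL a (shuffle u (b :: v)) +
      (-1 : k) ^ (u.length + 1) • consL b (shuffle (a :: u) v) := by rw [shuffle]

/-- The recursion for shuffles read from the right: if the word ends with `b`, then `b` has moved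
past all letters of `v ++ [c]`, which gives the sign. It is needed because `dynkin` takes letters
off both ends of a word. -/
theorem shuffle_concat (u v : List (Letter A.X S)) (b c : Letter A.X S) :
    shuffle (u ++ [b]) (v ++ [c]) = (-1 : k) ^ (v.length + 1) • snocL b (shuffle u (v ++ [c])) +
      snocL c (shuffle (u ++ [b]) v) := by
  induction u generalizing v with
  | nil =>
    induction v with
    | nil =>
      simp [shuffle, add_comm]
    | cons d v ih =>
      simp only [List.nil_append, List.cons_append] at ih ⊢
      rw [shuffle_cons_cons, ih, shuffle_cons_cons]
      simp only [shuffle_nil_left, map_add, map_smul, consL_snocL, snocL_single, consL_single,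
        List.length_cons, List.length_nil, List.cons_append]
      rw [pow_succ _ (v.length + 1)]
      module
  | cons a u ihu =>
    induction v with
    | nil =>
      have := ihu []
      simp only [List.nil_append, List.cons_append] at this ⊢
      rw [shuffle_cons_cons, this, shuffle_cons_cons]
      simp only [shuffle_nil_right, map_add, map_smul, consL_snocL, snocL_single, consL_single,
        List.length_cons, List.length_nil, List.cons_append, List.length_append]
      rw [pow_succ _ (u.length + 1)]
      module
    | cons d v ih =>
      have := ihu (d :: v)
      simp only [List.cons_append] at this ih ⊢
      rw [shuffle_cons_cons, this, ih, shuffle_cons_cons a d, shuffle_cons_cons a d]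
      simp only [map_add, map_smul, consL_snocL, List.length_cons, List.length_nil,
        List.length_append]
      simp only [pow_succ]
      module

/-- The submodule of linear combinations of reorderings of `w`. -/
def permSpan (w : List (Letter A.X S)) : Submodule k (List (Letter A.X S) →₀ k) :=
  Finsupp.supported k k {w' | w'.Perm w}

theorem map_mem_permSpan {w v : List (Letter A.X S)}
    {f : (List (Letter A.X S) →₀ k) →ₗ[k] (List (Letter A.X S) →₀ k)}
    (h : ∀ w', w'.Perm w → f (Finsupp.single w' 1) ∈ permSpan v)
    {z : List (Letter A.X S) →₀ k} (hz : z ∈ permSpan w) : f z ∈ permSpan v := by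
  have : permSpan w ≤ (permSpan v).comap f := by
    rw [permSpan, Finsupp.supported_eq_span_single]
    refine Submodule.span_le.2 ?_
    rintro _ ⟨w', hw', rfl⟩
    exact h w' hw'
  exact this hz

theorem single_mem_permSpan {w w' : List (Letter A.X S)} (h : w'.Perm w) :
    Finsupp.single w' (1 : k) ∈ permSpan w :=
  Finsupp.single_mem_supported k _ h

theorem consL_mem_permSpan {w : List (Letter A.X S)} (a : Letter A.X S)
    {z : List (Letter A.X S) →₀ k} (hz : z ∈ permSpan w) : consL a z ∈ permSpan (a :: w) :=
  map_mem_permSpan (fun w' h => by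
    rw [consL_single]; exact single_mem_permSpan (h.cons a)) hz

theorem snocL_mem_permSpan {w : List (Letter A.X S)} (a : Letter A.X S)
    {z : List (Letter A.X S) →₀ k} (hz : z ∈ permSpan w) : snocL a z ∈ permSpan (a :: w) :=
  map_mem_permSpan (fun w' h => by
    rw [snocL_single]
    exact single_mem_permSpan ((List.perm_append_singleton a w').trans (h.cons a))) hz

theorem permSpan_congr {w w' : List (Letter A.X S)} (h : w.Perm w') :
    permSpan w = permSpan (k := k) w' := by
  rw [permSpan, permSpan]
  congr 1
  ext v
  exact ⟨fun h' => h'.trans h, fun h' => h'.trans h.symm⟩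

theorem shuffle_mem_permSpan (u v : List (Letter A.X S)) : shuffle u v ∈ permSpan (u ++ v) := by
  induction u, v using shuffle.induct with
  | case1 v => rw [shuffle_nil_left]; exact single_mem_permSpan (.refl _)
  | case2 a u => rw [shuffle_nil_right]; exact single_mem_permSpan (by simp)
  | case3 a u b v ih1 ih2 =>
    rw [shuffle]
    refine Submodule.add_mem _ (consL_mem_permSpan a ih1) (Submodule.smul_mem _ _ ?_)
    rw [permSpan_congr (List.perm_middle (a := b) (l₁ := a :: u) (l₂ := v))]
    exact consL_mem_permSpan b ih2

/-- On reorderings of `w` a linear map is determined by its values on words of the same length. -/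
theorem eq_of_mem_permSpan {N : Type*} [AddCommGroup N] [Module k N] {w : List (Letter A.X S)}
    {f g : (List (Letter A.X S) →₀ k) →ₗ[k] N}
    (h : ∀ w', w'.Perm w → f (Finsupp.single w' 1) = g (Finsupp.single w' 1))
    {z : List (Letter A.X S) →₀ k} (hz : z ∈ permSpan w) : f z = g z := by
  have : permSpan w ≤ LinearMap.eqLocus f g := by
    rw [permSpan, Finsupp.supported_eq_span_single]
    refine Submodule.span_le.2 ?_
    rintro _ ⟨w', hw', rfl⟩
    exact h w' hw'
  exact this hz

/-! ### The transpose of the left normed bracket -/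

open Classical in
/-- The transpose of the operator which maps a word `a₁ ⋯ aₙ` whose first letter contains the
position `s₀` to the left normed bracket `[⋯[[a₁, a₂], a₃], ⋯, aₙ]`, and all other words to zero. -/
def dynkin (s₀ : S) : List (Letter A.X S) → (List (Letter A.X S) →₀ k)
  | [] => 0
  | [a] => if s₀ ∈ Set.range a.pos then Finsupp.single [a] 1 else 0
  -- With `[x, y] = x y - (-1)^|x| y x`, the last entry `y` of a left normed bracket ends up at the
  -- right or at the left end of the word. The transpose therefore takes a letter off either end and
  -- puts it last; the exponent `w.length + 1` is the length of `x`.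
  | a :: b :: w => snocL ((b :: w).getLast (List.cons_ne_nil b w))
      (dynkin s₀ (a :: (b :: w).dropLast)) - (-1 : k) ^ (w.length + 1) • snocL a (dynkin s₀ (b :: w))
termination_by w => w.length

variable (s₀ : S)

/-- The recursion with both end letters explicit; this is the form in which the later inductions use
it. -/
theorem dynkin_cons_concat (a b : Letter A.X S) (w : List (Letter A.X S)) :
    dynkin s₀ (a :: (w ++ [b])) = snocL b (dynkin s₀ (a :: w)) -
      (-1 : k) ^ (w.length + 1) • snocL a (dynkin s₀ (w ++ [b])) := by
  obtain - | ⟨c, w⟩ := w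
  · rw [List.nil_append, dynkin.eq_3]; rfl
  · rw [List.cons_append, dynkin]
    simp only [← List.cons_append]
    rw [List.getLast_append_singleton, List.dropLast_concat]
    simp

/-- Linear extension of `dynkin`. -/
def dynkinL : (List (Letter A.X S) →₀ k) →ₗ[k] (List (Letter A.X S) →₀ k) :=
  Finsupp.linearCombination k (dynkin s₀)

@[simp] theorem dynkinL_single (w : List (Letter A.X S)) :
    dynkinL s₀ (Finsupp.single w (1 : k)) = dynkin s₀ w := by simp [dynkinL]

theorem dynkin_mem_permSpan (w : List (Letter A.X S)) : dynkin s₀ w ∈ permSpan w := by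
  generalize hn : w.length = n
  induction n using Nat.strong_induction_on generalizing w with
  | _ n ih =>
  obtain - | ⟨a, w⟩ := w
  · rw [dynkin]; exact zero_mem _
  · obtain rfl | ⟨w, b, rfl⟩ := w.eq_nil_or_concat'
    · rw [dynkin]
      split_ifs
      exacts [single_mem_permSpan (.refl _), zero_mem _]
    · subst hn
      rw [dynkin_cons_concat]
      refine Submodule.sub_mem _ ?_ (Submodule.smul_mem _ _ (snocL_mem_permSpan _ ?_))
      · rw [permSpan_congr (w' := b :: a :: w)
          (((List.perm_append_singleton b w).cons a).trans (List.Perm.swap _ _ _))]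
        exact snocL_mem_permSpan _ (ih _ (by simp) _ rfl)
      · exact ih _ (by simp) _ rfl

/-- The recursion strips the word down to single letters, and each of these is sent to zero. -/
theorem dynkin_unmarked (w : List (Letter A.X S)) (h : ∀ t ∈ w, s₀ ∉ Set.range t.pos) :
    dynkin s₀ w = (0 : List (Letter A.X S) →₀ k) := by
  generalize hn : w.length = n
  induction n using Nat.strong_induction_on generalizing w with
  | _ n ih =>
  obtain - | ⟨a, w⟩ := w
  · rw [dynkin]
  · obtain rfl | ⟨w, b, rfl⟩ := w.eq_nil_or_concat'
    · rw [dynkin, if_neg (h a (by simp))]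
    · subst hn
      rw [dynkin_cons_concat, ih _ (by simp) (a :: w) _ rfl, ih _ (by simp) (w ++ [b]) _ rfl]
      · simp
      · exact fun t ht => h t (by simp at ht ⊢; tauto)
      · exact fun t ht => h t (by simp at ht ⊢; tauto)

/-- Taking off the first letter leaves a word without `s₀`, which is killed. So at every stage only
the term that takes off the last letter survives, and that letter returns to its old place. -/
theorem dynkin_marked (a : Letter A.X S) (ha : s₀ ∈ Set.range a.pos) (w : List (Letter A.X S))
    (h : ∀ t ∈ w, s₀ ∉ Set.range t.pos) :
    dynkin s₀ (a :: w) = (Finsupp.single (a :: w) 1 : List (Letter A.X S) →₀ k) := by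
  induction w using List.reverseRecOn with
  | nil => rw [dynkin, if_pos ha]
  | append_singleton w b ih =>
    rw [dynkin_cons_concat, ih fun t ht => h t (by simp [ht]), dynkin_unmarked s₀ _ h]
    simp

/-- `dynkin` kills the shuffle products. -/
theorem dynkinL_shuffle (u v : List (Letter A.X S)) (hu : u ≠ []) (hv : v ≠ []) :
    dynkinL s₀ (shuffle u v) = (0 : List (Letter A.X S) →₀ k) := by
  -- `F` takes off the last letter and `G` the first one, with its sign, so that `dynkin` is `F - G`
  -- on words with at least two letters.
  let F : (List (Letter A.X S) →₀ k) →ₗ[k] (List (Letter A.X S) →₀ k) :=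
    Finsupp.linearCombination k fun w => if h : w = [] then 0 else
      snocL (w.getLast h) (dynkin s₀ w.dropLast)
  let G : (List (Letter A.X S) →₀ k) →ₗ[k] (List (Letter A.X S) →₀ k) :=
    Finsupp.linearCombination k fun w => if h : w = [] then 0 else
      (-1 : k) ^ w.tail.length • snocL (w.head h) (dynkin s₀ w.tail)
  have hF (b : Letter A.X S) (z) : F (snocL b z) = snocL b (dynkinL s₀ z) := by
    have : F ∘ₗ snocL b = snocL b ∘ₗ dynkinL s₀ := word_hom_ext fun w => by simp [F]
    exact LinearMap.congr_fun this z
  have hG (b : Letter A.X S) (z) : G (consL b z) = snocL b (dynkinL s₀ (signL z)) := by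
    have : G ∘ₗ consL b = snocL b ∘ₗ dynkinL s₀ ∘ₗ signL := word_hom_ext fun w => by
      simp [G, -Finsupp.smul_single]
    exact LinearMap.congr_fun this z
  have hsign (u v : List (Letter A.X S)) :
      signL (shuffle u v) = (-1 : k) ^ (u.length + v.length) • shuffle u v :=
    eq_of_mem_permSpan (g := (-1 : k) ^ (u.length + v.length) • LinearMap.id) (fun w' hw' => by
      rw [signL_single, hw'.length_eq, List.length_append]; rfl) (shuffle_mem_permSpan u v)
  generalize hn : u.length + v.length = n
  induction n using Nat.strong_induction_on generalizing u v with
  | _ n ih =>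
  subst hn
  have hFG : dynkinL s₀ (shuffle u v) = (F - G) (shuffle u v) := by
    refine eq_of_mem_permSpan (fun w hw => ?_) (shuffle_mem_permSpan u v)
    have hl := hw.length_eq
    rw [List.length_append] at hl
    have hu' := List.length_pos_iff.2 hu
    have hv' := List.length_pos_iff.2 hv
    obtain - | ⟨a, w⟩ := w
    · simp at hl; lia
    · obtain rfl | ⟨w, b, rfl⟩ := w.eq_nil_or_concat'
      · simp at hl; lia
      · rw [dynkinL_single, dynkin_cons_concat, LinearMap.sub_apply]
        congr 1
        · have := hF b (Finsupp.single (a :: w) 1)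
          rw [snocL_single, dynkinL_single] at this
          exact this.symm
        · simp [G]
  -- Without its last letter, a shuffle product becomes a combination of shorter shuffle products.
  -- By induction these die, unless one factor has become empty, which happens only if `u` or `v` is
  -- a single letter.
  have h1 : F (shuffle u v) = (if u.tail = [] then (-1 : k) ^ v.length •
      snocL (u.head hu) (dynkin s₀ v) else 0) + if v.tail = [] then
        snocL (v.head hv) (dynkin s₀ u) else 0 := by
    obtain ⟨u', b, rfl⟩ := u.eq_nil_or_concat'.resolve_left hu
    obtain ⟨v', c, rfl⟩ := v.eq_nil_or_concat'.resolve_left hv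
    rw [shuffle_concat, map_add, map_smul, hF, hF]
    congr 1
    · obtain rfl | hu' := eq_or_ne u' []
      · simp [shuffle_nil_left]
      · rw [ih _ (by simp) _ _ hu' hv rfl, map_zero, smul_zero, if_neg]
        obtain - | ⟨d, u'⟩ := u'
        exacts [absurd rfl hu', by simp]
    · obtain rfl | hv' := eq_or_ne v' []
      · simp [shuffle_nil_right]
      · rw [ih _ (by simp) _ _ hu hv' rfl, map_zero, if_neg]
        obtain - | ⟨d, v'⟩ := v'
        exacts [absurd rfl hv', by simp]
  -- The same argument at the first letter. The sign built into `G` makes the surviving terms agree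
  -- with those of `F`.
  have h2 : G (shuffle u v) = (if u.tail = [] then (-1 : k) ^ v.length •
      snocL (u.head hu) (dynkin s₀ v) else 0) + if v.tail = [] then
        snocL (v.head hv) (dynkin s₀ u) else 0 := by
    obtain - | ⟨b, u⟩ := u
    · exact absurd rfl hu
    obtain - | ⟨c, v⟩ := v
    · exact absurd rfl hv
    rw [shuffle, map_add, map_smul, hG, hG, hsign, hsign, map_smul, map_smul, map_smul, map_smul]
    congr 1
    · obtain rfl | hu' := eq_or_ne u []
      · simp [shuffle_nil_left]
      · rw [ih _ (by simp) _ _ hu' hv rfl, map_zero, smul_zero, if_neg]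
        simpa using hu'
    · obtain rfl | hv' := eq_or_ne v []
      · simp [shuffle_nil_right, smul_smul, ← pow_add]
      · rw [ih _ (by simp) _ _ hu hv' rfl, map_zero, smul_zero, smul_zero, if_neg]
        simpa using hv'
  rw [hFG, LinearMap.sub_apply, h1, h2, sub_self]

/-- A word is, up to terms in which `a` appears earlier, a shuffle product. -/
theorem shuffle_sub_mem (a : Letter A.X S) (u v : List (Letter A.X S)) :
    shuffle u (a :: v) - Finsupp.single (u ++ a :: v) (1 : k) ∈ Submodule.span k
      {z | ∃ u' v' : List (Letter A.X S), u'.length < u.length ∧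
        z = Finsupp.single (u' ++ a :: v') (1 : k)} := by
  induction u with
  | nil => simp [shuffle_nil_left]
  | cons c u ih =>
    rw [shuffle, add_sub_right_comm]
    refine Submodule.add_mem _ ?_ (Submodule.smul_mem _ _ ?_)
    · rw [List.cons_append, ← consL_single, ← map_sub]
      refine Submodule.span_le (p := (Submodule.span k _).comap (consL c)).2 ?_ ih
      rintro _ ⟨u', v', h, rfl⟩
      exact Submodule.subset_span ⟨c :: u', v', by simpa using h, by simp⟩
    -- In this summand `a` is the first letter, so the prefix `[]` is shorter than `c :: u`,
    -- whatever follows.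
    · generalize shuffle (c :: u) v = z
      induction z using Finsupp.induction_linear with
      | zero => simp
      | add x y hx hy => rw [map_add]; exact Submodule.add_mem _ hx hy
      | single w r =>
        rw [← mul_one r, ← smul_eq_mul, ← Finsupp.smul_single, map_smul, consL_single]
        exact Submodule.smul_mem _ _ (Submodule.subset_span ⟨[], w, by simp, rfl⟩)

/-! ### Compatibility of the transposed bracketing with the tensor relations -/

theorem tensorRel_snocL (t : Letter A.X S) :
    tensorRel A.X S ≤ (tensorRel A.X S).comap (snocL t) := by
  have h : Respects fun w : List (Letter A.X S) => (tq A.X S ∘ₗ snocL t) (Finsupp.single w 1) := by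
    simpa using respects_tq.append_right [t]
  have := respects_iff.2 h
  rwa [LinearMap.ker_comp, Submodule.ker_mkQ] at this

theorem tq_snocL (t : Letter A.X S) (z : List (Letter A.X S) →₀ k) :
    tq A.X S (snocL t z) = (tensorRel A.X S).mapQ _ (snocL t) (tensorRel_snocL t) (tq A.X S z) :=
  rfl

theorem LetterRespects.smul {M : SymSeq k} {N : Type*} [AddCommGroup N] [Module k N]
    {F : Letter M S → N} (hF : LetterRespects F) (c : k) : LetterRespects fun t => c • F t :=
  hF.comp (c • (LinearMap.id : N →ₗ[k] N))

/-- Interchanging the two sums, over letters and over the words of `z`, reduces the claim to the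
relations in the last letter of a fixed word. -/
theorem letterRespects_snocL (z : List (Letter A.X S) →₀ k) :
    LetterRespects fun t : Letter A.X S => tq A.X S (snocL t z) := by
  intro r hr
  have : Finsupp.linearCombination k (fun t : Letter A.X S => tq A.X S (snocL t z)) =
      Finsupp.linearCombination k (fun w : List (Letter A.X S) => Finsupp.linearCombination k
        fun t => tq A.X S (Finsupp.single (w ++ [t]) 1)) z := by
    refine Finsupp.lhom_ext' fun t => LinearMap.ext_ring ?_
    rw [LinearMap.comp_apply, Finsupp.lsingle_apply, Finsupp.linearCombination_single, one_smul,
      LinearMap.comp_apply, Finsupp.lsingle_apply, snocL, Finsupp.linearCombination_apply,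
      Finsupp.linearCombination_apply, Finsupp.sum, Finsupp.sum, map_sum, LinearMap.sum_apply]
    refine Finset.sum_congr rfl fun w _ => ?_
    rw [map_smul, LinearMap.smul_apply, Finsupp.linearCombination_single, one_smul]
  rw [this, Finsupp.linearCombination_apply, Finsupp.sum, LinearMap.sum_apply]
  refine Finset.sum_eq_zero fun w _ => ?_
  rw [LinearMap.smul_apply, respects_tq.letter w [] r hr, smul_zero]

/-- The test whether `s₀` is a position of a letter only depends on the set of positions of the
letter, and the relations preserve this set. In the recursion the varying letter is either the one
taken off or part of the remaining word; the cases distinguish whether it stands first, last, both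
or neither. -/
theorem letterRespects_dynkin (l l' : List (Letter A.X S)) :
    LetterRespects fun t => tq A.X S (dynkin s₀ (l ++ t :: l')) := by
  generalize hn : l.length + l'.length = n
  induction n using Nat.strong_induction_on generalizing l l' with
  | _ n ih =>
  subst hn
  obtain - | ⟨a, l⟩ := l
  · obtain rfl | ⟨l', b, rfl⟩ := l'.eq_nil_or_concat'
    · simp only [List.nil_append, dynkin]
      rintro _ (⟨p, i, x, y⟩ | ⟨p, i, c, x⟩ | ⟨s, t, hst⟩)
      · have := respects_tq.letter [] [] _ (.add p i x y)
        by_cases h : s₀ ∈ Set.range i <;> simp_all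
      · have := respects_tq.letter [] [] _ (.smul p i c x)
        by_cases h : s₀ ∈ Set.range i <;> simp_all
      · have := respects_tq.letter [] [] _ (.equiv s t hst)
        obtain ⟨e, h1, -⟩ := hst
        have h2 : Set.range s.pos = Set.range t.pos := by rw [← h1, e.surjective.range_comp]
        by_cases h : s₀ ∈ Set.range t.pos
        · simpa [h2, h] using this
        · simp [h2, h]
    · simp only [List.nil_append, dynkin_cons_concat, map_sub, map_smul, tq_snocL b]
      exact ((ih _ (by simp) [] l' rfl).comp _).sub ((letterRespects_snocL _).smul _)
  · obtain rfl | ⟨l', b, rfl⟩ := l'.eq_nil_or_concat'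
    · simp only [List.cons_append, dynkin_cons_concat, map_sub, map_smul, tq_snocL a]
      exact (letterRespects_snocL _).sub (((ih _ (by simp) l [] rfl).comp _).smul _)
    · simp only [List.cons_append]
      have h (t : Letter A.X S) : l ++ t :: (l' ++ [b]) = (l ++ t :: l') ++ [b] := by simp
      simp only [h, dynkin_cons_concat, map_sub, map_smul, tq_snocL a, tq_snocL b,
        List.length_append, List.length_cons]
      have h1 := ih _ (by simp) (a :: l) l' rfl
      have h2 := ih _ (by simp) l (l' ++ [b]) rfl
      simp only [h] at h2
      exact (h1.comp _).sub ((h2.comp _).smul _)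

end

/-! ### Words whose first letter contains a given position -/

namespace BarMod

variable {A : ReducedCommShuffleAlg k} {S : Type} (s : ℕ) (s₀ : S)

theorem q_eq_zero_of_mem_permSpan {w : List (Letter A.X S)}
    (h : ¬ (w ≠ [] ∧ w.length = s ∧ IsDecomposition w)) {z : List (Letter A.X S) →₀ k}
    (hz : z ∈ permSpan w) : q A.X s S z = 0 :=
  eq_of_mem_permSpan (g := 0) (fun w' hw' => q_single_eq_zero fun h' => h
    ⟨fun h0 => h'.1 (by subst h0; exact hw'.eq_nil), hw'.length_eq ▸ h'.2.1, h'.2.2.perm hw'⟩) hz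

/-- The operator `dynkin` on the bar construction. -/
def dynkin : BarMod A.X s S →ₗ[k] BarMod A.X s S :=
  lift (q A.X s S ∘ₗ dynkinL s₀)
    (by
      have h : Respects fun w : List (Letter A.X S) =>
          (tq A.X S ∘ₗ dynkinL s₀) (Finsupp.single w 1) := by
        simp only [LinearMap.comp_apply, dynkinL_single]
        exact respects_of_letter (F := fun w => tq A.X S (ShuffleAlg.dynkin s₀ w))
          (letterRespects_dynkin s₀)
      have := respects_iff.2 h
      rw [LinearMap.ker_comp, Submodule.ker_mkQ] at this ⊢
      exact this.trans (Submodule.comap_mono tensorRel_le))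
    (fun w h => by
      rw [LinearMap.comp_apply, dynkinL_single]
      exact q_eq_zero_of_mem_permSpan s h (dynkin_mem_permSpan s₀ w))

@[simp] theorem dynkin_q (z : List (Letter A.X S) →₀ k) :
    dynkin s s₀ (q A.X s S z) = q A.X s S (dynkinL s₀ z) := rfl

/-- The submodule spanned by the words whose first letter contains the position `s₀`. -/
def marked : Submodule k (BarMod A.X s S) :=
  Submodule.span k {z | ∃ a w, s₀ ∈ Set.range a.pos ∧ z = q A.X s S (Finsupp.single (a :: w) 1)}

variable {s₀}

theorem unmarked_of_isDecomposition {M : SymSeq k} {a : Letter M S} {w : List (Letter M S)}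
    (h : IsDecomposition (a :: w)) (ha : s₀ ∈ Set.range a.pos) (t : Letter M S) (ht : t ∈ w) :
    s₀ ∉ Set.range t.pos := by
  intro hs
  have := h.1
  simp only [positions, List.flatMap_cons, List.nodup_append] at this
  exact this.2.2 s₀ (by simpa [List.mem_ofFn] using ha) s₀
    (List.mem_flatMap.2 ⟨t, ht, by simpa [List.mem_ofFn] using hs⟩) rfl

/-- Together with `dynkin_of_mem_barDecomposables`, this shows that marked elements and
decomposables meet only in zero. Representatives that are not decompositions of the right length are
zero anyway, so the marked letter may be assumed to be the only one that contains `s₀`. -/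
theorem dynkin_of_mem_marked {x : BarMod A.X s S} (hx : x ∈ marked s s₀) : dynkin s s₀ x = x := by
  have : marked s s₀ ≤ LinearMap.eqLocus (dynkin s s₀) (LinearMap.id : BarMod A.X s S →ₗ[k] _) := by
    refine Submodule.span_le.2 ?_
    rintro _ ⟨a, w, ha, rfl⟩
    change dynkin s s₀ _ = _
    by_cases h : a :: w ≠ [] ∧ (a :: w).length = s ∧ IsDecomposition (a :: w)
    · rw [dynkin_q, dynkinL_single, dynkin_marked s₀ a ha w (unmarked_of_isDecomposition h.2.2 ha)]
      rfl
    · rw [q_single_eq_zero h, map_zero, map_zero]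
  exact this hx

theorem consL_mem_marked {a : Letter A.X S} (ha : s₀ ∈ Set.range a.pos)
    (z : List (Letter A.X S) →₀ k) : q A.X s S (consL a z) ∈ marked s s₀ := by
  induction z using Finsupp.induction_linear with
  | zero => simp
  | add x y hx hy => rw [map_add, map_add]; exact Submodule.add_mem _ hx hy
  | single w r =>
    rw [← mul_one r, ← smul_eq_mul, ← Finsupp.smul_single, map_smul, map_smul, consL_single]
    exact Submodule.smul_mem _ _ (Submodule.subset_span ⟨a, w, ha, rfl⟩)

theorem mem_range_mulLetter_left {a : Letter A.X S} (ha : s₀ ∈ Set.range a.pos)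
    (b : Letter A.X S) : s₀ ∈ Set.range (mulLetter a b).pos := by
  obtain ⟨i, rfl⟩ := ha
  exact ⟨Fin.castAdd _ i, Fin.append_left _ _ _⟩

/-- The only face that changes the first letter multiplies it by the second one, and the product
still contains `s₀`. So the marked words span a subcomplex. -/
theorem d_mem_marked {x : BarMod A.X (s + 1) S} (hx : x ∈ marked (s + 1) s₀) :
    d A s S x ∈ marked s s₀ := by
  have : marked (s + 1) s₀ ≤ (marked s s₀).comap (d A s S) := by
    refine Submodule.span_le.2 ?_
    rintro _ ⟨a, w, ha, rfl⟩
    rw [SetLike.mem_coe, Submodule.mem_comap, d_q, bdryL_single, bdry, map_sub]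
    refine Submodule.sub_mem _ ?_ (consL_mem_marked s ha _)
    obtain - | ⟨b, w⟩ := w
    · simp [mulFirst]
    · exact Submodule.subset_span ⟨_, _, mem_range_mulLetter_left ha b, rfl⟩
  exact this hx

end BarMod

/-! ### Marked words as a complement of the shuffle products -/

theorem BarMod.dynkin_of_mem_barDecomposables {A : ReducedCommShuffleAlg k} {s ℓ : ℕ} (s₀ : Fin ℓ)
    {x : BarMod A.X s (Fin ℓ)} (hx : x ∈ barDecomposables A s ℓ) : BarMod.dynkin s s₀ x = 0 := by
  have : barDecomposables A s ℓ ≤ LinearMap.ker (BarMod.dynkin s s₀) := by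
    refine Submodule.span_le.2 ?_
    rintro _ ⟨u, v, hu, hv, rfl⟩
    rw [SetLike.mem_coe, LinearMap.mem_ker, BarMod.dynkin_q, dynkinL_shuffle s₀ u v hu hv, map_zero]
  exact this hx

/-- Some letter of a decomposition contains `s₀`. Modulo shuffle products it can be moved towards
the front by `shuffle_sub_mem`; the induction is on the number of letters before it. -/
theorem BarMod.marked_sup_barDecomposables (A : ReducedCommShuffleAlg k) (s : ℕ) {ℓ : ℕ}
    (s₀ : Fin ℓ) : BarMod.marked s s₀ ⊔ barDecomposables A s ℓ = ⊤ := by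
  have key (a : Letter A.X (Fin ℓ)) (ha : s₀ ∈ Set.range a.pos) (u v : List (Letter A.X (Fin ℓ))) :
      BarMod.q A.X s (Fin ℓ) (Finsupp.single (u ++ a :: v) 1) ∈
        BarMod.marked s s₀ ⊔ barDecomposables A s ℓ := by
    generalize hn : u.length = n
    induction n using Nat.strong_induction_on generalizing u v with
    | _ n ih =>
    subst hn
    obtain rfl | hu := eq_or_ne u []
    · exact Submodule.mem_sup_left (Submodule.subset_span ⟨a, v, ha, rfl⟩)
    · have h1 : BarMod.q A.X s (Fin ℓ) (shuffle u (a :: v)) ∈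
          BarMod.marked s s₀ ⊔ barDecomposables A s ℓ :=
        Submodule.mem_sup_right (Submodule.subset_span ⟨u, a :: v, hu, by simp, rfl⟩)
      have h2 := (Submodule.span_le (p := (BarMod.marked s s₀ ⊔ barDecomposables A s ℓ).comap
        (BarMod.q A.X s (Fin ℓ)))).2 (by
          rintro _ ⟨u', v', h, rfl⟩
          exact ih _ h u' v' rfl) (shuffle_sub_mem a u v)
      rw [Submodule.mem_comap, map_sub] at h2
      exact (Submodule.sub_mem_iff_right _ h1).1 h2
  refine eq_top_iff.2 fun x _ => ?_
  obtain ⟨z, rfl⟩ := Submodule.mkQ_surjective _ x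
  induction z using Finsupp.induction_linear with
  | zero => simp
  | add x y hx hy => rw [map_add]; exact Submodule.add_mem _ (hx trivial) (hy trivial)
  | single w r =>
    rw [← mul_one r, ← smul_eq_mul, ← Finsupp.smul_single, map_smul]
    refine Submodule.smul_mem _ _ ?_
    by_cases h : w ≠ [] ∧ w.length = s ∧ IsDecomposition w
    · obtain ⟨a, ha, hs⟩ := List.mem_flatMap.1 (h.2.2.2 s₀)
      obtain ⟨u, v, rfl⟩ := List.append_of_mem ha
      exact key a (by simpa [List.mem_ofFn] using hs) u v
    · rw [BarMod.q_single_eq_zero h]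
      exact zero_mem _

end

end ShuffleAlg

namespace ShuffleAlg

noncomputable section

variable {k : Type u} [CommRing k]

/-! ### Sums over the decompositions of a word into a letter and the remaining word -/

section SplitSum

variable {M : SymSeq k} {S : Type} {N : Type*} [AddCommGroup N]

/-- The sum of `G m r` over all ways to remove a letter `m` from a word, with remaining word `r`. -/
def splitSum (G : Letter M S → List (Letter M S) → N) : List (Letter M S) → N
  | [] => 0
  | m :: v => G m v + splitSum (fun m' r => G m' (m :: r)) v

theorem splitSum_mem {G : Letter M S → List (Letter M S) → N} (P : AddSubgroup N)
    {v : List (Letter M S)} (h : ∀ m r, (m :: r).Perm v → G m r ∈ P) : splitSum G v ∈ P := by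
  induction v generalizing G with
  | nil => exact zero_mem P
  | cons a v ih =>
    exact add_mem (h a v (.refl _)) (ih fun m r hr =>
      h m (a :: r) ((List.Perm.swap _ _ _).trans (hr.cons a)))

theorem splitSum_eq_zero {G : Letter M S → List (Letter M S) → N} {v : List (Letter M S)}
    (h : ∀ m r, (m :: r).Perm v → G m r = 0) : splitSum G v = 0 :=
  splitSum_mem ⊥ h

theorem splitSum_perm {G : Letter M S → List (Letter M S) → N}
    (hG : ∀ m r r', r.Perm r' → G m r = G m r') {v v' : List (Letter M S)} (h : v.Perm v') :
    splitSum G v = splitSum G v' := by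
  induction h generalizing G with
  | nil => rfl
  | @cons t l l' h ih =>
    rw [splitSum, splitSum, hG t l l' h, ih fun m r r' hr => hG m _ _ (hr.cons t)]
  | swap a b l =>
    simp only [splitSum]
    have : (fun m r => G m (b :: a :: r)) = fun m r => G m (a :: b :: r) :=
      funext fun m => funext fun r => hG m _ _ (List.Perm.swap _ _ _)
    rw [this]
    abel
  | trans h h' ih ih' => rw [ih hG, ih' hG]

variable [Module k N]

theorem LetterRespects.add {F G : Letter M S → N} (hF : LetterRespects F)
    (hG : LetterRespects G) : LetterRespects fun t => F t + G t := by
  intro z hz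
  have : Finsupp.linearCombination k (fun t => F t + G t) =
      Finsupp.linearCombination k F + Finsupp.linearCombination k G :=
    Finsupp.lhom_ext' fun w => LinearMap.ext_ring (by simp)
  rw [this, LinearMap.add_apply, hF z hz, hG z hz, add_zero]

theorem letterRespects_splitSum_param {M' : SymSeq k} {S' : Type}
    {G : Letter M' S' → Letter M S → List (Letter M S) → N}
    (hG : ∀ m r, LetterRespects fun t => G t m r) (v : List (Letter M S)) :
    LetterRespects fun t => splitSum (G t) v := by
  induction v generalizing G with
  | nil => exact letterRespects_zero
  | cons a v ih => exact (hG a v).add (ih fun m r => hG m (a :: r))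

/-- The varying letter is the removed letter in one summand and belongs to the remaining word in all
others; `h1` and `h2` cover these two cases. -/
theorem letterRespects_splitSum {G : Letter M S → List (Letter M S) → N}
    (h1 : ∀ r, LetterRespects fun m => G m r)
    (h2 : ∀ m l l', LetterRespects fun t => G m (l ++ t :: l')) (l l' : List (Letter M S)) :
    LetterRespects fun t => splitSum G (l ++ t :: l') := by
  induction l generalizing G with
  | nil => exact (h1 l').add (letterRespects_splitSum_param (fun m r => h2 m [] r) l')
  | cons a l ih =>
    exact (h2 a l l').add (ih (fun r => h1 (a :: r)) fun m l l' => h2 m (a :: l) l')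

open Classical in
theorem LetterRespects.ite_mem {F : Letter M S → N} (hF : LetterRespects F) (s₀ : S) :
    LetterRespects fun t => if s₀ ∈ Set.range t.pos then F t else 0 := by
  rintro _ (⟨p, i, x, y⟩ | ⟨p, i, c, x⟩ | ⟨s, t, hst⟩)
  · have := hF _ (.add p i x y)
    by_cases h : s₀ ∈ Set.range i <;> simp_all
  · have := hF _ (.smul p i c x)
    by_cases h : s₀ ∈ Set.range i <;> simp_all
  · have := hF _ (.equiv s t hst)
    obtain ⟨e, h1, -⟩ := hst
    have h2 : Set.range s.pos = Set.range t.pos := by rw [← h1, e.surjective.range_comp]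
    rw [map_sub, Finsupp.linearCombination_single, Finsupp.linearCombination_single, one_smul,
      one_smul] at this ⊢
    simp only [h2]
    split_ifs
    exacts [this, sub_zero 0]

/-! ### Decompositions and the relations between letters -/

theorem positions_perm_of_equiv {s t : Letter M S} (h : LetterEquiv s t)
    (l l' : List (Letter M S)) : (positions (l ++ s :: l')).Perm (positions (l ++ t :: l')) := by
  obtain ⟨p, i, x⟩ := s
  obtain ⟨q, j, y⟩ := t
  obtain ⟨e, h1, -⟩ := h
  dsimp only at e h1
  obtain rfl : p = q := by simpa using Fintype.card_congr e
  have h : (List.ofFn i).Perm (List.ofFn j) := h1 ▸ Equiv.Perm.ofFn_comp_perm e j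
  simp only [positions, List.flatMap_append, List.flatMap_cons]
  exact (h.append_right _).append_left _

theorem isDecomposition_congr {w w' : List (Letter M S)} (h : (positions w).Perm (positions w')) :
    IsDecomposition w ↔ IsDecomposition w' := by
  simp only [IsDecomposition, h.nodup_iff, h.mem_iff]

open Classical in
-- Maps out of `FreeMod` must vanish on words that are not decompositions. This truncation is
-- harmless, because being a decomposition depends only on the list of positions up to order, which
-- the relations preserve.
theorem Respects.ite_isDecomposition {F : List (Letter M S) → N} (h : Respects F) :
    Respects fun w => if IsDecomposition w then F w else 0 where
  add l l' p i x y := by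
    have h1 : IsDecomposition (M := M) (l ++ ⟨p, i, x + y⟩ :: l') ↔
      IsDecomposition (M := M) (l ++ ⟨p, i, x⟩ :: l') :=
        isDecomposition_congr (by simp [positions])
    have h2 : IsDecomposition (M := M) (l ++ ⟨p, i, y⟩ :: l') ↔
      IsDecomposition (M := M) (l ++ ⟨p, i, x⟩ :: l') :=
        isDecomposition_congr (by simp [positions])
    simp only [h1, h2]
    split_ifs
    exacts [h.add l l' p i x y, (add_zero 0).symm]
  smul l l' p i c x := by
    have h1 : IsDecomposition (M := M) (l ++ ⟨p, i, c • x⟩ :: l') ↔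
      IsDecomposition (M := M) (l ++ ⟨p, i, x⟩ :: l') :=
        isDecomposition_congr (by simp [positions])
    simp only [h1]
    split_ifs
    exacts [h.smul l l' p i c x, (smul_zero c).symm]
  balanced l l' p i π x := by
    have h1 := isDecomposition_congr
      (positions_perm_of_equiv (M := M) (letterEquiv_balanced i π x) l l')
    simp only [h1, h.balanced l l' p i π x]

end SplitSum

/-! ### Words whose first letter is a product -/

section MulCons

variable {A : ReducedCommShuffleAlg k} {S T : Type}

/-- The word `w`, preceded by the product of the letters of `v`. -/
def mulCons (v w : List (Letter A.X S)) : List (Letter A.X S) →₀ k :=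
  match prodWord v with
  | none => 0
  | some c => Finsupp.single (c :: w) 1

theorem mulCons_some {v w : List (Letter A.X S)} {c : Letter A.X S} (h : prodWord v = some c) :
    mulCons v w = Finsupp.single (c :: w) (1 : k) := by rw [mulCons, h]

/-- Because of this value the homotopy vanishes on words whose first letter is a single generator,
where nothing can be split off. -/
theorem mulCons_nil (w : List (Letter A.X S)) : mulCons [] w = (0 : List (Letter A.X S) →₀ k) := rfl

theorem respects_mulCons (w : List (Letter A.X S)) :
    Respects fun v : List (Letter A.X S) => tq A.X S (mulCons v w) where
  add l l' p i x y := by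
    obtain ⟨q, j, X, Y, h1, h2, h3⟩ := prodWord_add l l' p i x y
    rw [mulCons_some h1, mulCons_some h2, mulCons_some h3]
    exact respects_tq.add [] w q j X Y
  smul l l' p i c x := by
    obtain ⟨q, j, X, h1, h2⟩ := prodWord_smul l l' p i c x
    rw [mulCons_some h1, mulCons_some h2]
    exact respects_tq.smul [] w q j c X
  balanced l l' p i π x := by
    obtain ⟨u, v, h1, h2, h3⟩ := prodWord_congr (A := A) l l' (letterEquiv_balanced i π x)
    rw [mulCons_some h1, mulCons_some h2]
    exact respects_tq.congr h3 [] w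

theorem mulCons_perm {v v' : List (Letter A.X S)} (h : v.Perm v') (w : List (Letter A.X S)) :
    tq A.X S (mulCons v w) = tq A.X S (mulCons v' w) := by
  by_cases hv : v = []
  · subst hv
    rw [h.nil_eq]
  · obtain ⟨u, u', h1, h2, h3⟩ := prodWord_perm h hv
    rw [mulCons_some h1, mulCons_some h2]
    exact respects_tq.congr h3 [] w

theorem letterRespects_mulCons (v l l' : List (Letter A.X S)) :
    LetterRespects fun t => tq A.X S (mulCons v (l ++ t :: l')) := by
  rcases h : prodWord v with - | c
  · simpa only [mulCons, h, map_zero] using letterRespects_zero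
  · simp only [mulCons, h]
    exact respects_tq.letter (c :: l) l'

theorem LetterEquiv.relabel {M : SymSeq k} {s t : Letter M S} (h : LetterEquiv s t) (g : S → T) :
    LetterEquiv (s.relabel g) (t.relabel g) := by
  obtain ⟨e, h1, h2⟩ := h
  exact ⟨e, congrArg (g ∘ ·) h1, h2⟩

end MulCons

/-! ### The unit of the free algebra -/

/-- The inclusion `M → C̄(M)` of the words with one letter. -/
def freeUnit (M : SymSeq k) (ℓ : ℕ) : M ℓ ⟶ freeSeq M ℓ := Rep.ofHom
  { toFun := fun x => FreeMod.mk [⟨ℓ, id, x⟩]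
    map_add' := fun x y => FreeMod.respects_mk.add [] [] ℓ id x y
    map_smul' := fun c x => FreeMod.respects_mk.smul [] [] ℓ id c x
    isIntertwining' := fun π => LinearMap.ext fun x => by
      have := FreeMod.respects_mk.balanced (M := M) [] [] ℓ id π x
      exact this.symm.trans (FreeMod.relabel_mk π [⟨ℓ, id, x⟩]).symm }

theorem transport_mk (M : SymSeq k) {m n : ℕ} (e : Fin m ≃ Fin n) (v : List (Letter M (Fin m))) :
    transport (freeSeq M) e (FreeMod.mk v : FreeMod M (Fin m)) =
      (FreeMod.mk (v.map (Letter.relabel e)) : FreeMod M (Fin n)) := by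
  obtain rfl : m = n := by simpa using Fintype.card_congr e
  exact FreeMod.relabel_mk e v

section Free

variable {M : SymSeq k} (hM : Subsingleton (M 0)) {S T : Type}

/-- The word in `C̄(M)` corresponding to a word in `M`. -/
abbrev unitWord (v : List (Letter M S)) : List (Letter (freeAlg M hM).X S) :=
  v.map (Letter.map (freeUnit M))

theorem unitWord_relabel (g : S → T) (v : List (Letter M S)) :
    unitWord hM (v.map (Letter.relabel g)) = (unitWord hM v).map (Letter.relabel g) := by
  simp only [unitWord, List.map_map]
  rfl

/-- The letter of `C̄(M)` with positions `i` and element the class of the word `v`. -/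
def wordLetter {p : ℕ} (i : Fin p → S) (v : List (Letter M (Fin p))) :
    Letter (freeAlg M hM).X S :=
  ⟨p, i, (FreeMod.mk v : FreeMod M (Fin p))⟩

theorem mulLetter_wordLetter {p q : ℕ} (i : Fin p → S) (j : Fin q → S)
    {v : List (Letter M (Fin p))} {w : List (Letter M (Fin q))} (hv : v ≠ []) (hw : w ≠ []) :
    mulLetter (wordLetter hM i v) (wordLetter hM j w) = wordLetter hM (Fin.append i j)
      (v.map (Letter.relabel (finSumFinEquiv ∘ Sum.inl)) ++
        w.map (Letter.relabel (finSumFinEquiv ∘ Sum.inr))) :=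
  congrArg (fun x => (⟨p + q, Fin.append i j, x⟩ : Letter (freeAlg M hM).X S))
    (FreeMod.mul_mk finSumFinEquiv hv hw)

theorem relabel_append {p q : ℕ} (i : Fin p → S) (j : Fin q → S)
    (v : List (Letter M (Fin p))) (w : List (Letter M (Fin q))) :
    (v.map (Letter.relabel (finSumFinEquiv ∘ Sum.inl)) ++
      w.map (Letter.relabel (finSumFinEquiv ∘ Sum.inr))).map (Letter.relabel (Fin.append i j)) =
    v.map (Letter.relabel i) ++ w.map (Letter.relabel j) := by
  rw [List.map_append, Letter.relabel_relabel, Letter.relabel_relabel, ← Function.comp_assoc,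
    ← Function.comp_assoc, append_finSumFinEquiv, Sum.elim_comp_inl, Sum.elim_comp_inr]

/-- Products in `C̄(M)` are concatenations. The level of a product is the sum of the levels of its
factors, so the word `v` is only recovered after relabelling along the positions `i` of the product.
-/
theorem exists_prodWord_unitWord {v : List (Letter M S)} {t : Letter (freeAlg M hM).X S}
    (h : prodWord (unitWord hM v) = some t) : ∃ (p : ℕ) (i : Fin p → S)
      (v' : List (Letter M (Fin p))), v' ≠ [] ∧ t = wordLetter hM i v' ∧
        v'.map (Letter.relabel i) = v := by
  induction v generalizing t with
  | nil => simp [prodWord] at h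
  | cons m v ih =>
    have hm : Letter.map (freeUnit M) m = wordLetter hM m.pos [⟨m.lvl, id, m.elt⟩] := rfl
    rcases h' : prodWord (unitWord hM v) with - | t'
    · obtain rfl : v = [] := by simpa using prodWord_eq_none h'
      obtain rfl : Letter.map (freeUnit M) m = t := Option.some.inj h
      exact ⟨_, _, _, by simp, hm, rfl⟩
    · obtain ⟨p, i, v', hv', rfl, rfl⟩ := ih h'
      rw [unitWord, List.map_cons] at h
      have h2 := (prodWord_cons_some h').symm.trans h
      obtain rfl := Option.some.inj h2
      refine ⟨_, _, _, ?_, (congrArg (fun x => mulLetter x _) hm).trans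
        (mulLetter_wordLetter hM _ _ (by simp) hv'), ?_⟩
      · simp
      · rw [relabel_append]
        rfl

/-- The positions of `t` form a bijection onto `{1,…,p}`, and relabelling along it turns the word of
`exists_prodWord_unitWord` into `v`. -/
theorem prodWord_unitWord_equiv_id {p : ℕ} {v : List (Letter M (Fin p))} (hv : IsDecomposition v)
    {t : Letter (freeAlg M hM).X (Fin p)} (h : prodWord (unitWord hM v) = some t) :
    LetterEquiv t (wordLetter hM id v) := by
  have hb := (prodWord_bijective h).2 ((isDecomposition_map _ v).2 hv)
  obtain ⟨q, i, v', hv', rfl, rfl⟩ := exists_prodWord_unitWord hM h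
  exact ⟨Equiv.ofBijective _ hb, rfl, transport_mk M (Equiv.ofBijective _ hb) v'⟩

/-- The product of the letters of a word of generators is the class of this word. -/
theorem prodWord_unitWord_equiv {p : ℕ} (i : Fin p → S) {v : List (Letter M (Fin p))}
    (hv : IsDecomposition v) {t : Letter (freeAlg M hM).X S}
    (h : prodWord (unitWord hM (v.map (Letter.relabel i))) = some t) :
    LetterEquiv t (wordLetter hM i v) := by
  rw [unitWord_relabel, prodWord_relabel, Option.map_eq_some_iff] at h
  obtain ⟨t', h, rfl⟩ := h
  exact (prodWord_unitWord_equiv_id hM hv h).relabel i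

/-! ### The contracting homotopy -/

variable (s₀ : S)

open Classical in
/-- The summand `[m | r | w]` of the homotopy, where the letter `m` and the word `r` of generators
are the factors of the first letter of a word `[m r | w]`. -/
def splitTerm (w : List (Letter (freeAlg M hM).X S)) (m : Letter M S) (r : List (Letter M S)) :
    (List (Letter (freeAlg M hM).X S) →₀ k) ⧸ tensorRel (freeAlg M hM).X S :=
  if s₀ ∈ Set.range m.pos then
    tq _ S (consL (M := (freeAlg M hM).X) (m.map (freeUnit M)) (mulCons (unitWord hM r) w)) else 0

open Classical in
/-- The value of the homotopy on a word with first letter the class of a word `v` of generators. -/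
def splitWord {p : ℕ} (i : Fin p → S) (w : List (Letter (freeAlg M hM).X S))
    (v : List (Letter M (Fin p))) :
    (List (Letter (freeAlg M hM).X S) →₀ k) ⧸ tensorRel (freeAlg M hM).X S :=
  -- Summing over all letters, instead of choosing the one that contains `s₀`, makes the value
  -- visibly linear in each letter and invariant under reordering. `split_wordLetter` recovers the
  -- single summand that counts.
  if IsDecomposition v then splitSum (splitTerm hM s₀ w) (v.map (Letter.relabel i)) else 0

theorem splitTerm_perm (w : List (Letter (freeAlg M hM).X S)) (m : Letter M S)
    (r r' : List (Letter M S)) (h : r.Perm r') :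
    splitTerm hM s₀ w m r = splitTerm hM s₀ w m r' := by
  rw [splitTerm, splitTerm]
  split_ifs
  · exact tq_consL_congr _ (mulCons_perm (h.map _) w)
  · rfl

theorem LetterRespects.map {N : Type*} [AddCommGroup N] [Module k N] {M M' : SymSeq k}
    {F : Letter M' S → N} (hF : LetterRespects F) (f : ∀ ℓ, M ℓ ⟶ M' ℓ) :
    LetterRespects fun t => F (t.map f) := by
  rintro _ (⟨p, i, x, y⟩ | ⟨p, i, c, x⟩ | ⟨s, t, e, h1, h2⟩)
  · simpa [Letter.map] using hF _ (.add p i ((f p).hom x) ((f p).hom y))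
  · simpa [Letter.map] using hF _ (.smul p i c ((f p).hom x))
  · simpa using hF _ (.equiv (s.map f) (t.map f)
      ⟨e, h1, (map_transport f e s.elt).symm.trans (congrArg (f t.lvl).hom h2)⟩)

theorem letterRespects_splitTerm_left (w : List (Letter (freeAlg M hM).X S))
    (r : List (Letter M S)) : LetterRespects fun m => splitTerm hM s₀ w m r :=
  ((letterRespects_consL (M := (freeAlg M hM).X) (mulCons (unitWord hM r) w)).map
    (freeUnit M)).ite_mem s₀

theorem letterRespects_splitTerm_right (w : List (Letter (freeAlg M hM).X S)) (m : Letter M S)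
    (l l' : List (Letter M S)) : LetterRespects fun t => splitTerm hM s₀ w m (l ++ t :: l') := by
  by_cases h : s₀ ∈ Set.range m.pos
  · simp only [splitTerm, if_pos h, tq_consL]
    exact (((respects_mulCons w).map (freeUnit M)).letter l l').comp _
  · simpa only [splitTerm, if_neg h] using letterRespects_zero

theorem letterRespects_splitTerm_word (l l' : List (Letter (freeAlg M hM).X S)) (m : Letter M S)
    (r : List (Letter M S)) : LetterRespects fun t => splitTerm hM s₀ (l ++ t :: l') m r := by
  by_cases h : s₀ ∈ Set.range m.pos
  · simp only [splitTerm, if_pos h, tq_consL]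
    exact (letterRespects_mulCons _ l l').comp _
  · simpa only [splitTerm, if_neg h] using letterRespects_zero

/-- The homotopy on words with a given first letter. -/
def splitFirst {p : ℕ} (i : Fin p → S) (w : List (Letter (freeAlg M hM).X S)) :
    FreeMod M (Fin p) →ₗ[k]
      (List (Letter (freeAlg M hM).X S) →₀ k) ⧸ tensorRel (freeAlg M hM).X S :=
  FreeMod.lift (splitWord hM s₀ i w)
    ((respects_of_letter (letterRespects_splitSum (letterRespects_splitTerm_left hM s₀ w)
      (letterRespects_splitTerm_right hM s₀ w))).relabel i).ite_isDecomposition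
    (fun v v' h => by
      have h1 : IsDecomposition v ↔ IsDecomposition v' := ⟨.perm h, .perm h.symm⟩
      by_cases hv : IsDecomposition v
      · rw [splitWord, splitWord, if_pos hv, if_pos (h1.1 hv),
          splitSum_perm (splitTerm_perm hM s₀ w) (h.map (Letter.relabel i))]
      · rw [splitWord, splitWord, if_neg hv, if_neg (h1.not.1 hv)])
    (fun v hv => by
      rw [splitWord]
      split_ifs with h
      · obtain rfl : v = [] := by
          by_contra h'
          exact hv ⟨h', h⟩
        rfl
      · rfl)

theorem splitFirst_mk {p : ℕ} (i : Fin p → S) (w : List (Letter (freeAlg M hM).X S))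
    (v : List (Letter M (Fin p))) :
    splitFirst hM s₀ i w (FreeMod.mk v) = splitWord hM s₀ i w v := FreeMod.lift_mk ..

/-- The homotopy on words. -/
def split : List (Letter (freeAlg M hM).X S) →
    (List (Letter (freeAlg M hM).X S) →₀ k) ⧸ tensorRel (freeAlg M hM).X S
  | [] => 0
  | t :: w => splitFirst hM s₀ t.pos w t.elt

theorem splitFirst_balanced {p : ℕ} (i : Fin p → S) (π : Equiv.Perm (Fin p))
    (w : List (Letter (freeAlg M hM).X S)) (x : FreeMod M (Fin p)) :
    splitFirst hM s₀ (i ∘ π) w x = splitFirst hM s₀ i w (FreeMod.relabel π x) := by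
  have : splitFirst hM s₀ (i ∘ π) w = splitFirst hM s₀ i w ∘ₗ FreeMod.relabel π := by
    refine FreeMod.hom_ext fun v _ _ => ?_
    rw [LinearMap.comp_apply, FreeMod.relabel_mk, splitFirst_mk, splitFirst_mk, splitWord, splitWord,
      isDecomposition_relabel, Letter.relabel_relabel]
  exact LinearMap.congr_fun this x

theorem letterRespects_splitFirst {p : ℕ} (i : Fin p → S) (x : FreeMod M (Fin p))
    (l l' : List (Letter (freeAlg M hM).X S)) :
    LetterRespects fun t => splitFirst hM s₀ i (l ++ t :: l') x := by
  induction x using FreeMod.induction with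
  | zero => simpa only [map_zero] using letterRespects_zero
  | add x y hx hy => simpa only [map_add] using hx.add hy
  | smul c x hx => simpa only [map_smul] using hx.smul c
  | mk v _ hv =>
    simp only [splitFirst_mk, splitWord, if_pos hv]
    exact letterRespects_splitSum_param (letterRespects_splitTerm_word hM s₀ l l') _

/-- If the varying letter is the first one, the homotopy is linear and balanced in it by the
construction of `splitFirst`; otherwise the letter belongs to the tail, which the homotopy leaves in
place. -/
theorem respects_split : Respects (split hM s₀) where
  add l l' p i x y := by
    obtain - | ⟨t, l⟩ := l
    · exact map_add (splitFirst hM s₀ i l') x y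
    · exact (respects_of_letter (F := fun w => splitFirst hM s₀ t.pos w t.elt)
        (letterRespects_splitFirst hM s₀ t.pos t.elt)).add l l' p i x y
  smul l l' p i c x := by
    obtain - | ⟨t, l⟩ := l
    · exact map_smul (splitFirst hM s₀ i l') c x
    · exact (respects_of_letter (F := fun w => splitFirst hM s₀ t.pos w t.elt)
        (letterRespects_splitFirst hM s₀ t.pos t.elt)).smul l l' p i c x
  balanced l l' p i π x := by
    obtain - | ⟨t, l⟩ := l
    · exact splitFirst_balanced hM s₀ i π l' x
    · exact (respects_of_letter (F := fun w => splitFirst hM s₀ t.pos w t.elt)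
        (letterRespects_splitFirst hM s₀ t.pos t.elt)).balanced l l' p i π x

/-- The homotopy on a word `[m r | w]` such that `s₀` is a position of `m` only. -/
theorem split_wordLetter {p : ℕ} (i : Fin p → S) (m : Letter M (Fin p))
    (r : List (Letter M (Fin p))) (hd : IsDecomposition (m :: r))
    (hm : s₀ ∈ Set.range (m.relabel i).pos)
    (hr : ∀ t ∈ r.map (Letter.relabel i), s₀ ∉ Set.range t.pos)
    (w : List (Letter (freeAlg M hM).X S)) :
    split hM s₀ (wordLetter hM i (m :: r) :: w) =
      tq _ S (consL (M := (freeAlg M hM).X) ((m.relabel i).map (freeUnit M))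
        (mulCons (unitWord hM (r.map (Letter.relabel i))) w)) := by
  have h : split hM s₀ (wordLetter hM i (m :: r) :: w) = splitWord hM s₀ i w (m :: r) :=
    splitFirst_mk hM s₀ i w (m :: r)
  rw [h, splitWord, if_pos hd, List.map_cons, splitSum, splitTerm, if_pos hm, splitSum_eq_zero,
    add_zero]
  intro t v htv
  rw [splitTerm, if_neg (hr t (htv.mem_iff.1 (by simp)))]

end Free

end

end ShuffleAlg

namespace ShuffleAlg

noncomputable section

variable {k : Type u} [CommRing k]

/-! ### The homotopy on the bar construction of a free algebra -/

section

variable {M : SymSeq k} {S : Type}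

theorem Respects.comp {N N' : Type*} [AddCommGroup N] [Module k N] [AddCommGroup N'] [Module k N']
    {F : List (Letter M S) → N} (hF : Respects F) (f : N →ₗ[k] N') : Respects fun w => f (F w) where
  add l l' p i x y := by rw [hF.add, map_add]
  smul l l' p i c x := by rw [hF.smul, map_smul]
  balanced l l' p i π x := by rw [hF.balanced]

theorem positions_perm_ofFn {p : ℕ} {v : List (Letter M (Fin p))} (hv : IsDecomposition v)
    (i : Fin p → S) : (positions (v.map (Letter.relabel i))).Perm (List.ofFn i) := by
  rw [positions_relabel, List.ofFn_eq_map]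
  refine List.Perm.map i ((List.perm_ext_iff_of_nodup hv.1 (List.nodup_finRange p)).2 fun x => ?_)
  simp [hv.2 x]

end

section Free

variable {M : SymSeq k} (hM : Subsingleton (M 0)) {S : Type} (s₀ : S)

/-- Identities that are linear in a letter of `C̄(M)` may be checked on classes of words of
generators, one letter at a time. -/
theorem Respects.eq_zero_of_wordLetter {N : Type*} [AddCommGroup N] [Module k N]
    {F : List (Letter (freeAlg M hM).X S) → N} (hF : Respects F)
    (l l' : List (Letter (freeAlg M hM).X S)) {p : ℕ} (i : Fin p → S)
    (h : ∀ v, v ≠ [] → IsDecomposition v → F (l ++ wordLetter hM i v :: l') = 0)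
    (x : (freeAlg M hM).X p) : F (l ++ ⟨p, i, x⟩ :: l') = 0 := by
  let f : FreeMod M (Fin p) →ₗ[k] N :=
    { toFun := fun x => F (l ++ ⟨p, i, x⟩ :: l')
      map_add' := hF.add l l' p i
      map_smul' := hF.smul l l' p i }
  have : f = 0 := FreeMod.hom_ext fun v hv hv' => h v hv hv'
  exact LinearMap.congr_fun this x

/-- Linear extension of `split`. -/
def splitL : (List (Letter (freeAlg M hM).X S) →₀ k) →ₗ[k]
    (List (Letter (freeAlg M hM).X S) →₀ k) ⧸ tensorRel (freeAlg M hM).X S :=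
  Finsupp.linearCombination k (split hM s₀)

@[simp] theorem splitL_single (w : List (Letter (freeAlg M hM).X S)) :
    splitL hM s₀ (Finsupp.single w 1) = split hM s₀ w := by simp [splitL]

end Free

/-! ### Descent of the homotopy to the bar construction -/

namespace BarMod

/-- The projection from the tensor algebra to the bar construction in a given degree. -/
def ofTensor (M : SymSeq k) (s : ℕ) (S : Type) :
    (List (Letter M S) →₀ k) ⧸ tensorRel M S →ₗ[k] BarMod M s S :=
  (tensorRel M S).liftQ (q M s S) (by rw [Submodule.ker_mkQ]; exact tensorRel_le)

@[simp] theorem ofTensor_tq (M : SymSeq k) (s : ℕ) (S : Type) (z : List (Letter M S) →₀ k) :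
    ofTensor M s S (tq M S z) = q M s S z := rfl

variable {M : SymSeq k} (hM : Subsingleton (M 0)) {S : Type} (s₀ : S)

/-- Every word in the homotopy of `w` has one letter more than `w` and the same positions up to
order. So words that represent zero in degree `s` go to words that represent zero in degree `s + 1`.
-/
theorem ofTensor_split (s : ℕ) {w : List (Letter (freeAlg M hM).X S)}
    (hw : ¬ (w ≠ [] ∧ w.length = s ∧ IsDecomposition w)) :
    ofTensor (freeAlg M hM).X (s + 1) S (split hM s₀ w) = 0 := by
  obtain - | ⟨⟨p, i, x⟩, w⟩ := w
  · exact map_zero _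
  refine ((respects_split hM s₀).comp (ofTensor _ (s + 1) S)).eq_zero_of_wordLetter hM [] w i
    (fun v _ hv => ?_) x
  have h : split hM s₀ (wordLetter hM i v :: w) = splitWord hM s₀ i w v :=
    splitFirst_mk hM s₀ i w v
  rw [List.nil_append, h, splitWord, if_pos hv, ← LinearMap.mem_ker]
  refine splitSum_mem (LinearMap.ker (ofTensor (freeAlg M hM).X (s + 1) S)).toAddSubgroup
    fun m r hr => ?_
  change ofTensor _ _ _ _ = 0
  rw [splitTerm]
  split_ifs
  · rw [ofTensor_tq]
    rcases hc : prodWord (unitWord hM r) with - | c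
    · rw [mulCons, hc]
      simp
    · rw [mulCons_some hc, consL_single]
      refine q_single_eq_zero fun hw' => hw ⟨by simp, by simpa using hw'.2.1, ?_⟩
      refine (isDecomposition_congr ?_).1 hw'.2.2
      have h1 : positions (unitWord hM r) = positions r := positions_map _ r
      have h2 := (hr.flatMap_right fun t : Letter M S => List.ofFn t.pos).trans
        (positions_perm_ofFn hv i)
      rw [prodWord_positions hc] at h1
      simp only [positions, List.flatMap_cons] at h1 h2 ⊢
      rw [← List.append_assoc]
      refine List.Perm.append_right _ ?_
      rw [h1]
      exact h2
  · exact map_zero _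

/-- The homotopy on the bar construction of a free algebra. -/
def split (s : ℕ) : BarMod (freeAlg M hM).X s S →ₗ[k] BarMod (freeAlg M hM).X (s + 1) S :=
  lift (ofTensor _ (s + 1) S ∘ₗ splitL hM s₀)
    (respects_iff.2 (by
      simp only [LinearMap.comp_apply, splitL_single]
      exact (respects_split hM s₀).comp _))
    (fun w hw => by
      rw [LinearMap.comp_apply, splitL_single]
      exact ofTensor_split hM s₀ s hw)

@[simp] theorem split_q (s : ℕ) (z : List (Letter (freeAlg M hM).X S) →₀ k) :
    split hM s₀ s (q _ s S z) = ofTensor _ (s + 1) S (splitL hM s₀ z) := rfl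

/-! ### The homotopy formula and acyclicity for free algebras -/

theorem q_cons_congr {N : SymSeq k} {s : ℕ} {a b : Letter N S} (h : LetterEquiv a b)
    (w : List (Letter N S)) : q N s S (Finsupp.single (a :: w) 1) =
      q N s S (Finsupp.single (b :: w) 1) :=
  respects_q.congr h [] w

theorem q_cons_cons_congr {N : SymSeq k} {s : ℕ} (t : Letter N S) {a b : Letter N S}
    (h : LetterEquiv a b) (w : List (Letter N S)) : q N s S (Finsupp.single (t :: a :: w) 1) =
      q N s S (Finsupp.single (t :: b :: w) 1) :=
  respects_q.congr h [t] w

/-- The homotopy formula for a word `[m r | v | w]`, where `s₀` is a position of `m` only. -/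
theorem d_split_add_split_d_wordLetter (s : ℕ) {p p' : ℕ} (i : Fin p → S) (j : Fin p' → S)
    (m : Letter M (Fin p)) (r : List (Letter M (Fin p))) (hd : IsDecomposition (m :: r))
    (v : List (Letter M (Fin p'))) (hv : v ≠ []) (hv' : IsDecomposition v)
    (hm : s₀ ∈ Set.range (m.relabel i).pos)
    (hr : ∀ t ∈ r.map (Letter.relabel i), s₀ ∉ Set.range t.pos)
    (hj : ∀ t ∈ v.map (Letter.relabel j), s₀ ∉ Set.range t.pos)
    (w : List (Letter (freeAlg M hM).X S)) :
    d (freeAlg M hM) (s + 2) S (split hM s₀ (s + 2) (q _ (s + 2) S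
        (Finsupp.single (wordLetter hM i (m :: r) :: wordLetter hM j v :: w) 1))) +
      split hM s₀ (s + 1) (d (freeAlg M hM) (s + 1) S (q _ (s + 2) S
        (Finsupp.single (wordLetter hM i (m :: r) :: wordLetter hM j v :: w) 1))) =
      q _ (s + 2) S
        (Finsupp.single (wordLetter hM i (m :: r) :: wordLetter hM j v :: w) 1) := by
  set a := wordLetter hM i (m :: r) with ha
  set c := wordLetter hM j v with hc
  set η : Letter (freeAlg M hM).X S := (m.relabel i).map (freeUnit M) with hη
  obtain ⟨c', hc'⟩ := exists_prodWord (w := unitWord hM (v.map (Letter.relabel j))) (by simpa using hv)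
  have hcc : LetterEquiv c' c := prodWord_unitWord_equiv hM j hv' hc'
  have hsplit (w) : ShuffleAlg.split hM s₀ (a :: w) =
      tq _ S (consL η (mulCons (unitWord hM (r.map (Letter.relabel i))) w)) :=
    split_wordLetter hM s₀ i m r hd hm hr w
  have hrel : (m.relabel (finSumFinEquiv ∘ Sum.inl)).relabel (Fin.append i j) = m.relabel i :=
    (List.cons.inj (relabel_append i j [m] [])).1
  have hsplit' : ShuffleAlg.split hM s₀ (mulLetter a c :: w) = tq _ S (consL η
      (mulCons (unitWord hM (r.map (Letter.relabel i)) ++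
        unitWord hM (v.map (Letter.relabel j))) w)) := by
    rw [ha, hc, mulLetter_wordLetter hM i j (List.cons_ne_nil m r) hv, List.map_cons,
      List.cons_append, split_wordLetter, relabel_append, hrel]
    · rw [unitWord, List.map_append]
    · exact (FreeMod.isDecomposition_append finSumFinEquiv (m :: r) v).2 ⟨hd, hv'⟩
    · rw [hrel]
      exact hm
    · rw [relabel_append]
      intro t ht
      rcases List.mem_append.1 ht with ht | ht
      exacts [hr t ht, hj t ht]
  rw [d_q, split_q, split_q, splitL_single, hsplit, ofTensor_tq, d_q, bdryL_single, bdry, mulFirst,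
    map_sub, map_sub, splitL_single, hsplit', ofTensor_tq]
  rcases hb : prodWord (unitWord hM (r.map (Letter.relabel i))) with - | b
  -- If `r` is empty, then `a` is a generator, and the homotopy kills every word that starts with
  -- `a`. Of `dh + hd` only the homotopy of `[ac|w]` remains, which is `[η|c|w]`.
  · obtain rfl : r = [] := by simpa using prodWord_eq_none hb
    have h1 : splitL hM s₀ (consL a (bdry (c :: w))) = 0 := by
      generalize bdry (c :: w) = z
      have : splitL hM s₀ ∘ₗ consL a = 0 := word_hom_ext fun w => by
        rw [LinearMap.comp_apply, consL_single, splitL_single, hsplit]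
        simp [mulCons_nil]
      exact LinearMap.congr_fun this z
    have h2 : LetterEquiv η a := prodWord_unitWord_equiv hM i hd rfl
    rw [h1, mulCons_some (v := unitWord hM _ ++ _) hc']
    simp only [List.map_nil, mulCons_nil, map_zero, zero_add, sub_zero, consL_single]
    rw [q_cons_cons_congr η hcc, q_cons_congr h2]
  -- Otherwise `a = ηb`, and the homotopy sends `[a|c|w]` to `[η|b|c|w]` and `[ac|w]` to `[η|bc|w]`.
  -- In `dh + hd` the terms `[η|bc|w]` and `[η|b|d[c|w]]` each occur with both signs, and `[ηb|c|w]`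
  -- remains.
  · have h1 (z) : splitL hM s₀ (consL a z) = tq _ S (consL η (consL b z)) := by
      have : splitL hM s₀ ∘ₗ consL a = tq _ S ∘ₗ consL η ∘ₗ consL b := word_hom_ext fun w => by
        rw [LinearMap.comp_apply, consL_single, splitL_single, hsplit, mulCons_some hb]
        simp
      exact LinearMap.congr_fun this z
    obtain ⟨e, he, he'⟩ := prodWord_append hb hc'
    have h2 : LetterEquiv (mulLetter η b) a :=
      prodWord_unitWord_equiv hM i hd (prodWord_cons_some hb)
    have h3 : LetterEquiv e (mulLetter b c) := he'.trans (mulLetter_congr (.refl _) hcc)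
    rw [h1, ofTensor_tq, mulCons_some hb, mulCons_some he, bdryL_consL, mulFirstL_single, mulFirst,
      map_sub, bdryL_single, bdry, map_sub, map_sub, q_cons_congr h2, mulFirst, consL_single,
      consL_single, q_cons_cons_congr η h3]
    abel

/-- By linearity the first two letters may be taken to be classes of words of generators. The degree
is at least two because the face that multiplies the first letter by the second one is essential: on
a single generator the formula fails. -/
theorem d_split_add_split_d (s : ℕ) {x : BarMod (freeAlg M hM).X (s + 2) S}
    (hx : x ∈ marked (s + 2) s₀) :
    d (freeAlg M hM) (s + 2) S (split hM s₀ (s + 2) x) +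
      split hM s₀ (s + 1) (d (freeAlg M hM) (s + 1) S x) = x := by
  let f : BarMod (freeAlg M hM).X (s + 2) S →ₗ[k] BarMod (freeAlg M hM).X (s + 2) S :=
    d (freeAlg M hM) (s + 2) S ∘ₗ split hM s₀ (s + 2) +
      split hM s₀ (s + 1) ∘ₗ d (freeAlg M hM) (s + 1) S - LinearMap.id
  have hf : Respects fun w => f (q _ _ _ (Finsupp.single w 1)) := respects_q.comp f
  suffices h : marked (s + 2) s₀ ≤ LinearMap.ker f from sub_eq_zero.1 (h hx)
  refine Submodule.span_le.2 ?_
  rintro _ ⟨⟨p, i, x⟩, w, hi, rfl⟩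
  rw [SetLike.mem_coe, LinearMap.mem_ker]
  by_cases hw : (⟨p, i, x⟩ :: w : List (Letter (freeAlg M hM).X S)) ≠ [] ∧
    (⟨p, i, x⟩ :: w : List (Letter (freeAlg M hM).X S)).length = s + 2 ∧
      IsDecomposition (M := (freeAlg M hM).X) (⟨p, i, x⟩ :: w)
  swap
  · rw [q_single_eq_zero hw, map_zero]
  obtain ⟨-, hl, hw⟩ := hw
  obtain - | ⟨⟨p', j, y⟩, w⟩ := w
  · simp at hl
  have hj : s₀ ∉ Set.range j := unmarked_of_isDecomposition hw hi ⟨p', j, y⟩ (by simp)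
  have hinj : Function.Injective i := by
    have := hw.1
    simp only [positions, List.flatMap_cons, List.nodup_append, List.nodup_ofFn] at this
    exact this.1
  refine hf.eq_zero_of_wordLetter hM [] _ i (fun v hv hv' => ?_) x
  refine hf.eq_zero_of_wordLetter hM [_] _ j (fun v₂ hv₂ hv₂' => ?_) y
  obtain ⟨x₀, rfl⟩ := hi
  obtain ⟨m, hmv, hm⟩ := List.mem_flatMap.1 (hv'.2 x₀)
  rw [List.mem_ofFn] at hm
  obtain ⟨v, v', rfl⟩ := List.append_of_mem hmv
  -- Words of generators are unordered in the free algebra, so the generator that contains `s₀` can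
  -- be moved to the front.
  have hp : (v ++ m :: v').Perm (m :: (v ++ v')) := List.perm_middle
  have hw' : wordLetter hM i (v ++ m :: v') = wordLetter hM i (m :: (v ++ v')) :=
    congrArg (fun z => (⟨p, i, z⟩ : Letter (freeAlg M hM).X S)) (FreeMod.mk_perm hp)
  rw [hw']
  refine sub_eq_zero.2 (d_split_add_split_d_wordLetter hM (i x₀) s i j m (v ++ v') (hv'.perm hp) v₂
    hv₂ hv₂' ?_ ?_ ?_ w)
  · obtain ⟨y, rfl⟩ := hm
    exact ⟨y, rfl⟩
  · intro t ht
    obtain ⟨t, ht', rfl⟩ := List.mem_map.1 ht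
    rintro ⟨y, hy⟩
    have hy' : i (t.pos y) = i x₀ := hy
    exact unmarked_of_isDecomposition (hv'.perm hp) hm t ht' ⟨_, hinj hy'⟩
  · intro t ht
    obtain ⟨t, ht, rfl⟩ := List.mem_map.1 ht
    rintro ⟨y, hy⟩
    exact hj ⟨t.pos y, hy⟩

/-- Without positions every letter has level zero, where the algebra vanishes. Level zero has to be
treated apart, because there is no `s₀` to choose. -/
theorem subsingleton_fin_zero (A : ReducedCommShuffleAlg k) (s : ℕ) (x : BarMod A.X s (Fin 0)) :
    x = 0 := by
  have : (LinearMap.id : BarMod A.X s (Fin 0) →ₗ[k] _) = 0 := hom_ext fun w => by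
    obtain - | ⟨⟨p, i, x⟩, w⟩ := w
    · exact q_single_eq_zero fun h => h.1 rfl
    · obtain - | p := p
      · have h := respects_q (s := s).smul [] w 0 i (0 : k) x
        have := A.reduced
        rw [zero_smul, zero_smul, Subsingleton.elim (0 : A.X 0) x] at h
        exact h
      · exact (i 0).elim0
  exact LinearMap.congr_fun this x

/-- The complex of indecomposables of the bar construction of a free algebra is acyclic in
degrees greater than one. -/
theorem exists_d_sub_mem_barDecomposables (s ℓ : ℕ) (x : BarMod (freeAlg M hM).X (s + 2) (Fin ℓ))
    (hx : d (freeAlg M hM) (s + 1) (Fin ℓ) x ∈ barDecomposables (freeAlg M hM) (s + 1) ℓ) :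
    ∃ y, d (freeAlg M hM) (s + 2) (Fin ℓ) y - x ∈ barDecomposables (freeAlg M hM) (s + 2) ℓ := by
  obtain - | ℓ := ℓ
  · exact ⟨0, by rw [subsingleton_fin_zero _ _ x, map_zero, sub_zero]; exact zero_mem _⟩
  obtain ⟨y, hy, b, hb, rfl⟩ := Submodule.mem_sup.1
    ((marked_sup_barDecomposables (freeAlg M hM) (s + 2) (0 : Fin (ℓ + 1))).ge
      (Submodule.mem_top (x := x)))
  have hb' : d (freeAlg M hM) (s + 1) (Fin (ℓ + 1)) b ∈
    barDecomposables (freeAlg M hM) (s + 1) (ℓ + 1) := barDecomposables_d _ _ _ hb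
  rw [map_add] at hx
  have h1 := (Submodule.add_mem_iff_left _ hb').1 hx
  -- The boundary of `y` is marked and decomposable. The operator `dynkin` fixes it and kills it, so
  -- it is zero.
  have h2 := dynkin_of_mem_marked _ (d_mem_marked _ hy)
  rw [dynkin_of_mem_barDecomposables _ h1] at h2
  have h3 := d_split_add_split_d hM _ s hy
  rw [← h2, map_zero, add_zero] at h3
  -- As `y` is a cycle, it is the boundary of its image under the homotopy, and it differs from the
  -- given element by the decomposable `b`.
  refine ⟨split hM (0 : Fin (ℓ + 1)) (s + 2) y, ?_⟩
  rw [h3, sub_add_cancel_left]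
  exact Submodule.neg_mem _ hb

end BarMod

end

end ShuffleAlg

namespace ShuffleAlg

noncomputable section

/-! ### Standard complexes with an extra degeneracy -/

section Standard

open Limits HomologicalComplex

variable {C : Type*} [Category C] (G : C ⥤ C) (ε : G ⟶ 𝟭 C) {D : Type*} [Category D]

theorem standardComplex_d [Preadditive D] (Q : C ⥤ D) (A : C) (n : ℕ) :
    (standardComplex G ε Q A).d (n + 1) n = standardD G ε Q A (n + 1) :=
  ChainComplex.of_d (fun n => Q.obj (standardObj G A (n + 1)))
    (fun n => standardD G ε Q A (n + 1)) n

theorem standardD_naturality [Preadditive D] {Q Q' : C ⥤ D} (τ : Q ⟶ Q') (A : C) (n : ℕ) :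
    τ.app (standardObj G A (n + 1)) ≫ standardD G ε Q' A n =
      standardD G ε Q A n ≫ τ.app (standardObj G A n) := by
  simp only [standardD, Preadditive.comp_sum, Preadditive.sum_comp, Preadditive.comp_zsmul,
    Preadditive.zsmul_comp, τ.naturality]

/-- A natural transformation induces a map of standard complexes. -/
def standardMap [Preadditive D] {Q Q' : C ⥤ D} (τ : Q ⟶ Q') (A : C) :
    standardComplex G ε Q A ⟶ standardComplex G ε Q' A :=
  ChainComplex.ofHom (fun n => τ.app (standardObj G A (n + 1))) fun n => by
    rw [standardComplex_d, standardComplex_d]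
    exact standardD_naturality G ε τ A (n + 1)

theorem exact_of_comp_eq_id_sub [Abelian D] (S : ShortComplex D) (r : S.X₂ ⟶ S.X₁)
    (r' : S.X₃ ⟶ S.X₂) (h : r ≫ S.f = 𝟙 _ - S.g ≫ r') : S.Exact := by
  rw [ShortComplex.exact_iff_exact_up_to_refinements]
  intro B x hx
  refine ⟨B, 𝟙 B, inferInstance, x ≫ r, ?_⟩
  rw [Category.assoc, h, Preadditive.comp_sub, reassoc_of% hx, zero_comp, sub_zero,
    Category.id_comp, Category.comp_id]

variable [Abelian D] {Q : C ⥤ D} {A : C}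
  (h : ∀ n, Q.obj (standardObj G A n) ⟶ Q.obj (standardObj G A (n + 1)))

variable (Q A) in
/-- The augmentation of the standard complex. -/
def standardAug : (standardComplex G ε Q A).X 0 ⟶ Q.obj A := Q.map (ε.app A)

variable (Q A) in
theorem standardD_zero : standardD G ε Q A 0 = standardAug G ε Q A := by
  rw [standardD, Fin.sum_univ_one]
  simp
  rfl

variable (Q A) in
theorem standardComplex_d_comp_aug :
    (standardComplex G ε Q A).d 1 0 ≫ standardAug G ε Q A = 0 := by
  rw [standardComplex_d, ← standardD_zero]
  exact standardD_comp G ε Q A 0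

/-- An extra degeneracy of the standard simplicial object. -/
structure ExtraDegeneracy : Prop where
  zero (n : ℕ) : h n ≫ Q.map (standardFace G ε A n 0) = 𝟙 _
  succ (n : ℕ) (j : Fin (n + 1)) : h (n + 1) ≫ Q.map (standardFace G ε A (n + 1) j.succ) =
    Q.map (standardFace G ε A n j) ≫ h n

variable {G ε h}

/-- The zeroth face contributes the identity. The remaining faces pass through `h` with their index
lowered by one, which changes the sign. For `n = 0`, `standardD` on the right is the augmentation.
-/
theorem ExtraDegeneracy.comp_d (H : ExtraDegeneracy G ε h) (n : ℕ) :
    h (n + 1) ≫ standardD G ε Q A (n + 1) = 𝟙 _ - standardD G ε Q A n ≫ h n := by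
  rw [standardD, Fin.sum_univ_succ, Preadditive.comp_add, Fin.val_zero, pow_zero, one_smul, H.zero,
    sub_eq_add_neg, standardD, Preadditive.sum_comp, Preadditive.comp_sum, ← Finset.sum_neg_distrib]
  congr 1
  refine Finset.sum_congr rfl fun j _ => ?_
  rw [Preadditive.comp_zsmul, H.succ, Fin.val_succ, pow_succ, Preadditive.zsmul_comp, mul_neg_one,
    neg_smul]

theorem ExtraDegeneracy.comp_aug (H : ExtraDegeneracy G ε h) :
    h 0 ≫ standardAug G ε Q A = 𝟙 _ := H.zero 0

theorem ExtraDegeneracy.isZero_homology (H : ExtraDegeneracy G ε h) (n : ℕ) :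
    IsZero ((standardComplex G ε Q A).homology (n + 1)) := by
  rw [← exactAt_iff_isZero_homology, exactAt_iff' _ (n + 2) (n + 1) n (by simp) (by simp)]
  refine exact_of_comp_eq_id_sub _ (h (n + 2)) (h (n + 1)) ?_
  have := H.comp_d (n + 1)
  rwa [← standardComplex_d, ← standardComplex_d] at this

/-- The contraction extends to the augmented complex: it gives exactness in simplicial degree zero,
and `h 0` splits the augmentation. -/
theorem ExtraDegeneracy.isIso_descOpcycles (H : ExtraDegeneracy G ε h) :
    IsIso ((standardComplex G ε Q A).descOpcycles (standardAug G ε Q A) 1 (by simp)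
      (standardComplex_d_comp_aug G ε Q A)) := by
  rw [ChainComplex.isIso_descOpcycles_iff]
  constructor
  · refine exact_of_comp_eq_id_sub _ (h 1) (h 0) ?_
    have := H.comp_d 0
    rwa [← standardComplex_d, standardD_zero] at this
  · exact (SplitEpi.mk (h 0) H.comp_aug).epi

/-- The homology in degree zero of a standard complex with an extra degeneracy. -/
def ExtraDegeneracy.homologyZeroIso (H : ExtraDegeneracy G ε h) :
    (standardComplex G ε Q A).homology 0 ≅ Q.obj A :=
  have := H.isIso_descOpcycles
  (standardComplex G ε Q A).isoHomologyι₀ ≪≫ asIso ((standardComplex G ε Q A).descOpcycles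
    (standardAug G ε Q A) 1 (ChainComplex.prev ℕ 0) (standardComplex_d_comp_aug G ε Q A))

/-- This identifies the maps induced on `H₀` by the bar differential with the bar differential of
`A` itself. -/
theorem ExtraDegeneracy.homologyZeroIso_naturality {Q' : C ⥤ D}
    {h' : ∀ n, Q'.obj (standardObj G A n) ⟶ Q'.obj (standardObj G A (n + 1))}
    (H : ExtraDegeneracy G ε h) (H' : ExtraDegeneracy G ε h') (τ : Q ⟶ Q') :
    homologyMap (standardMap G ε τ A) 0 ≫ H'.homologyZeroIso.hom =
      H.homologyZeroIso.hom ≫ τ.app A := by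
  change homologyMap (standardMap G ε τ A) 0 ≫ homologyι _ 0 ≫ descOpcycles _
      (standardAug G ε Q' A) 1 (ChainComplex.prev ℕ 0) (standardComplex_d_comp_aug G ε Q' A) =
    (homologyι _ 0 ≫ descOpcycles _
      (standardAug G ε Q A) 1 (ChainComplex.prev ℕ 0) (standardComplex_d_comp_aug G ε Q A)) ≫ _
  rw [homologyι_naturality_assoc, Category.assoc]
  congr 1
  rw [← cancel_epi (pOpcycles _ 0), p_opcyclesMap_assoc, p_descOpcycles, p_descOpcycles_assoc]
  exact (τ.naturality (ε.app A)).symm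

end Standard

end

end ShuffleAlg

namespace ShuffleAlg

noncomputable section

variable {k : Type u} [CommRing k]

/-! ### Functoriality of the bar construction -/

namespace BarMod

section

variable {M M' M'' : SymSeq k} {s : ℕ} {S T : Type}

/-- Application of a morphism of symmetric sequences to all letters of words, extended linearly. -/
def mapL (f : ∀ ℓ, M ℓ ⟶ M' ℓ) : (List (Letter M S) →₀ k) →ₗ[k] (List (Letter M' S) →₀ k) :=
  Finsupp.linearCombination k fun w => Finsupp.single (w.map (Letter.map f)) 1

@[simp] theorem mapL_single (f : ∀ ℓ, M ℓ ⟶ M' ℓ) (w : List (Letter M S)) :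
    mapL f (Finsupp.single w (1 : k)) = Finsupp.single (w.map (Letter.map f)) 1 := by
  simp [mapL]

variable (s S) in
/-- Functoriality in the symmetric sequence. -/
def map (f : ∀ ℓ, M ℓ ⟶ M' ℓ) : BarMod M s S →ₗ[k] BarMod M' s S :=
  lift (q M' s S ∘ₗ mapL f)
    (respects_iff.2 (by simpa using respects_q.map f))
    (fun w h => by
      rw [LinearMap.comp_apply, mapL_single]
      exact q_single_eq_zero
        (by rwa [isDecomposition_map, Ne, List.map_eq_nil_iff, List.length_map]))

@[simp] theorem map_q (f : ∀ ℓ, M ℓ ⟶ M' ℓ) (z : List (Letter M S) →₀ k) :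
    map s S f (q M s S z) = q M' s S (mapL f z) := rfl

theorem map_relabel (f : ∀ ℓ, M ℓ ⟶ M' ℓ) (g : S ≃ T) :
    map s T f ∘ₗ relabel g = relabel g ∘ₗ map s S f := by
  refine hom_ext fun w => ?_
  simp only [LinearMap.comp_apply, relabel_q, relabelL_single, map_q, mapL_single, List.map_map]
  rfl

theorem map_id : map s S (fun ℓ => 𝟙 (M ℓ)) = LinearMap.id := by
  refine hom_ext fun w => ?_
  rw [map_q, mapL_single]
  exact congrArg (fun v => q M s S (Finsupp.single v 1)) (List.map_id w)

theorem map_comp (f : ∀ ℓ, M ℓ ⟶ M' ℓ) (g : ∀ ℓ, M' ℓ ⟶ M'' ℓ) :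
    map s S (fun ℓ => f ℓ ≫ g ℓ) = map s S g ∘ₗ map s S f := by
  refine hom_ext fun w => ?_
  simp only [LinearMap.comp_apply, map_q, mapL_single, List.map_map]
  rfl

theorem mapL_consL (f : ∀ ℓ, M ℓ ⟶ M' ℓ) (t : Letter M S) (z : List (Letter M S) →₀ k) :
    mapL f (consL t z) = consL (t.map f) (mapL f z) := by
  have : mapL f ∘ₗ consL t = consL (t.map f) ∘ₗ mapL f := word_hom_ext fun w => by simp
  exact LinearMap.congr_fun this z

/-- Shuffling only reorders letters, so `f` need not be multiplicative, unlike in `mapL_bdry`. This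
is what lets the unit of the free algebra act on the bar indecomposables. -/
theorem mapL_shuffle (f : ∀ ℓ, M ℓ ⟶ M' ℓ) (u v : List (Letter M S)) :
    mapL f (shuffle u v) = shuffle (u.map (Letter.map f)) (v.map (Letter.map f)) := by
  induction u, v using shuffle.induct with
  | case1 v => simp [shuffle]
  | case2 a u => simp [shuffle]
  | case3 a u b v ih1 ih2 =>
    rw [shuffle, map_add, map_smul, mapL_consL, mapL_consL, ih1, ih2]
    simp only [List.map_cons]
    rw [shuffle, List.length_map]

end

/-! ### Functoriality of the shuffle products and of the bar differential -/

variable {A B : ReducedCommShuffleAlg k}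

theorem barDecomposables_map (f : ∀ ℓ, A.X ℓ ⟶ B.X ℓ) (s ℓ : ℕ) :
    barDecomposables A s ℓ ≤ (barDecomposables B s ℓ).comap (map s (Fin ℓ) f) := by
  refine Submodule.span_le.2 ?_
  rintro _ ⟨u, v, hu, hv, rfl⟩
  refine Submodule.subset_span ⟨u.map (Letter.map f), v.map (Letter.map f),
    by simpa using hu, by simpa using hv, ?_⟩
  rw [map_q, mapL_shuffle]

theorem mapL_bdry {S : Type} (f : A ⟶ B) (w : List (Letter A.X S)) :
    mapL f.f (bdry w) = bdry (w.map (Letter.map f.f)) := by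
  induction w with
  | nil => simp [bdry]
  | cons a v ih =>
    rw [bdry, map_sub, mapL_consL, ih, List.map_cons, bdry]
    congr 1
    obtain - | ⟨b, v⟩ := v
    · simp [mulFirst]
    · simp [mulFirst, map_mulLetter]

theorem map_d (f : A ⟶ B) (s : ℕ) (S : Type) :
    map s S f.f ∘ₗ d A s S = d B s S ∘ₗ map (s + 1) S f.f := by
  refine hom_ext fun w => ?_
  simp only [LinearMap.comp_apply, map_q, mapL_single, d_q, bdryL_single, mapL_bdry]

end BarMod

/-! ### The functors of indecomposables of the bar construction -/

/-- The indecomposables of the bar construction of `A`, in degree `s` and level `ℓ`. -/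
abbrev barIndecObj (A : ReducedCommShuffleAlg k) (s ℓ : ℕ) : Rep.{u} k (Equiv.Perm (Fin ℓ)) :=
  Rep.of ((barRep A.X s ℓ).quotient (barDecomposables A s ℓ) (barDecomposables_act A s ℓ))

/-- The map on indecomposables which is induced by a map of symmetric sequences. -/
def barIndecMap {A B : ReducedCommShuffleAlg k} (f : ∀ ℓ, A.X ℓ ⟶ B.X ℓ) (s ℓ : ℕ) :
    barIndecObj A s ℓ ⟶ barIndecObj B s ℓ := Rep.ofHom
  { toLinearMap := Submodule.mapQ _ _ (BarMod.map s (Fin ℓ) f) (BarMod.barDecomposables_map f s ℓ)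
    isIntertwining' := fun π => by
      refine Submodule.linearMap_qext _ (LinearMap.ext fun x => ?_)
      exact congrArg (Submodule.mkQ _) (LinearMap.congr_fun (BarMod.map_relabel f π) x) }

theorem barIndecMap_id (A : ReducedCommShuffleAlg k) (s ℓ : ℕ) :
    barIndecMap (fun ℓ => 𝟙 (A.X ℓ)) s ℓ = 𝟙 (barIndecObj A s ℓ) := by
  ext : 2
  refine Submodule.linearMap_qext _ (LinearMap.ext fun x => ?_)
  exact congrArg (Submodule.mkQ _) (LinearMap.congr_fun BarMod.map_id x)

theorem barIndecMap_comp {A B C : ReducedCommShuffleAlg k} (f : ∀ ℓ, A.X ℓ ⟶ B.X ℓ)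
    (g : ∀ ℓ, B.X ℓ ⟶ C.X ℓ) (s ℓ : ℕ) :
    barIndecMap (fun ℓ => f ℓ ≫ g ℓ) s ℓ = barIndecMap f s ℓ ≫ barIndecMap g s ℓ := by
  ext : 2
  refine Submodule.linearMap_qext _ (LinearMap.ext fun x => ?_)
  exact congrArg (Submodule.mkQ _) (LinearMap.congr_fun (BarMod.map_comp f g) x)

variable (k) in
/-- The indecomposables of the bar construction, as a functor of the algebra. -/
def barIndec (s ℓ : ℕ) : ReducedCommShuffleAlg k ⥤ Rep.{u} k (Equiv.Perm (Fin ℓ)) where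
  obj A := barIndecObj A s ℓ
  map g := barIndecMap g.f s ℓ
  map_id A := barIndecMap_id A s ℓ
  map_comp g h := barIndecMap_comp g.f h.f s ℓ

variable (k) in
/-- The differential of the bar construction on indecomposables. -/
def barIndecD (s ℓ : ℕ) : barIndec k (s + 1) ℓ ⟶ barIndec k s ℓ where
  app A := Rep.ofHom
    { toLinearMap := Submodule.mapQ _ _ (BarMod.d A s (Fin ℓ)) (barDecomposables_d A s ℓ)
      isIntertwining' := fun π => by
        refine Submodule.linearMap_qext _ (LinearMap.ext fun x => ?_)
        exact congrArg (Submodule.mkQ _) (BarMod.d_relabel π x) }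
  naturality A B g := by
    ext : 2
    refine Submodule.linearMap_qext _ (LinearMap.ext fun x => ?_)
    exact congrArg (Submodule.mkQ _) (LinearMap.congr_fun (BarMod.map_d g s (Fin ℓ)) x).symm

theorem barIndecD_comp (s ℓ : ℕ) : barIndecD k (s + 1) ℓ ≫ barIndecD k s ℓ = 0 := by
  ext A : 4
  refine Submodule.linearMap_qext _ (LinearMap.ext fun x => ?_)
  exact (congrArg (barDecomposables A s ℓ).mkQ
    (LinearMap.congr_fun BarMod.d_d x)).trans (map_zero (barDecomposables A s ℓ).mkQ)

theorem harrisonComplex_d (A : ReducedCommShuffleAlg k) (s ℓ : ℕ) :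
    (harrisonComplex A ℓ).d (s + 1) s = (barIndecD k s ℓ).app A :=
  ChainComplex.of_d (fun s => barIndecObj A s ℓ) (fun s => (barIndecD k s ℓ).app A) s

theorem isZero_barIndecObj_zero (A : ReducedCommShuffleAlg k) (ℓ : ℕ) :
    Limits.IsZero (barIndecObj A 0 ℓ) := by
  rw [Limits.IsZero.iff_id_eq_zero]
  ext : 2
  refine Submodule.linearMap_qext _ (BarMod.hom_ext fun w => ?_)
  have : BarMod.q A.X 0 (Fin ℓ) (Finsupp.single w 1) = 0 :=
    BarMod.q_single_eq_zero fun h => h.1 (List.length_eq_zero_iff.1 h.2.1)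
  rw [this, map_zero, map_zero]

/-! ### The augmentation onto the indecomposables of the algebra -/

open Classical in
/-- A word with one letter represents an element of the algebra. -/
def wordToElt {A : ReducedCommShuffleAlg k} {ℓ : ℕ} (w : List (Letter A.X (Fin ℓ))) : A.X ℓ :=
  if w.length = 1 then evalWord w else 0

namespace BarMod

variable (A : ReducedCommShuffleAlg k) (ℓ : ℕ)

/-- Words with one letter represent elements of the algebra. -/
def toElt : BarMod A.X 1 (Fin ℓ) →ₗ[k] A.X ℓ :=
  lift (Finsupp.linearCombination k wordToElt)
    (Respects.le_ker
      { add := fun l l' p i x y => by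
          simp only [wordToElt, (respects_evalWord A ℓ).add, List.length_append, List.length_cons]
          split_ifs <;> simp
        smul := fun l l' p i c x => by
          simp only [wordToElt, (respects_evalWord A ℓ).smul, List.length_append, List.length_cons]
          split_ifs <;> simp
        balanced := fun l l' p i π x => by
          simp only [wordToElt, (respects_evalWord A ℓ).balanced, List.length_append,
            List.length_cons] })
    (fun w h => by
      rw [Finsupp.linearCombination_single, one_smul, wordToElt]
      split_ifs with hw
      · have h0 : w ≠ [] := by rintro rfl; simp at hw
        obtain ⟨t, ht⟩ := exists_prodWord h0
        rw [evalWord_some ht, Letter.toElt, dif_neg]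
        exact fun hb => h ⟨h0, hw, (prodWord_bijective ht).1 hb⟩
      · rfl)

variable {A ℓ}

theorem toElt_q (t : Letter A.X (Fin ℓ)) :
    toElt A ℓ (q A.X 1 (Fin ℓ) (Finsupp.single [t] 1)) = t.toElt := by
  rw [toElt, lift_q, Finsupp.linearCombination_single, one_smul]
  rfl

variable (A ℓ) in
/-- Elements of the algebra are represented by words with one letter. -/
def ofElt : A.X ℓ →ₗ[k] BarMod A.X 1 (Fin ℓ) where
  toFun a := q A.X 1 (Fin ℓ) (Finsupp.single [⟨ℓ, id, a⟩] 1)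
  map_add' x y := respects_q.add [] [] ℓ id x y
  map_smul' c x := respects_q.smul [] [] ℓ id c x

theorem toElt_ofElt (a : A.X ℓ) : toElt A ℓ (ofElt A ℓ a) = a := by
  refine (toElt_q _).trans ?_
  rw [Letter.toElt_of_equiv _ (Equiv.refl (Fin ℓ)) rfl]
  exact transport_refl _ _

/-- A letter with bijective positions is equivalent to one whose positions are the identity. -/
theorem ofElt_toElt (x : BarMod A.X 1 (Fin ℓ)) : ofElt A ℓ (toElt A ℓ x) = x := by
  have : ofElt A ℓ ∘ₗ toElt A ℓ = LinearMap.id := hom_ext fun w => by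
    rw [LinearMap.comp_apply, LinearMap.id_apply]
    by_cases hw : w ≠ [] ∧ w.length = 1 ∧ IsDecomposition w
    · obtain ⟨t, rfl⟩ := List.length_eq_one_iff.1 hw.2.1
      have hb : Function.Bijective t.pos := (prodWord_bijective (w := [t]) rfl).2 hw.2.2
      rw [toElt_q, Letter.toElt_of_equiv t (Equiv.ofBijective _ hb) rfl]
      refine (respects_q.congr (s := t) ?_ [] []).symm
      exact ⟨Equiv.ofBijective _ hb, rfl, rfl⟩
    · rw [q_single_eq_zero hw, map_zero, map_zero]
  exact LinearMap.congr_fun this x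

/-- A shuffle product of two nonempty words has at least two letters. -/
theorem barDecomposables_one : barDecomposables A 1 ℓ = ⊥ := by
  refine Submodule.span_eq_bot.2 ?_
  rintro _ ⟨u, v, hu, hv, rfl⟩
  refine q_eq_zero_of_mem_permSpan 1 (fun h => ?_) (shuffle_mem_permSpan u v)
  have h1 := h.2.1
  rw [List.length_append] at h1
  have := List.length_pos_iff.2 hu
  have := List.length_pos_iff.2 hv
  lia

theorem toElt_d_mem (x : BarMod A.X 2 (Fin ℓ)) :
    toElt A ℓ (d A 1 (Fin ℓ) x) ∈ decomposables A ℓ := by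
  suffices h : (decomposables A ℓ).mkQ ∘ₗ toElt A ℓ ∘ₗ d A 1 (Fin ℓ) = 0 by
    have := LinearMap.congr_fun h x
    rwa [LinearMap.comp_apply, LinearMap.zero_apply, Submodule.mkQ_apply,
      Submodule.Quotient.mk_eq_zero] at this
  refine hom_ext fun w => ?_
  by_cases hw : w ≠ [] ∧ w.length = 2 ∧ IsDecomposition w
  · obtain ⟨a, b, rfl⟩ := List.length_eq_two.1 hw.2.1
    have hb : Function.Bijective (mulLetter a b).pos :=
      (prodWord_bijective (w := [a, b]) rfl).2 hw.2.2
    have h1 : bdry [a, b] = Finsupp.single [mulLetter a b] (1 : k) := by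
      simp [bdry, mulFirst]
    rw [LinearMap.comp_apply, LinearMap.comp_apply, d_q, bdryL_single, h1, toElt_q,
      Letter.toElt_of_equiv _ (Equiv.ofBijective _ hb) rfl, LinearMap.zero_apply,
      Submodule.mkQ_apply, Submodule.Quotient.mk_eq_zero]
    refine Submodule.subset_span ⟨_, _, finSumFinEquiv.trans (Equiv.ofBijective _ hb),
      a.elt, b.elt, ?_⟩
    have := mul_transport A finSumFinEquiv (finSumFinEquiv.trans (Equiv.ofBijective _ hb))
      (Equiv.refl _) (Equiv.refl _) (Equiv.ofBijective _ hb) (by ext x; simp) a.elt b.elt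
    rwa [transport_refl, transport_refl] at this
  · rw [q_single_eq_zero hw, map_zero, map_zero]

/-- Together with `toElt_d_mem`, this matches the boundaries in degree one with the decomposables.
It holds for every algebra: freeness is only needed for exactness in higher degrees. -/
theorem ofElt_mem_range_d {a : A.X ℓ} (ha : a ∈ decomposables A ℓ) :
    ofElt A ℓ a ∈ LinearMap.range (d A 1 (Fin ℓ)) := by
  have : decomposables A ℓ ≤ (LinearMap.range (d A 1 (Fin ℓ))).comap (ofElt A ℓ) := by
    refine Submodule.span_le.2 ?_
    rintro _ ⟨p, r, σ, a, b, rfl⟩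
    let s : Letter A.X (Fin ℓ) := ⟨p, σ ∘ Sum.inl, a⟩
    let t : Letter A.X (Fin ℓ) := ⟨r, σ ∘ Sum.inr, b⟩
    refine ⟨q A.X 2 (Fin ℓ) (Finsupp.single [s, t] 1), ?_⟩
    have h1 : bdry [s, t] = Finsupp.single [mulLetter s t] (1 : k) := by
      simp [bdry, mulFirst]
    rw [d_q, bdryL_single, h1]
    refine respects_q.congr (t := ⟨ℓ, id, A.mul σ a b⟩) ?_ [] []
    refine mulLetter_equiv (s := s) (t := t) (u := ⟨ℓ, id, A.mul σ a b⟩) σ ?_ rfl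
    ext (x | x) <;> rfl
  exact this ha

theorem toElt_relabel (π : Equiv.Perm (Fin ℓ)) (x : BarMod A.X 1 (Fin ℓ)) :
    toElt A ℓ (relabel π x) = (A.X ℓ).ρ π (toElt A ℓ x) := by
  obtain ⟨a, rfl⟩ : ∃ a, ofElt A ℓ a = x := ⟨_, ofElt_toElt x⟩
  rw [toElt_ofElt]
  have : relabel π (ofElt A ℓ a) = ofElt A ℓ ((A.X ℓ).ρ π a) := by
    refine (congrArg (q A.X 1 (Fin ℓ)) (relabelL_single π _)).trans ?_
    exact respects_q.balanced [] [] ℓ id π a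
  rw [this, toElt_ofElt]

theorem toElt_map {B : ReducedCommShuffleAlg k} (f : ∀ ℓ, A.X ℓ ⟶ B.X ℓ)
    (x : BarMod A.X 1 (Fin ℓ)) :
    toElt B ℓ (map 1 (Fin ℓ) f x) = (f ℓ).hom (toElt A ℓ x) := by
  obtain ⟨a, rfl⟩ : ∃ a, ofElt A ℓ a = x := ⟨_, ofElt_toElt x⟩
  rw [toElt_ofElt]
  have : map 1 (Fin ℓ) f (ofElt A ℓ a) = ofElt B ℓ ((f ℓ).hom a) :=
    congrArg (q B.X 1 (Fin ℓ)) (mapL_single f _)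
  rw [this, toElt_ofElt]

end BarMod

theorem barDecomposables_one_toElt (A : ReducedCommShuffleAlg k) (ℓ : ℕ) :
    barDecomposables A 1 ℓ ≤ (decomposables A ℓ).comap (BarMod.toElt A ℓ) := by
  rw [BarMod.barDecomposables_one]
  exact bot_le

variable (k) in
/-- The natural map from the indecomposables of the bar construction in degree one to the
indecomposables of the algebra. -/
def barIndecAug (ℓ : ℕ) : barIndec k 1 ℓ ⟶ indecomposables k ℓ where
  app A := Rep.ofHom
    { toLinearMap := Submodule.mapQ _ _ (BarMod.toElt A ℓ) (barDecomposables_one_toElt A ℓ)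
      isIntertwining' := fun π => by
        refine Submodule.linearMap_qext _ (LinearMap.ext fun x => ?_)
        exact congrArg (Submodule.mkQ _) (BarMod.toElt_relabel π x) }
  naturality A B g := by
    ext : 2
    refine Submodule.linearMap_qext _ (LinearMap.ext fun x => ?_)
    exact congrArg (Submodule.mkQ _) (BarMod.toElt_map g.f x)

theorem barIndecD_comp_aug (ℓ : ℕ) : barIndecD k 1 ℓ ≫ barIndecAug k ℓ = 0 := by
  ext A : 4
  refine Submodule.linearMap_qext _ (LinearMap.ext fun x => ?_)
  exact (Submodule.Quotient.mk_eq_zero _).2 (BarMod.toElt_d_mem x)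

end

end ShuffleAlg

namespace ShuffleAlg

noncomputable section

open Limits HomologicalComplex

variable {k : Type u} [CommRing k]

/-! ### The resolution of the bar indecomposables -/

/-- Exactness is detected on underlying modules, so preimages need not be chosen equivariantly. This
is what permits the choice of a position `s₀`. -/
theorem rep_exact_iff {G : Type} [Group G] (S : ShortComplex (Rep.{u} k G)) :
    S.Exact ↔ ∀ x : S.X₂, S.g.hom x = 0 → ∃ y : S.X₁, S.f.hom y = x := by
  rw [← ShortComplex.exact_map_iff_of_faithful S (forget₂ (Rep k G) (ModuleCat k)),
    ShortComplex.moduleCat_exact_iff]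
  rfl

theorem barIndecD_exact (A : ReducedCommShuffleAlg k) (s ℓ : ℕ) :
    (ShortComplex.mk ((barIndecD k (s + 2) ℓ).app ((freeFunctor k).obj A))
      ((barIndecD k (s + 1) ℓ).app ((freeFunctor k).obj A))
      (NatTrans.congr_app (barIndecD_comp (s + 1) ℓ) _)).Exact := by
  rw [rep_exact_iff]
  intro x hx
  obtain ⟨x, rfl⟩ := Submodule.mkQ_surjective _ x
  obtain ⟨y, hy⟩ := BarMod.exists_d_sub_mem_barDecomposables A.reduced s ℓ x
    ((Submodule.Quotient.mk_eq_zero _).1 hx)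
  exact ⟨Submodule.mkQ _ y, (Submodule.Quotient.eq _).2 hy⟩

theorem barIndecAug_exact (A : ReducedCommShuffleAlg k) (ℓ : ℕ) :
    (ShortComplex.mk ((barIndecD k 1 ℓ).app A) ((barIndecAug k ℓ).app A)
      (NatTrans.congr_app (barIndecD_comp_aug ℓ) _)).Exact := by
  rw [rep_exact_iff]
  intro x hx
  obtain ⟨x, rfl⟩ := Submodule.mkQ_surjective _ x
  obtain ⟨y, hy⟩ := BarMod.ofElt_mem_range_d ((Submodule.Quotient.mk_eq_zero _).1 hx)
  rw [BarMod.ofElt_toElt] at hy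
  exact ⟨Submodule.mkQ _ y, congrArg (Submodule.mkQ _) hy⟩

instance (A : ReducedCommShuffleAlg k) (ℓ : ℕ) : Epi ((barIndecAug k ℓ).app A) := by
  rw [Rep.epi_iff_surjective]
  intro x
  obtain ⟨x, rfl⟩ := Submodule.mkQ_surjective _ x
  exact ⟨Submodule.mkQ _ (BarMod.ofElt A ℓ x), congrArg (Submodule.mkQ _) (BarMod.toElt_ofElt x)⟩

/-! ### The extra degeneracy -/

theorem freeUnit_counit (A : ReducedCommShuffleAlg k) (ℓ : ℕ) :
    freeUnit A.X ℓ ≫ ((freeCounit k).app A).f ℓ = 𝟙 (A.X ℓ) := by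
  ext x
  change eval A ℓ (FreeMod.mk [⟨ℓ, id, x⟩]) = x
  rw [eval_mk, evalWord_some (s := ⟨ℓ, id, x⟩) rfl,
    Letter.toElt_of_equiv _ (Equiv.refl (Fin ℓ)) rfl]
  exact transport_refl _ _

theorem freeUnit_naturality {A B : ReducedCommShuffleAlg k} (g : A ⟶ B) (ℓ : ℕ) :
    freeUnit A.X ℓ ≫ ((freeFunctor k).map g).f ℓ = g.f ℓ ≫ freeUnit B.X ℓ := by
  ext x
  exact FreeMod.map_mk g.f [⟨ℓ, id, x⟩]

/-- The indecomposables of the bar construction only depend on the underlying symmetric sequence,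
so that the unit of the free algebra induces an extra degeneracy. -/
def barIndecDegeneracy (A : ReducedCommShuffleAlg k) (s ℓ n : ℕ) :
    (barIndec k s ℓ).obj (standardObj (freeFunctor k) A n) ⟶
      (barIndec k s ℓ).obj (standardObj (freeFunctor k) A (n + 1)) :=
  barIndecMap (B := (freeFunctor k).obj (standardObj (freeFunctor k) A n))
    (freeUnit (standardObj (freeFunctor k) A n).X) s ℓ

/-- The zeroth face is the structure map of a free algebra, and the unit is a section of it. Every
other face is the free functor applied to a face one level below, and the unit is natural. Both are
identities between maps of symmetric sequences, which is enough for `barIndecMap`. -/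
theorem extraDegeneracy (A : ReducedCommShuffleAlg k) (s ℓ : ℕ) :
    ExtraDegeneracy (freeFunctor k) (freeCounit k) (barIndecDegeneracy A s ℓ) where
  zero n := by
    have h : standardFace (freeFunctor k) (freeCounit k) A n 0 = (freeCounit k).app _ := by
      cases n <;> rfl
    rw [h]
    refine (barIndecMap_comp _ _ s ℓ).symm.trans ?_
    exact (congrArg (fun f => barIndecMap f s ℓ) (funext (freeUnit_counit _))).trans
      (barIndecMap_id _ s ℓ)
  succ n j := by
    refine (barIndecMap_comp _ _ s ℓ).symm.trans ?_
    refine Eq.trans ?_ (barIndecMap_comp _ _ s ℓ)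
    exact congrArg (fun f => barIndecMap f s ℓ) (funext (freeUnit_naturality _))

/-! ### Comparison of the homology theories -/

/-- The standard complexes of the indecomposables of the bar construction. -/
abbrev barResolution (A : ReducedCommShuffleAlg k) (ℓ s : ℕ) :
    ChainComplex (Rep.{u} k (Equiv.Perm (Fin ℓ))) ℕ :=
  standardComplex (freeFunctor k) (freeCounit k) (barIndec k s ℓ) A

/-- The differential of the bar construction on standard complexes. -/
abbrev barResolutionD (A : ReducedCommShuffleAlg k) (ℓ s : ℕ) :
    barResolution A ℓ (s + 1) ⟶ barResolution A ℓ s :=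
  standardMap (freeFunctor k) (freeCounit k) (barIndecD k s ℓ) A

theorem barResolutionD_comp (A : ReducedCommShuffleAlg k) (ℓ s : ℕ) :
    barResolutionD A ℓ (s + 1) ≫ barResolutionD A ℓ s = 0 := by
  ext n : 1
  exact NatTrans.congr_app (barIndecD_comp s ℓ) _

/-- The augmentation onto the complex which computes André–Quillen homology. -/
abbrev barResolutionAug (A : ReducedCommShuffleAlg k) (ℓ : ℕ) :
    barResolution A ℓ 1 ⟶ aqComplex A ℓ :=
  standardMap (freeFunctor k) (freeCounit k) (barIndecAug k ℓ) A

theorem barResolutionD_comp_aug (A : ReducedCommShuffleAlg k) (ℓ : ℕ) :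
    barResolutionD A ℓ 1 ≫ barResolutionAug A ℓ = 0 := by
  ext n : 1
  exact NatTrans.congr_app (barIndecD_comp_aug ℓ) _

instance (A : ReducedCommShuffleAlg k) (ℓ : ℕ) : Epi (barResolutionAug A ℓ) :=
  have (n : ℕ) : Epi ((barResolutionAug A ℓ).f n) :=
    inferInstanceAs (Epi ((barIndecAug k ℓ).app _))
  HomologicalComplex.epi_of_epi_f _ this

/-- Every simplicial degree of the standard resolution is a free algebra. Hence the bar
indecomposables in degrees one and higher resolve the complex of `Q_a` degreewise, and for each bar
degree the extra degeneracy leaves homology in degree zero only. -/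
theorem andreQuillen_iso (A : ReducedCommShuffleAlg k) (r ℓ : ℕ) :
    Nonempty ((aqComplex A ℓ).homology r ≅
      (homologyZeroComplex (barResolution A ℓ) (barResolutionD A ℓ)
        (barResolutionD_comp A ℓ) r).homology) := by
  refine homology_iso_of_resolution (barResolution A ℓ) (barResolutionD_comp A ℓ) (fun s => ?_) ?_
    (fun s => (extraDegeneracy A (s + 1) ℓ).isZero_homology) (barResolutionAug A ℓ)
    (barResolutionD_comp_aug A ℓ) ?_ r
  · exact HomologicalComplex.exact_of_degreewise_exact _ fun n => barIndecD_exact _ s ℓ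
  · rw [IsZero.iff_id_eq_zero]
    ext n : 1
    exact (isZero_barIndecObj_zero _ ℓ).eq_of_src _ _
  · exact HomologicalComplex.exact_of_degreewise_exact _ fun n => barIndecAug_exact _ ℓ

/-- The isomorphisms of `H₀` with `Indec B_s(A)` for `s = r + 2, r + 1, r` commute with the
differentials; the middle term sits in Harrison degree `r + 1`, which is the source of the shift. -/
theorem harrison_iso (A : ReducedCommShuffleAlg k) (r ℓ : ℕ) :
    Nonempty ((homologyZeroComplex (barResolution A ℓ) (barResolutionD A ℓ)
      (barResolutionD_comp A ℓ) r).homology ≅ (harrisonComplex A ℓ).homology (r + 1)) := by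
  have h (s : ℕ) := (extraDegeneracy A (s + 1) ℓ).homologyZeroIso_naturality
    (extraDegeneracy A s ℓ) (barIndecD k s ℓ)
  refine ⟨ShortComplex.homologyMapIso (ShortComplex.isoMk
    (extraDegeneracy A (r + 2) ℓ).homologyZeroIso (extraDegeneracy A (r + 1) ℓ).homologyZeroIso
    (extraDegeneracy A r ℓ).homologyZeroIso ?_ ?_) ≪≫
    ((harrisonComplex A ℓ).homologyIsoSc' (r + 2) (r + 1) r (by simp) (by simp)).symm⟩
  · exact (congrArg (_ ≫ ·) (harrisonComplex_d A (r + 1) ℓ)).trans (h (r + 1)).symm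
  · exact (congrArg (_ ≫ ·) (harrisonComplex_d A r ℓ)).trans (h r).symm

theorem isZero_harrison_zero (A : ReducedCommShuffleAlg k) (ℓ : ℕ) : IsZero (harrison A 0 ℓ) :=
  ShortComplex.isZero_homology_of_isZero_X₂ _ (isZero_barIndecObj_zero A ℓ)

end

end ShuffleAlg

/-- For a reduced commutative shuffle algebra `A` which is levelwise `k`-projective, there are
isomorphisms of symmetric sequences `AQ_*(A) ≅ Σ⁻¹ Harr_*(A)`: one has `AQ_r(A) ≅ Harr_{r+1}(A)` for
all `r ≥ 0`, and the remaining group `Harr_0(A)`, in degree `-1` of `Σ⁻¹ Harr_*(A)`, is zero. -/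
theorem theorem3p4 {k : Type u} [CommRing k] (A : ShuffleAlg.ReducedCommShuffleAlg k)
    (hA : ∀ ℓ : ℕ, Module.Projective k (A.X ℓ)) :
    (∀ r : ℕ, Nonempty (ShuffleAlg.andreQuillen A r ≅ ShuffleAlg.harrison A (r + 1))) ∧
      ∀ ℓ : ℕ, Limits.IsZero (ShuffleAlg.harrison A 0 ℓ) := by
  -- Different levels of a symmetric sequence are not linked by any structure, so levelwise
  -- isomorphisms of representations suffice.
  refine ⟨fun r => ⟨Pi.isoMk fun ℓ => ?_⟩, ShuffleAlg.isZero_harrison_zero A⟩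
  exact (ShuffleAlg.andreQuillen_iso A r ℓ).some ≪≫ (ShuffleAlg.harrison_iso A r ℓ).some
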